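/- **Theorem 8.3 (Helicity integrals on $S^3$ and $H^3$).** *Conventions.* $S^3=\{x\in\mathbb R^4:\langle x,x\rangle=1\}$ is the unit sphere, identified with the group of unit quaternions by $x\leftrightarrow x_0+x_1i+x_2j+x_3k$. With $\langle x,y\rangle_{M}=x_0y_0-x_1y_1-x_2y_2-x_3y_3$, hyperbolic space is $H^3=\{x\in\mathbb R^4:\langle x,x\rangle_{M}=1,\ x_0>0\}$ with the Riemannian inner product $v\cdot w=-\langle v,w\rangle_{M}$ on tangent vectors; on $S^3$, $v\cdot w=\langle v,w\rangle$ is the Euclidean product. In both spaces $dx$, $dy$ denote Riemannian volume, $\nabla_x,\nabla_y$ the Riemannian gradient in the indicated variable, $\alpha(x,y)$ the geodesic distance, $\varphi(x,y)=\varphi(\alpha(x,y))$, and the cross product at a point $x$ is the one with $(u\times v)\cdot w=\det[x,u,v,w]$ (determinant of the matrix with these rows). $P_{yx}$ is parallel transport from $x$ to $y$ along the geodesic segment, and on $S^3$, $L_{yx^{-1}}$ is the differential of left translation by $yx^{-1}$, i.e. $L_{yx^{-1}}v=yx^{-1}v$. *Biot–Savart operator and helicity.* For a smooth vector field $v$ on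 $S^3$ there is a unique smooth vector field $B=\mathrm{BS}(v)$ on $S^3$ with $$\nabla\cdot B=0,\qquad \nabla\times B(y)=v(y)+\nabla_y\int_{S^3}v(x)\cdot\nabla_x\varphi_0(x,y)\,dx,$$ where $\varphi_0(\alpha)=-(\pi-\alpha)\cot\alpha/(4\pi^2)$ is the fundamental solution of the Laplacian on $S^3$. For a smooth compactly supported vector field $v$ on $H^3$ put $$\mathrm{BS}(v)(y)=\int_{H^3}P_{yx}v(x)\times\nabla_y\varphi_0(x,y)\,dx,\qquad \varphi_0(\alpha)=-\operatorname{csch}\alpha/(4\pi).$$ In both cases define the helicity $H(v)=\int \mathrm{BS}(v)(y)\cdot v(y)\,dy$ over the whole space. *Statement.* The integrals in (1)–(3), those defining $H(v)$, and the one defining $\mathrm{BS}(v)$ on $H^3$ converge absolutely, and the following hold. (1) For every smooth vector field $v$ on $S^3$ (left-translation format), $$\begin{aligned}H(v)={}&\int_{S^3\times S^3}L_{yx^{-1}}v(x)\times v(y)\cdot\nabla_y\varphi(x,y)\,dx\,dy-\frac1{4\pi^2}\int_{S^3\times S^3}L_{yx^{-1}}v(x)\cdot v(y)\,dx\,dy\\&+2\int_{S^3\times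 S^3}\nabla_y\bigl(L_{yx^{-1}}v(x)\cdot\nabla_y\varphi_1(x,y)\bigr)\cdot v(y)\,dx\,dy,\end{aligned}$$ where $\varphi(\alpha)=(\pi-\alpha)\cot\alpha/(4\pi^2)$ and $\varphi_1(\alpha)=-\alpha(2\pi-\alpha)/(16\pi^2)$. (2) For every smooth vector field $v$ on $S^3$ (parallel transport format), $$H(v)=\int_{S^3\times S^3}P_{yx}v(x)\times v(y)\cdot\nabla_y\varphi(x,y)\,dx\,dy,\qquad \varphi(\alpha)=(\pi-\alpha)\csc\alpha/(4\pi^2).$$ (3) For every smooth compactly supported vector field $v$ on $H^3$ (parallel transport format), $$H(v)=\int_{H^3\times H^3}P_{yx}v(x)\times v(y)\cdot\nabla_y\varphi(x,y)\,dx\,dy,\qquad \varphi(\alpha)=\operatorname{csch}\alpha/(4\pi).$$ -/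

import Mathlib

open MeasureTheory
open scoped RealInnerProductSpace Manifold ContDiff

noncomputable section

/-- `ℝ³` with its Euclidean structure. -/
abbrev E3 : Type := EuclideanSpace ℝ (Fin 3)

/-- `ℝ⁴` with its Euclidean structure; coordinates are `x 0, x 1, x 2, x 3`. -/
abbrev E4 : Type := EuclideanSpace ℝ (Fin 4)

instance factFinrankE4 : Fact (Module.finrank ℝ E4 = 3 + 1) := ⟨by simp⟩

/-- The determinant of the `4 × 4` matrix with rows `a`, `b`, `c`, `d`. -/
def det4 (a b c d : E4) : ℝ := Matrix.det (Matrix.of ![⇑a, ⇑b, ⇑c, ⇑d])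

/-- The `k`-th vector of the canonical basis of `ℝ⁴`. -/
def stdVec (k : Fin 4) : E4 := EuclideanSpace.single k 1

/-! ### The unit 3-sphere -/

/-- The unit sphere of `ℝ⁴`, with Mathlib's smooth structure. -/
abbrev S3 : Type := Metric.sphere (0 : E4) 1

namespace S3

/-- The Riemannian volume on the unit 3-sphere (surface measure, of total mass `2 π ^ 2`). -/
def vol : Measure S3 := (volume : Measure E4).toSphere

/-- The north pole, used only as a default value. -/
def pole : S3 := ⟨stdVec 0, by simp [stdVec]⟩

open Classical in
/-- Radial projection `z ↦ z / ‖z‖` of `ℝ⁴ \ {0}` onto the sphere. -/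
def proj (z : E4) : S3 :=
  if h : z ≠ 0 then ⟨‖z‖⁻¹ • z, by simp [norm_smul, h]⟩ else pole

/-- Geodesic distance on the unit sphere. -/
def geoDist (x y : S3) : ℝ := Real.arccos ⟪(x : E4), (y : E4)⟫

/-- A smooth tangent vector field on the sphere, viewed as an `ℝ⁴`-valued map. -/
structure IsSmoothField (v : S3 → E4) : Prop where
  smooth : ContMDiff (𝓡 3) 𝓘(ℝ, E4) ∞ v
  tangent : ∀ x : S3, ⟪(x : E4), v x⟫ = 0

/-- Riemannian gradient at `y` of a function on the sphere: the Euclidean gradient of its extension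
to `ℝ⁴ \ {0}` that is constant along rays (whose radial derivative is zero). -/
def grad (f : S3 → ℝ) (y : S3) : E4 := gradient (fun z : E4 => f (proj z)) (y : E4)

/-- Cross product of tangent vectors at `x`: the formal determinant with
rows `x`, `v`, `w` and the canonical basis vectors. -/
def cross (x : S3) (v w : E4) : E4 := WithLp.toLp 2 fun k => det4 x v w (stdVec k)

/-- Directional derivative at `y`, in direction `w`, of the extension of a vector field that is
constant along rays. For `w` tangent at `y` its tangential part is the covariant derivative. -/
def dirDeriv (v : S3 → E4) (y : S3) (w : E4) : E4 :=
  fderiv ℝ (fun z : E4 => v (proj z)) (y : E4) w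

/-- Divergence on the sphere of a tangent field: the trace of its derivative. (The radial direction
contributes nothing, since `dirDeriv v y y = 0`.) -/
def div (v : S3 → E4) (y : S3) : ℝ := ∑ k : Fin 4, (dirDeriv v y (stdVec k)) k

/-- Curl on the sphere of a tangent field, `∑ e × ∇_e v` over an orthonormal frame `e`; here the
frame is the canonical one of `ℝ⁴`, as the radial direction contributes nothing and `cross y`
ignores the radial parts of its arguments. -/
def curl (v : S3 → E4) (y : S3) : E4 :=
  ∑ k : Fin 4, cross y (stdVec k) (dirDeriv v y (stdVec k))

/-- The identification of `ℝ⁴` with the quaternions,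
`(x₀, x₁, x₂, x₃) ↔ x₀ + x₁ i + x₂ j + x₃ k`. -/
def toQuat (x : E4) : Quaternion ℝ := Quaternion.linearIsometryEquivTuple.symm x

/-- The inverse identification. -/
def ofQuat (q : Quaternion ℝ) : E4 := Quaternion.linearIsometryEquivTuple q

/-- The differential of left translation by `y x⁻¹` in the group of unit quaternions. It carries
tangent vectors at `x` to tangent vectors at `y`. -/
def leftTrans (y x : S3) (v : E4) : E4 := ofQuat (toQuat y * (toQuat x)⁻¹ * toQuat v)

/-- Parallel transport from `x` to `y` along the geodesic segment between these points (for points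
that are not antipodal). -/
def transport (y x : S3) (v : E4) : E4 :=
  v - (⟪(y : E4), v⟫ / (1 + ⟪(y : E4), (x : E4)⟫)) • ((x : E4) + (y : E4))

/-- `∇_y φ(x, y)`, where `φ(x, y) = φ (α(x, y))` and `α` is the geodesic distance. -/
def gradSnd (φ : ℝ → ℝ) (x y : S3) : E4 := grad (fun y' => φ (geoDist x y')) y

/-- `∇_x φ(x, y)`. -/
def gradFst (φ : ℝ → ℝ) (x y : S3) : E4 := grad (fun x' => φ (geoDist x' y)) x

/-- The kernel `(π - α) cot α / (4 π²)`. Its negative is the fundamental solution of the Laplacian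
on the sphere, `Δ(-φ) = δ - 1 / (2 π²)`. -/
def phiLeft (α : ℝ) : ℝ := (Real.pi - α) * Real.cot α / (4 * Real.pi ^ 2)

/-- The kernel `-α (2π - α) / (16 π²)`. -/
def phiOne (α : ℝ) : ℝ := -α * (2 * Real.pi - α) / (16 * Real.pi ^ 2)

/-- The kernel `(π - α) csc α / (4 π²)`. -/
def phiPar (α : ℝ) : ℝ := (Real.pi - α) / Real.sin α / (4 * Real.pi ^ 2)

/-- `B` is the magnetic field of the current flow `v`: it is a smooth field, it is divergence-free,
and it satisfies Maxwell's equation `curl B = v + ∇_y ∫ v(x) · ∇_x φ₀(x, y) dx`, where `φ₀` is the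
fundamental solution of the Laplacian. -/
structure IsMagneticField (v B : S3 → E4) : Prop where
  isSmoothField : IsSmoothField B
  div_eq_zero : ∀ y, div B y = 0
  maxwell : ∀ y, curl B y =
    v y + grad (fun y' => ∫ x, ⟪v x, gradFst (fun α => -phiLeft α) x y'⟫ ∂vol) y

open Classical in
/-- The Biot-Savart operator: `BS v` is the magnetic field of the current flow `v`. -/
def BS (v : S3 → E4) : S3 → E4 :=
  if h : ∃ B, IsMagneticField v B then h.choose else 0

/-- The helicity of `v`. -/
def helicity (v : S3 → E4) : ℝ := ∫ y, ⟪BS v y, v y⟫ ∂vol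

/-- `L_{y x⁻¹} v(x) × v(y) · ∇_y φ(x, y)` for `φ(α) = (π - α) cot α / (4 π²)`. -/
def leftIntegrand₁ (v : S3 → E4) (p : S3 × S3) : ℝ :=
  ⟪cross p.2 (leftTrans p.2 p.1 (v p.1)) (v p.2), gradSnd phiLeft p.1 p.2⟫

/-- `L_{y x⁻¹} v(x) · v(y)`. -/
def leftIntegrand₂ (v : S3 → E4) (p : S3 × S3) : ℝ :=
  ⟪leftTrans p.2 p.1 (v p.1), v p.2⟫

/-- `∇_y (L_{y x⁻¹} v(x) · ∇_y φ₁(x, y)) · v(y)`. -/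
def leftIntegrand₃ (v : S3 → E4) (p : S3 × S3) : ℝ :=
  ⟪grad (fun y => ⟪leftTrans y p.1 (v p.1), gradSnd phiOne p.1 y⟫) p.2, v p.2⟫

/-- `P_{yx} v(x) × v(y) · ∇_y φ(x, y)` for `φ(α) = (π - α) csc α / (4 π²)`. -/
def parIntegrand (v : S3 → E4) (p : S3 × S3) : ℝ :=
  ⟪cross p.2 (transport p.2 p.1 (v p.1)) (v p.2), gradSnd phiPar p.1 p.2⟫

end S3

/-! ### Hyperbolic 3-space -/

/-- The Minkowski form `x₀ y₀ - x₁ y₁ - x₂ y₂ - x₃ y₃` on `ℝ⁴`. -/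
def mink (x y : E4) : ℝ := x 0 * y 0 - x 1 * y 1 - x 2 * y 2 - x 3 * y 3

/-- Hyperbolic 3-space: the upper sheet of the hyperboloid `⟨x, x⟩ = 1`. -/
abbrev H3 : Type := {x : E4 // mink x x = 1 ∧ 0 < x 0}

namespace H3

/-- The global chart of the hyperboloid as a graph over `ℝ³`:
`u ↦ (√(1 + |u|²), u₁, u₂, u₃)`. -/
def ofE3 (u : E3) : H3 :=
  ⟨!₂[Real.sqrt (1 + ‖u‖ ^ 2), u 0, u 1, u 2], by
    have h : (0 : ℝ) < 1 + ‖u‖ ^ 2 := by positivity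
    refine ⟨?_, by simpa using h⟩
    have h2 := EuclideanSpace.real_norm_sq_eq u
    simp only [Fin.sum_univ_three] at h2
    simp [mink, Real.mul_self_sqrt h.le]
    linarith⟩

/-- The hyperbolic volume, which in the chart `ofE3` is `du / √(1 + |u|²)`. -/
def vol : Measure H3 :=
  ((volume : Measure E3).withDensity
    fun u => ENNReal.ofReal (Real.sqrt (1 + ‖u‖ ^ 2))⁻¹).map ofE3

/-- The point `(1, 0, 0, 0)`, used only as a default value. -/
def pole : H3 := ofE3 0

open Classical in
/-- Radial projection `z ↦ z / √⟨z, z⟩` of the open forward cone onto the hyperboloid. -/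
def proj (z : E4) : H3 :=
  if h : 0 < mink z z ∧ 0 < z 0 then
    ⟨(Real.sqrt (mink z z))⁻¹ • z, by
      obtain ⟨h1, h2⟩ := h
      have h3 : 0 < Real.sqrt (mink z z) := Real.sqrt_pos.2 h1
      refine ⟨?_, by simpa using mul_pos (inv_pos.2 h3) h2⟩
      have h4 : mink ((Real.sqrt (mink z z))⁻¹ • z) ((Real.sqrt (mink z z))⁻¹ • z)
          = (Real.sqrt (mink z z))⁻¹ ^ 2 * mink z z := by
        simp only [mink, PiLp.smul_apply, smul_eq_mul]
        ring
      rw [h4, inv_pow, Real.sq_sqrt h1.le, inv_mul_cancel₀ h1.ne']⟩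
  else pole

/-- The Riemannian inner product of tangent vectors, `v · w = -⟨v, w⟩`. -/
def dot (v w : E4) : ℝ := -mink v w

/-- Geodesic distance: `cosh α = ⟨x, y⟩`. -/
def geoDist (x y : H3) : ℝ := Real.arcosh (mink x y)

/-- A smooth tangent vector field on hyperbolic space, viewed as an `ℝ⁴`-valued map. -/
structure IsSmoothField (v : H3 → E4) : Prop where
  smooth : ContDiff ℝ ∞ (fun u : E3 => v (ofE3 u))
  tangent : ∀ x : H3, mink x (v x) = 0

/-- Reflection in the `0`-th coordinate: it turns the Euclidean into the Minkowski gradient. -/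
def flip (w : E4) : E4 := !₂[-w 0, w 1, w 2, w 3]

/-- Riemannian gradient at `y` of a function on hyperbolic space. It is the vector that represents,
with respect to `dot`, the derivative of the extension that is constant along rays; since the radial
derivative of the extension is zero, it is tangent at `y`. -/
def grad (f : H3 → ℝ) (y : H3) : E4 := flip (gradient (fun z : E4 => f (proj z)) (y : E4))

/-- Cross product of tangent vectors at `x`: the formal determinant with rows `x`, `v`, `w` and
`(-e₀, e₁, e₂, e₃)`, so that `dot (cross x v w) u = det4 x v w u`. -/
def cross (x : H3) (v w : E4) : E4 := flip (WithLp.toLp 2 fun k => det4 x v w (stdVec k))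

/-- Parallel transport from `x` to `y` along the geodesic segment between these points. -/
def transport (y x : H3) (v : E4) : E4 :=
  v - (mink y v / (1 + mink y x)) • ((x : E4) + (y : E4))

/-- `∇_y φ(x, y)`, where `φ(x, y) = φ (α(x, y))` and `α` is the geodesic distance. -/
def gradSnd (φ : ℝ → ℝ) (x y : H3) : E4 := grad (fun y' => φ (geoDist x y')) y

/-- The kernel `csch α / (4 π)`. -/
def phiPar (α : ℝ) : ℝ := (Real.sinh α)⁻¹ / (4 * Real.pi)

/-- The integrand `P_{yx} v(x) × ∇_y φ₀(x, y)` of the Biot-Savart operator, where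
`φ₀(α) = -csch α / (4 π)`. -/
def BSIntegrand (v : H3 → E4) (y x : H3) : E4 :=
  cross y (transport y x (v x)) (gradSnd (fun α => -phiPar α) x y)

/-- The Biot-Savart operator on hyperbolic space. -/
def BS (v : H3 → E4) (y : H3) : E4 := ∫ x, BSIntegrand v y x ∂vol

/-- The helicity of `v`. -/
def helicity (v : H3 → E4) : ℝ := ∫ y, dot (BS v y) (v y) ∂vol

/-- `P_{yx} v(x) × v(y) · ∇_y φ(x, y)` for `φ(α) = csch α / (4 π)`. -/
def parIntegrand (v : H3 → E4) (p : H3 × H3) : ℝ :=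
  dot (cross p.2 (transport p.2 p.1 (v p.1)) (v p.2)) (gradSnd phiPar p.1 p.2)

end H3

end

/-!
Helicity on the 3-sphere and in hyperbolic 3-space as a double integral.

**The sphere.** The sphere is the group of unit quaternions, and its left-invariant frame
`frame i x = x eᵢ` trivializes everything: a tangent field becomes a triple of functions, left
translation preserves components (`leftTrans_frame`), gradient, divergence and curl become
`D i f`, `∑ D i (u i)` and the curl of `ℝ³` corrected by `-2 u`, where the frame derivatives satisfy
`[D 0, D 1] = 2 D 2` cyclically. Right translations preserve the volume, so frame derivatives
integrate to zero (`integral_D`) and can be integrated by parts. Applied to the dilated function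
`-log (1 - l ⟪x, y⟫)`, `l < 1`, this already shows that `(1 - ⟪x, y⟫)⁻¹` is integrable
(`integrable_inv`), which carries all convergence statements and, as `l → 1`, integration by parts
against singular kernels (`IsKernel.integral_mul_D`).

The kernels are elementary expressions in `A s = (π - α) csc α`, `s = cos α`. The Laplacian of the
dilated fundamental solution is a nonnegative approximate identity minus a constant (`peak`), and
hence convolution with the fundamental solution inverts the Laplacian up to mean values
(`conv_F0_lap`). Convolution with a zonal kernel is an average of left translates, so it commutes
with the frame derivatives. Writing `G` and `G₁` for the convolutions with `F0` and `F1`, where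
`Δ F1 = F0` up to a constant, the field `magComp` with components
`-(curl of ℝ³ of G u) - (1 / 4π²) ∫ u + 2 grad G₁ (div u)` solves Maxwell's equation
(`divComp_magComp`, `curlComp_magComp`) by the commutation relations alone. The solution is unique
because a divergence-free and curl-free field has harmonic, hence constant, components `u`, and then
its curl is `-2 u` (`eq_zero_of_curlComp_of_divComp`). Pairing with `v`, moving the derivatives onto
the kernels and using Fubini yields the left-translation format (`helicity_eq_left`). The parallel
transport format follows from it, because the integrands agree pointwise away from coinciding and
antipodal points (`parIntegrand_eq`); this is a polynomial identity modulo the equation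
`(1 - s ^ 2) A' = 1 + s A`.

**Hyperbolic space.** The Biot-Savart operator is an integral, so that the formula is Fubini's theorem
together with the antisymmetry of the triple product. Absolute convergence holds since the
gradient of the kernel is of the order of the inverse square of the distance, which in the chart
over `ℝ³` is locally integrable (`exists_lintegral_le`).
-/

namespace S3

/-! ### Quaternionic frames -/

lemma inner_E4 (a b : E4) : ⟪a, b⟫ = a 0 * b 0 + a 1 * b 1 + a 2 * b 2 + a 3 * b 3 := by
  simp [PiLp.inner_apply, Fin.sum_univ_four, mul_comm]

lemma norm_sq_E4 (a : E4) : ‖a‖ ^ 2 = a 0 ^ 2 + a 1 ^ 2 + a 2 ^ 2 + a 3 ^ 2 := by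
  rw [← real_inner_self_eq_norm_sq, inner_E4]; ring

lemma sphere_sq (y : S3) :
    (y : E4) 0 ^ 2 + (y : E4) 1 ^ 2 + (y : E4) 2 ^ 2 + (y : E4) 3 ^ 2 = 1 := by
  rw [← norm_sq_E4]; simp

lemma sphere_ne_zero (y : S3) : (y : E4) ≠ 0 := ne_zero_of_mem_unit_sphere y

lemma inner_self_sphere (y : S3) : ⟪(y : E4), (y : E4)⟫ = 1 := by
  rw [real_inner_self_eq_norm_sq]; simp

/-- The quaternion product, in the coordinates of `ℝ⁴`. -/
noncomputable def qmul (a b : E4) : E4 :=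
  !₂[a 0 * b 0 - a 1 * b 1 - a 2 * b 2 - a 3 * b 3,
    a 0 * b 1 + a 1 * b 0 + a 2 * b 3 - a 3 * b 2,
    a 0 * b 2 - a 1 * b 3 + a 2 * b 0 + a 3 * b 1,
    a 0 * b 3 + a 1 * b 2 - a 2 * b 1 + a 3 * b 0]

@[simp] lemma qmul_zero_apply (a b : E4) :
    qmul a b 0 = a 0 * b 0 - a 1 * b 1 - a 2 * b 2 - a 3 * b 3 := rfl
@[simp] lemma qmul_one_apply (a b : E4) :
    qmul a b 1 = a 0 * b 1 + a 1 * b 0 + a 2 * b 3 - a 3 * b 2 := rfl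
@[simp] lemma qmul_two_apply (a b : E4) :
    qmul a b 2 = a 0 * b 2 - a 1 * b 3 + a 2 * b 0 + a 3 * b 1 := rfl
@[simp] lemma qmul_three_apply (a b : E4) :
    qmul a b 3 = a 0 * b 3 + a 1 * b 2 - a 2 * b 1 + a 3 * b 0 := rfl

lemma ext_E4 {a b : E4} (h0 : a 0 = b 0) (h1 : a 1 = b 1) (h2 : a 2 = b 2) (h3 : a 3 = b 3) :
    a = b := by
  ext k; fin_cases k <;> assumption

lemma ofQuat_mul (a b : E4) : ofQuat (toQuat a * toQuat b) = qmul a b := by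
  have h0 (c : E4) : (toQuat c).re = c 0 := rfl
  have h1 (c : E4) : (toQuat c).imI = c 1 := rfl
  have h2 (c : E4) : (toQuat c).imJ = c 2 := rfl
  have h3 (c : E4) : (toQuat c).imK = c 3 := rfl
  have e (q : Quaternion ℝ) : ofQuat q = !₂[q.re, q.imI, q.imJ, q.imK] := rfl
  rw [e]
  apply ext_E4 <;> simp [h0, h1, h2, h3]

lemma toQuat_qmul (a b : E4) : toQuat (qmul a b) = toQuat a * toQuat b := by
  rw [← ofQuat_mul]
  exact Quaternion.linearIsometryEquivTuple.symm_apply_apply _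

/-- Left multiplication by a quaternion. -/
noncomputable def leftMul (a : E4) : E4 →L[ℝ] E4 :=
  LinearMap.toContinuousLinearMap
    { toFun := qmul a
      map_add' := fun x y => by apply ext_E4 <;> simp <;> ring
      map_smul' := fun c x => by apply ext_E4 <;> simp <;> ring }

@[simp] lemma leftMul_apply (a b : E4) : leftMul a b = qmul a b := rfl

/-- The left-invariant frame: `frame i z` is the quaternion product of `z` with the `i`-th
imaginary unit. -/
noncomputable def frame (i : Fin 3) : E4 →L[ℝ] E4 :=
  LinearMap.toContinuousLinearMap
    { toFun := fun z => qmul z (stdVec i.succ)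
      map_add' := fun x y => by apply ext_E4 <;> simp <;> ring
      map_smul' := fun c x => by apply ext_E4 <;> simp <;> ring }

lemma frame_apply (i : Fin 3) (z : E4) : frame i z = qmul z (stdVec i.succ) := rfl

lemma frame_zero (z : E4) : frame 0 z = !₂[-z 1, z 0, z 3, -z 2] := by
  rw [frame_apply]; apply ext_E4 <;> simp [stdVec]

lemma frame_one (z : E4) : frame 1 z = !₂[-z 2, -z 3, z 0, z 1] := by
  rw [frame_apply]; apply ext_E4 <;> simp [stdVec]

lemma frame_two (z : E4) : frame 2 z = !₂[-z 3, z 2, -z 1, z 0] := by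
  rw [frame_apply]; apply ext_E4 <;> simp [stdVec]

lemma qmul_assoc (a b c : E4) : qmul (qmul a b) c = qmul a (qmul b c) := by
  apply ext_E4 <;> simp <;> ring

lemma frame_qmul (i : Fin 3) (g z : E4) : frame i (qmul g z) = qmul g (frame i z) := by
  simp only [frame_apply, qmul_assoc]

lemma norm_qmul (a b : E4) : ‖qmul a b‖ = ‖a‖ * ‖b‖ := by
  rw [← sq_eq_sq₀ (norm_nonneg _) (by positivity), mul_pow]
  simp only [norm_sq_E4, qmul_zero_apply, qmul_one_apply, qmul_two_apply, qmul_three_apply]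
  ring

lemma inner_qmul_right (g a : E4) : ⟪qmul g a, a⟫ = g 0 * ‖a‖ ^ 2 := by
  simp only [inner_E4, norm_sq_E4, qmul_zero_apply, qmul_one_apply, qmul_two_apply,
    qmul_three_apply]
  ring

lemma inner_frame_self (i : Fin 3) (z : E4) : ⟪frame i z, z⟫ = 0 := by
  fin_cases i <;> simp [inner_E4, frame_zero, frame_one, frame_two] <;> ring

lemma inner_frame_left (i : Fin 3) (x y : E4) : ⟪frame i x, y⟫ = -⟪x, frame i y⟫ := by
  fin_cases i <;> simp [inner_E4, frame_zero, frame_one, frame_two] <;> ring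

lemma inner_frame_frame (i j : Fin 3) (z : E4) :
    ⟪frame i z, frame j z⟫ = if i = j then ‖z‖ ^ 2 else 0 := by
  fin_cases i <;> fin_cases j <;>
    simp [inner_E4, norm_sq_E4, frame_zero, frame_one, frame_two] <;> ring

lemma frame_frame_self (i : Fin 3) (z : E4) : frame i (frame i z) = -z := by
  fin_cases i <;> apply ext_E4 <;> simp [frame_zero, frame_one, frame_two]

lemma norm_frame (i : Fin 3) (z : E4) : ‖frame i z‖ = ‖z‖ := by
  rw [← sq_eq_sq₀ (norm_nonneg _) (norm_nonneg _), ← real_inner_self_eq_norm_sq,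
    inner_frame_frame, if_pos rfl]

lemma frame_one_frame_zero (z : E4) : frame 1 (frame 0 z) = frame 2 z := by
  apply ext_E4 <;> simp [frame_zero, frame_one, frame_two]
lemma frame_zero_frame_one (z : E4) : frame 0 (frame 1 z) = -frame 2 z := by
  apply ext_E4 <;> simp [frame_zero, frame_one, frame_two]
lemma frame_two_frame_one (z : E4) : frame 2 (frame 1 z) = frame 0 z := by
  apply ext_E4 <;> simp [frame_zero, frame_one, frame_two]
lemma frame_one_frame_two (z : E4) : frame 1 (frame 2 z) = -frame 0 z := by
  apply ext_E4 <;> simp [frame_zero, frame_one, frame_two]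
lemma frame_zero_frame_two (z : E4) : frame 0 (frame 2 z) = frame 1 z := by
  apply ext_E4 <;> simp [frame_zero, frame_one, frame_two]
lemma frame_two_frame_zero (z : E4) : frame 2 (frame 0 z) = -frame 1 z := by
  apply ext_E4 <;> simp [frame_zero, frame_one, frame_two]

/-- The vectors `z` and `frame i z` form an orthogonal basis of vectors of length `‖z‖`. -/
lemma frame_expansion (z w : E4) :
    ‖z‖ ^ 2 • w = ⟪z, w⟫ • z + ∑ i, ⟪frame i z, w⟫ • frame i z := by
  simp only [Fin.sum_univ_three, norm_sq_E4, inner_E4]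
  apply ext_E4 <;> simp [frame_zero, frame_one, frame_two] <;> ring

lemma tangent_expansion (y : S3) {w : E4} (hw : ⟪(y : E4), w⟫ = 0) :
    w = ∑ i, ⟪frame i y, w⟫ • frame i (y : E4) := by
  simpa [hw] using frame_expansion (y : E4) w

lemma sum_sq_inner_frame (x y : E4) :
    ∑ i, ⟪frame i x, y⟫ ^ 2 = ‖x‖ ^ 2 * ‖y‖ ^ 2 - ⟪x, y⟫ ^ 2 := by
  simp only [Fin.sum_univ_three, norm_sq_E4, inner_E4]
  simp [frame_zero, frame_one, frame_two]; ring

lemma leftTrans_frame (y x : S3) (i : Fin 3) :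
    leftTrans y x (frame i (x : E4)) = frame i (y : E4) := by
  have hx : toQuat (x : E4) ≠ 0 := by
    rw [toQuat, Ne, LinearIsometryEquiv.map_eq_zero_iff]
    exact sphere_ne_zero x
  rw [leftTrans, frame_apply, toQuat_qmul, mul_assoc, inv_mul_cancel_left₀ hx, ofQuat_mul]
  rfl

lemma leftTrans_sum_frame (y x : S3) (c : Fin 3 → ℝ) :
    leftTrans y x (∑ i, c i • frame i (x : E4)) = ∑ i, c i • frame i (y : E4) := by
  have e : ∀ i, frame i (y : E4) = leftTrans y x (frame i (x : E4)) := fun i =>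
    (leftTrans_frame y x i).symm
  simp only [e]
  simp only [leftTrans, toQuat, ofQuat, map_sum, map_smul, Finset.mul_sum, mul_smul_comm]

/-! ### The radial projection -/

lemma proj_val {z : E4} (hz : z ≠ 0) : (proj z : E4) = ‖z‖⁻¹ • z := by
  simp [proj, hz]

@[simp] lemma proj_coe (y : S3) : proj (y : E4) = y := by
  apply Subtype.ext; rw [proj_val (sphere_ne_zero y)]; simp

lemma qmul_mem_sphere (g y : S3) : qmul (g : E4) y ∈ Metric.sphere (0 : E4) 1 := by
  simp [norm_qmul]

/-- The group law of the sphere of unit quaternions. -/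
noncomputable def mul (g y : S3) : S3 := ⟨qmul g y, qmul_mem_sphere g y⟩

@[simp] lemma coe_mul (g y : S3) : (mul g y : E4) = qmul g y := rfl

lemma qmul_ne_zero (g : S3) {z : E4} (hz : z ≠ 0) : qmul (g : E4) z ≠ 0 := by
  rw [← norm_ne_zero_iff, norm_qmul]; simpa using hz

lemma proj_qmul (g : S3) {z : E4} (hz : z ≠ 0) : proj (qmul (g : E4) z) = mul g (proj z) := by
  apply Subtype.ext
  rw [coe_mul, proj_val hz, proj_val (qmul_ne_zero g hz), norm_qmul, ← leftMul_apply,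
    ← leftMul_apply, map_smul]
  simp

lemma contDiffOn_coe_proj : ContDiffOn ℝ ∞ (fun z => (proj z : E4)) {0}ᶜ := by
  have : ContDiffOn ℝ ∞ (fun z : E4 => ‖z‖⁻¹ • z) {0}ᶜ := by
    intro z hz
    have hz' : z ≠ 0 := hz
    exact (((contDiffAt_norm ℝ hz').inv (by simpa using hz')).smul contDiffAt_id).contDiffWithinAt
  exact this.congr fun z hz => proj_val hz

lemma hasFDerivAt_coe_proj (y : S3) {w : E4} (hw : ⟪(y : E4), w⟫ = 0) :
    fderiv ℝ (fun z => (proj z : E4)) y w = w := by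
  have e : (fun z => (proj z : E4)) =ᶠ[nhds (y : E4)] fun z => ‖z‖⁻¹ • z := by
    filter_upwards [isOpen_compl_singleton.mem_nhds (sphere_ne_zero y)] with z hz
    exact proj_val hz
  rw [e.fderiv_eq]
  have h1 : HasFDerivAt (fun z : E4 => ‖z‖) (innerSL ℝ (y : E4)) (y : E4) := by
    have := (hasStrictFDerivAt_norm_sq (y : E4)).hasFDerivAt.sqrt (by simp)
    have e2 : (fun z : E4 => ‖z‖) = fun z => Real.sqrt (‖z‖ ^ 2) := by
      ext z; rw [Real.sqrt_sq (norm_nonneg z)]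
    rw [e2]
    refine this.congr_fderiv ?_
    ext w
    simp
  have h2 := (hasDerivAt_inv (x := ‖(y : E4)‖) (by simp)).comp_hasFDerivAt _ h1
  have h3 := h2.smul (hasFDerivAt_id (y : E4))
  have h4 : fderiv ℝ (fun z : E4 => ‖z‖⁻¹ • z) y = _ := h3.fderiv
  rw [h4]
  simp [hw]

end S3

namespace S3

/-! ### Calculus along the left-invariant frame -/

variable {F : Type*} [NormedAddCommGroup F] [NormedSpace ℝ F]

/-- Smoothness of a map on the sphere, expressed through its extension to `ℝ⁴ \ {0}` that is
constant along rays. -/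
def IsSmooth (f : S3 → F) : Prop := ContDiffOn ℝ ∞ (fun z : E4 => f (proj z)) {0}ᶜ

/-- The derivative of a map on the sphere along the `i`-th left-invariant vector field. -/
noncomputable def D (i : Fin 3) (f : S3 → F) (y : S3) : F :=
  fderiv ℝ (fun z : E4 => f (proj z)) (y : E4) (frame i (y : E4))

lemma compl_zero_mem_nhds {z : E4} (hz : z ≠ 0) : ({0}ᶜ : Set E4) ∈ nhds z :=
  isOpen_compl_singleton.mem_nhds hz

lemma IsSmooth.contDiffAt {f : S3 → F} (hf : IsSmooth f) {z : E4} (hz : z ≠ 0) :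
    ContDiffAt ℝ ∞ (fun z : E4 => f (proj z)) z :=
  ContDiffOn.contDiffAt hf (compl_zero_mem_nhds hz)

lemma IsSmooth.differentiableAt {f : S3 → F} (hf : IsSmooth f) {z : E4} (hz : z ≠ 0) :
    DifferentiableAt ℝ (fun z : E4 => f (proj z)) z :=
  (hf.contDiffAt hz).differentiableAt (by simp)

lemma IsSmooth.continuous {f : S3 → F} (hf : IsSmooth f) : Continuous f := by
  have h : Continuous fun y : S3 => f (proj (y : E4)) :=
    ContinuousOn.comp_continuous (s := {0}ᶜ) (g := fun z : E4 => f (proj z))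
      (ContDiffOn.continuousOn hf) continuous_subtype_val
      fun y => sphere_ne_zero y
  simpa using h

lemma isSmooth_of_ambient {H : E4 → F} (hH : ∀ y : S3, ContDiffAt ℝ ∞ H (y : E4)) :
    IsSmooth fun y : S3 => H (y : E4) := fun z hz =>
  (ContDiffAt.comp z (hH (proj z))
    (contDiffOn_coe_proj.contDiffAt (compl_zero_mem_nhds hz))).contDiffWithinAt

lemma isSmooth_const (c : F) : IsSmooth fun _ : S3 => c := contDiffOn_const

lemma IsSmooth.add {f g : S3 → F} (hf : IsSmooth f) (hg : IsSmooth g) :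
    IsSmooth fun y => f y + g y := ContDiffOn.add hf hg

lemma IsSmooth.sub {f g : S3 → F} (hf : IsSmooth f) (hg : IsSmooth g) :
    IsSmooth fun y => f y - g y := ContDiffOn.sub hf hg

lemma IsSmooth.neg {f : S3 → F} (hf : IsSmooth f) :
    IsSmooth fun y => -f y := ContDiffOn.neg hf

lemma IsSmooth.smul {f : S3 → ℝ} {g : S3 → F} (hf : IsSmooth f) (hg : IsSmooth g) :
    IsSmooth fun y => f y • g y := ContDiffOn.smul hf hg

lemma IsSmooth.mul {f g : S3 → ℝ} (hf : IsSmooth f) (hg : IsSmooth g) :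
    IsSmooth fun y => f y * g y := ContDiffOn.mul hf hg

lemma IsSmooth.sum {ι : Type*} {s : Finset ι} {f : ι → S3 → F} (hf : ∀ i, IsSmooth (f i)) :
    IsSmooth fun y => ∑ i ∈ s, f i y := ContDiffOn.sum fun i _ => hf i

lemma IsSmooth.inner {f g : S3 → E4} (hf : IsSmooth f) (hg : IsSmooth g) :
    IsSmooth fun y => ⟪f y, g y⟫ := ContDiffOn.inner ℝ hf hg

lemma isSmooth_clm (L : E4 →L[ℝ] F) : IsSmooth fun y : S3 => L (y : E4) :=
  isSmooth_of_ambient fun _ => L.contDiff.contDiffAt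

lemma proj_smul {c : ℝ} (hc : 0 < c) (z : E4) : proj (c • z) = proj z := by
  by_cases hz : z = 0
  · simp [hz]
  · apply Subtype.ext
    rw [proj_val hz, proj_val (by simp [hz, hc.ne']), norm_smul, smul_smul, mul_inv,
      Real.norm_of_nonneg hc.le, mul_right_comm, inv_mul_cancel₀ hc.ne', one_mul]

/-- The derivative of the extension is homogeneous of degree `-1`. -/
lemma fderiv_proj_eq {f : S3 → F} (hf : IsSmooth f) {z : E4} (hz : z ≠ 0) :
    fderiv ℝ (fun z : E4 => f (proj z)) z =
      ‖z‖⁻¹ • fderiv ℝ (fun z : E4 => f (proj z)) (proj z : E4) := by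
  have hc : 0 < ‖z‖⁻¹ := by positivity
  have e : (fun z : E4 => f (proj z)) = fun w : E4 => (fun z : E4 => f (proj z)) (‖z‖⁻¹ • w) := by
    ext w; simp only [proj_smul hc]
  conv_lhs => rw [e]
  rw [proj_val hz]
  have h1 := hf.differentiableAt (z := ‖z‖⁻¹ • z) (by simp [hz])
  have h2 : HasFDerivAt (fun w : E4 => ‖z‖⁻¹ • w) (‖z‖⁻¹ • ContinuousLinearMap.id ℝ E4) z :=
    (hasFDerivAt_id z).fun_const_smul _
  have h3 := (h1.hasFDerivAt.comp z h2).fderiv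
  simp only [Function.comp_def] at h3
  rw [h3]
  ext w
  simp

/-- The extension is constant along rays. -/
lemma fderiv_proj_self {f : S3 → F} (hf : IsSmooth f) {z : E4} (hz : z ≠ 0) :
    fderiv ℝ (fun z : E4 => f (proj z)) z z = 0 := by
  have h1 : HasDerivAt (fun t : ℝ => t • z) z 1 := by
    simpa using (hasDerivAt_id (1 : ℝ)).smul_const z
  have h2 : HasFDerivAt (fun z : E4 => f (proj z)) (fderiv ℝ (fun z : E4 => f (proj z)) z)
      ((1 : ℝ) • z) := by
    simpa using (hf.differentiableAt hz).hasFDerivAt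
  have h3 := h2.comp_hasDerivAt (1 : ℝ) h1
  have e : ((fun z : E4 => f (proj z)) ∘ fun t : ℝ => t • z) =ᶠ[nhds 1] fun _ => f (proj z) := by
    filter_upwards [lt_mem_nhds one_pos] with t ht
    simp only [Function.comp, proj_smul ht]
  exact (h3.congr_of_eventuallyEq e.symm).unique (hasDerivAt_const _ _)

lemma fderiv_proj_frame {f : S3 → F} (hf : IsSmooth f) {z : E4} (hz : z ≠ 0) (i : Fin 3) :
    fderiv ℝ (fun z : E4 => f (proj z)) z (frame i z) = D i f (proj z) := by
  rw [fderiv_proj_eq hf hz, D, proj_val hz, map_smul]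
  simp

/-- The derivative of the extension in terms of the frame derivatives. -/
lemma fderiv_proj_apply {f : S3 → F} (hf : IsSmooth f) {z : E4} (hz : z ≠ 0) (w : E4) :
    fderiv ℝ (fun z : E4 => f (proj z)) z w =
      ∑ i, ((‖z‖ ^ 2)⁻¹ * ⟪frame i z, w⟫) • D i f (proj z) := by
  have h0 : (‖z‖ ^ 2) ≠ 0 := by positivity
  have h : w = (‖z‖ ^ 2)⁻¹ • (⟪z, w⟫ • z + ∑ i, ⟪frame i z, w⟫ • frame i z) := by
    rw [← frame_expansion, inv_smul_smul₀ h0]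
  conv_lhs => rw [h]
  simp [fderiv_proj_self hf hz, fderiv_proj_frame hf hz, Finset.smul_sum, smul_smul]

lemma isSmooth_D {f : S3 → F} (hf : IsSmooth f) (i : Fin 3) : IsSmooth (D i f) := by
  have h1 : ContDiffOn ℝ ∞ (fun z => fderiv ℝ (fun z : E4 => f (proj z)) z (frame i z)) {0}ᶜ :=
    (ContDiffOn.fderiv_of_isOpen hf isOpen_compl_singleton (m := ∞) (by simp)).clm_apply
      (frame i).contDiff.contDiffOn
  exact h1.congr fun z hz => (fderiv_proj_frame hf hz i).symm

/-- A frame derivative may be computed on any ambient extension. -/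
lemma D_of_ambient {H : E4 → F} {H' : E4 →L[ℝ] F} {y : S3} (hH : HasFDerivAt H H' (y : E4))
    (i : Fin 3) : D i (fun x : S3 => H (x : E4)) y = H' (frame i (y : E4)) := by
  have h1 : DifferentiableAt ℝ (fun z => (proj z : E4)) (y : E4) :=
    (contDiffOn_coe_proj.contDiffAt (compl_zero_mem_nhds (sphere_ne_zero y))).differentiableAt
      (by simp)
  have h2 : HasFDerivAt H H' ((fun z => (proj z : E4)) (y : E4)) := by simpa using hH
  have h3 : fderiv ℝ (fun z => H (proj z : E4)) y = _ := (h2.comp (y : E4) h1.hasFDerivAt).fderiv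
  rw [D, h3, ContinuousLinearMap.comp_apply, hasFDerivAt_coe_proj]
  rw [real_inner_comm, inner_frame_self]

lemma D_clm (i : Fin 3) (L : E4 →L[ℝ] F) (y : S3) :
    D i (fun x : S3 => L (x : E4)) y = L (frame i (y : E4)) :=
  D_of_ambient L.hasFDerivAt i

lemma D_const (i : Fin 3) (c : F) (y : S3) : D i (fun _ : S3 => c) y = 0 := by
  simp [D]

section
variable {f g : S3 → F} (hf : IsSmooth f) (hg : IsSmooth g) (i : Fin 3) (y : S3)
include hf

lemma D_neg : D i (fun y => -f y) y = -D i f y := by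
  have h : HasFDerivAt (fun z : E4 => -f (proj z)) _ (y : E4) :=
    (hf.differentiableAt (sphere_ne_zero y)).hasFDerivAt.neg
  rw [D, h.fderiv]; rfl

lemma D_smul {a : S3 → ℝ} (ha : IsSmooth a) :
    D i (fun y => a y • f y) y = D i a y • f y + a y • D i f y := by
  have h : HasFDerivAt (fun z : E4 => a (proj z) • f (proj z)) _ (y : E4) :=
    (ha.differentiableAt (sphere_ne_zero y)).hasFDerivAt.smul
      (hf.differentiableAt (sphere_ne_zero y)).hasFDerivAt
  rw [D, h.fderiv]; simp [D, add_comm]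

include hg

lemma D_add : D i (fun y => f y + g y) y = D i f y + D i g y := by
  have h : HasFDerivAt (fun z : E4 => f (proj z) + g (proj z)) _ (y : E4) :=
    (hf.differentiableAt (sphere_ne_zero y)).hasFDerivAt.add
    (hg.differentiableAt (sphere_ne_zero y)).hasFDerivAt
  rw [D, h.fderiv]; rfl

lemma D_sub : D i (fun y => f y - g y) y = D i f y - D i g y := by
  have h : HasFDerivAt (fun z : E4 => f (proj z) - g (proj z)) _ (y : E4) :=
    (hf.differentiableAt (sphere_ne_zero y)).hasFDerivAt.sub
    (hg.differentiableAt (sphere_ne_zero y)).hasFDerivAt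
  rw [D, h.fderiv]; rfl

end

lemma D_sum {ι : Type*} {s : Finset ι} {f : ι → S3 → F} (hf : ∀ i, IsSmooth (f i)) (i : Fin 3)
    (y : S3) : D i (fun y => ∑ j ∈ s, f j y) y = ∑ j ∈ s, D i (f j) y := by
  have h : HasFDerivAt (fun z : E4 => ∑ j ∈ s, f j (proj z)) _ (y : E4) :=
    HasFDerivAt.fun_sum fun j _ => ((hf j).differentiableAt (sphere_ne_zero y)).hasFDerivAt
  rw [D, h.fderiv]; simp [D]

lemma D_mul {f g : S3 → ℝ} (hf : IsSmooth f) (hg : IsSmooth g) (i : Fin 3) (y : S3) :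
    D i (fun y => f y * g y) y = D i f y * g y + f y * D i g y :=
  D_smul hg i y hf

lemma D_const_mul {f : S3 → ℝ} (hf : IsSmooth f) (c : ℝ) (i : Fin 3) (y : S3) :
    D i (fun y => c * f y) y = c * D i f y := by
  rw [D_mul (isSmooth_const c) hf, D_const, zero_mul, zero_add]

/-- The commutator of two frame derivatives is the derivative along the bracket. -/
lemma D_commutator {f : S3 → F} (hf : IsSmooth f) (i j : Fin 3) (y : S3) :
    D i (D j f) y - D j (D i f) y =
      fderiv ℝ (fun z : E4 => f (proj z)) y (frame j (frame i (y : E4)))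
        - fderiv ℝ (fun z : E4 => f (proj z)) y (frame i (frame j (y : E4))) := by
  have hy := sphere_ne_zero y
  have key : ∀ i j : Fin 3, D i (D j f) y =
      fderiv ℝ (fderiv ℝ (fun z : E4 => f (proj z))) y (frame i (y : E4)) (frame j (y : E4))
      + fderiv ℝ (fun z : E4 => f (proj z)) y (frame j (frame i (y : E4))) := by
    intro i j
    have h1 : DifferentiableAt ℝ (fderiv ℝ (fun z : E4 => f (proj z))) (y : E4) :=
      ((ContDiffOn.fderiv_of_isOpen hf isOpen_compl_singleton (m := ∞) (by simp)).contDiffAt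
        (compl_zero_mem_nhds hy)).differentiableAt (by simp)
    have h2 := h1.hasFDerivAt.clm_apply (frame j).hasFDerivAt
    have e : D j f = fun x : S3 => fderiv ℝ (fun z : E4 => f (proj z)) x (frame j (x : E4)) := rfl
    rw [e, D_of_ambient h2]
    simp [add_comm]
  have hs : IsSymmSndFDerivAt ℝ (fun z : E4 => f (proj z)) (y : E4) :=
    (hf.contDiffAt hy).isSymmSndFDerivAt (by
      rw [minSmoothness_of_isRCLikeNormedField]; exact WithTop.coe_le_coe.2 le_top)
  rw [key i j, key j i, hs.eq (frame i (y : E4)) (frame j (y : E4))]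
  abel

section
variable {f : S3 → F} (hf : IsSmooth f) (y : S3)
include hf

lemma D_zero_one : D 0 (D 1 f) y - D 1 (D 0 f) y = (2 : ℝ) • D 2 f y := by
  rw [D_commutator hf, frame_one_frame_zero, frame_zero_frame_one, map_neg, two_smul]
  simp [D]

lemma D_one_two : D 1 (D 2 f) y - D 2 (D 1 f) y = (2 : ℝ) • D 0 f y := by
  rw [D_commutator hf, frame_two_frame_one, frame_one_frame_two, map_neg, two_smul]
  simp [D]

lemma D_two_zero : D 2 (D 0 f) y - D 0 (D 2 f) y = (2 : ℝ) • D 1 f y := by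
  rw [D_commutator hf, frame_zero_frame_two, frame_two_frame_zero, map_neg, two_smul]
  simp [D]

end

/-- A smooth field in the sense of manifolds has a smooth extension to `ℝ⁴ \ {0}`. -/
lemma isSmooth_of_contMDiff {v : S3 → F} (hv : ContMDiff (𝓡 3) 𝓘(ℝ, F) ∞ v) : IsSmooth v := by
  let U : TopologicalSpace.Opens E4 := ⟨{0}ᶜ, isOpen_compl_singleton⟩
  intro z hz
  have h1 : ContMDiff 𝓘(ℝ, E4) 𝓘(ℝ, E4) ∞ fun w : U => (proj (w : E4) : E4) := by
    intro w
    have := (contDiffOn_coe_proj.contDiffAt (compl_zero_mem_nhds w.2)).contMDiffAt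
    exact contMDiffAt_subtype_iff.2 this
  have h2 := h1.codRestrict_sphere (n := 3) (fun w => (proj (w : E4)).2)
  have h3 : ContMDiffAt 𝓘(ℝ, E4) 𝓘(ℝ, F) ∞ (fun w : U => v (proj (w : E4))) ⟨z, hz⟩ :=
    (hv.comp h2).contMDiffAt
  exact (contMDiffAt_iff_contDiffAt.1 (contMDiffAt_subtype_iff (f := fun w => v (proj w))
    (x := ⟨z, hz⟩) |>.1 h3)).contDiffWithinAt

lemma IsSmooth.contMDiff {v : S3 → F} (hv : IsSmooth v) : ContMDiff (𝓡 3) 𝓘(ℝ, F) ∞ v := by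
  intro y
  have h1 : ContMDiffAt 𝓘(ℝ, E4) 𝓘(ℝ, F) ∞ (fun w => v (proj w)) (y : E4) :=
    (hv.contDiffAt (sphere_ne_zero y)).contMDiffAt
  have h2 := h1.comp y (contMDiff_coe_sphere (n := 3) y)
  simpa [Function.comp_def] using h2

end S3

namespace S3

/-! ### Integration on the sphere -/

instance : IsFiniteMeasure vol := by unfold vol; infer_instance

lemma vol_real_univ : vol.real Set.univ = 2 * Real.pi ^ 2 := by
  have h : (volume : Measure E4).real (Metric.ball 0 1) = Real.pi ^ 2 / 2 := by
    rw [Measure.real, InnerProductSpace.volume_ball_of_dim_even (k := 2) (by simp)]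
    simp
    positivity
  rw [vol, Measure.toSphere_real_apply_univ, h]
  simp; ring

/-- The action of a linear isometry on the sphere. -/
noncomputable def rot (L : E4 ≃ₗᵢ[ℝ] E4) : S3 ≃ₜ S3 where
  toFun x := ⟨L x, by simp⟩
  invFun x := ⟨L.symm x, by simp⟩
  left_inv x := by simp
  right_inv x := by simp
  continuous_toFun := by fun_prop
  continuous_invFun := by fun_prop

open Pointwise in
lemma measurePreserving_rot (L : E4 ≃ₗᵢ[ℝ] E4) : MeasurePreserving (rot L) vol vol := by
  refine ⟨(rot L).continuous.measurable, ?_⟩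
  ext s hs
  have hm : Measurable (rot L) := (rot L).continuous.measurable
  rw [Measure.map_apply hm hs, vol, Measure.toSphere_apply' _ hs,
    Measure.toSphere_apply' _ (hm hs)]
  congr 1
  have e : Set.Ioo (0 : ℝ) 1 • (Subtype.val '' (rot L ⁻¹' s) : Set E4)
      = L ⁻¹' (Set.Ioo (0 : ℝ) 1 • (Subtype.val '' s : Set E4)) := by
    ext z
    simp only [Set.mem_smul, Set.mem_preimage, Set.mem_image]
    constructor
    · rintro ⟨c, hc, _, ⟨x, hx, rfl⟩, rfl⟩
      exact ⟨c, hc, _, ⟨rot L x, hx, rfl⟩, by simp [rot]⟩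
    · rintro ⟨c, hc, _, ⟨x, hx, rfl⟩, h⟩
      refine ⟨c, hc, _, ⟨(rot L).symm x, by simpa using hx, rfl⟩, ?_⟩
      apply L.injective
      rw [← h]
      simp [rot]
  rw [e]
  exact (L.measurePreserving).measure_preimage_equiv
    (f := L.toHomeomorph.toMeasurableEquiv) _

/-- Right multiplication by a unit quaternion, as a linear isometry. -/
noncomputable def rightIsometry (q : S3) : E4 ≃ₗᵢ[ℝ] E4 :=
  LinearIsometry.toLinearIsometryEquiv
    { toFun := fun x => qmul x q
      map_add' := fun x y => by apply ext_E4 <;> simp <;> ring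
      map_smul' := fun c x => by apply ext_E4 <;> simp <;> ring
      norm_map' := fun x => by
        change ‖qmul x q‖ = ‖x‖
        simp [norm_qmul] } rfl

lemma measurePreserving_mul_right (q : S3) : MeasurePreserving (fun x => mul x q) vol vol :=
  measurePreserving_rot (rightIsometry q)

lemma measurableEmbedding_mul_right (q : S3) : MeasurableEmbedding fun x => mul x q :=
  (rot (rightIsometry q)).measurableEmbedding

variable {F : Type*} [NormedAddCommGroup F] [NormedSpace ℝ F]

lemma integral_mul_right (f : S3 → F) (q : S3) : ∫ x, f (mul x q) ∂vol = ∫ x, f x ∂vol :=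
  (measurePreserving_mul_right q).integral_comp (measurableEmbedding_mul_right q) f

omit [NormedSpace ℝ F] in
lemma integrable_mul_right_iff {f : S3 → F} (q : S3) :
    Integrable (fun x => f (mul x q)) vol ↔ Integrable f vol :=
  (measurePreserving_mul_right q).integrable_comp_emb (measurableEmbedding_mul_right q)

lemma continuous_mul_right (q : S3) : Continuous fun x => mul x q :=
  (rot (rightIsometry q)).continuous

omit [NormedSpace ℝ F] in
lemma exists_bound {f : S3 → F} (hf : Continuous f) : ∃ C, 0 ≤ C ∧ ∀ x, ‖f x‖ ≤ C := by
  obtain ⟨C, hC⟩ := isCompact_univ.exists_bound_of_continuousOn hf.continuousOn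
  exact ⟨C, (norm_nonneg _).trans (hC pole trivial), fun x => hC x trivial⟩

omit [NormedSpace ℝ F] in
lemma integrable_of_continuous {f : S3 → F} (hf : Continuous f) : Integrable f vol := by
  obtain ⟨C, -, hC⟩ := exists_bound hf
  exact Integrable.of_bound hf.aestronglyMeasurable C (.of_forall hC)

lemma exists_bound_fderiv {f : S3 → F} (hf : IsSmooth f) :
    ∃ C, 0 ≤ C ∧ ∀ z : E4, z ≠ 0 → ‖fderiv ℝ (fun z : E4 => f (proj z)) z‖ ≤ C * ‖z‖⁻¹ := by
  have hc : Continuous fun y : S3 => fderiv ℝ (fun z : E4 => f (proj z)) (y : E4) :=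
    ContinuousOn.comp_continuous (s := {0}ᶜ)
      (ContDiffOn.fderiv_of_isOpen hf isOpen_compl_singleton (m := ∞) (by simp)).continuousOn
      continuous_subtype_val fun y => sphere_ne_zero y
  obtain ⟨C, hC0, hC⟩ := exists_bound hc
  refine ⟨C, hC0, fun z hz => ?_⟩
  rw [fderiv_proj_eq hf hz, norm_smul, norm_inv, norm_norm, mul_comm]
  gcongr
  exact hC _

/-- Moving along a left-invariant field is, before projecting to the sphere, a right
multiplication. -/
lemma add_smul_frame (x : E4) (t : ℝ) (i : Fin 3) :
    x + t • frame i x = qmul x (stdVec 0 + t • stdVec i.succ) := by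
  fin_cases i <;> rw [frame_apply] <;> apply ext_E4 <;> simp [stdVec] <;> ring

lemma proj_qmul_right (x : S3) {q : E4} (hq : q ≠ 0) : proj (qmul x q) = mul x (proj q) :=
  by simpa using proj_qmul x hq

lemma one_le_norm_add_smul_frame (x : S3) (t : ℝ) (i : Fin 3) :
    1 ≤ ‖(x : E4) + t • frame i (x : E4)‖ := by
  have h : ⟪(x : E4) + t • frame i (x : E4), (x : E4)⟫ = 1 := by
    rw [inner_add_left, inner_self_sphere, real_inner_smul_left, inner_frame_self]; simp
  have := real_inner_le_norm ((x : E4) + t • frame i (x : E4)) (x : E4)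
  rw [h] at this
  simpa using this

/-- Left-invariant vector fields generate right translations, which preserve the volume; hence the
integral of a frame derivative vanishes. -/
lemma integral_D [CompleteSpace F] {f : S3 → F} (hf : IsSmooth f) (i : Fin 3) :
    ∫ x, D i f x ∂vol = 0 := by
  obtain ⟨C, hC0, hC⟩ := exists_bound_fderiv hf
  have hq (t : ℝ) : (stdVec 0 + t • stdVec i.succ : E4) ≠ 0 := by
    intro h
    have := congrArg (fun z : E4 => z 0) h
    simp [stdVec] at this
  have hmul (t : ℝ) (x : S3) : f (proj ((x : E4) + t • frame i (x : E4)))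
      = f (mul x (proj (stdVec 0 + t • stdVec i.succ))) := by
    rw [add_smul_frame, proj_qmul_right x (hq t)]
  have hne (t : ℝ) (x : S3) : (x : E4) + t • frame i (x : E4) ≠ 0 := by
    rw [← norm_pos_iff]; exact one_pos.trans_le (one_le_norm_add_smul_frame x t i)
  have h := hasDerivAt_integral_of_dominated_loc_of_deriv_le (μ := vol) (x₀ := (0 : ℝ))
    (s := Set.univ) (bound := fun _ => C)
    (F := fun t x => f (proj ((x : E4) + t • frame i (x : E4))))
    (F' := fun t x => fderiv ℝ (fun z : E4 => f (proj z)) ((x : E4) + t • frame i (x : E4))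
      (frame i (x : E4))) Filter.univ_mem
    (.of_forall fun t => by
      simp only [hmul]
      exact (hf.continuous.comp (continuous_mul_right _)).aestronglyMeasurable)
    (by simpa using integrable_of_continuous hf.continuous)
    (by
      simp only [zero_smul, add_zero]
      exact (isSmooth_D hf i).continuous.aestronglyMeasurable)
    (.of_forall fun x t _ => by
      refine (ContinuousLinearMap.le_opNorm _ _).trans ?_
      rw [norm_frame, norm_eq_of_mem_sphere, mul_one]
      refine (hC _ (hne t x)).trans (mul_le_of_le_one_right hC0 ?_)
      exact inv_le_one_of_one_le₀ (one_le_norm_add_smul_frame x t i))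
    (integrable_const C)
    (.of_forall fun x t _ => by
      have h1 : HasDerivAt (fun t : ℝ => (x : E4) + t • frame i (x : E4)) (frame i (x : E4)) t := by
        simpa using ((hasDerivAt_id t).smul_const (frame i (x : E4))).const_add (x : E4)
      exact (hf.differentiableAt (hne t x)).hasFDerivAt.comp_hasDerivAt t h1)
  have h2 := h.2
  simp only [hmul, integral_mul_right f, zero_smul, add_zero] at h2
  exact h2.unique (hasDerivAt_const _ _)

/-- Integration by parts for a frame derivative. -/
lemma integral_mul_D {f g : S3 → ℝ} (hf : IsSmooth f) (hg : IsSmooth g) (i : Fin 3) :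
    ∫ x, f x * D i g x ∂vol = -∫ x, D i f x * g x ∂vol := by
  have h := integral_D (hf.mul hg) i
  simp only [D_mul hf hg] at h
  rw [integral_add] at h
  · linarith
  · exact integrable_of_continuous ((isSmooth_D hf i).continuous.mul hg.continuous)
  · exact integrable_of_continuous (hf.continuous.mul (isSmooth_D hg i).continuous)

end S3

namespace S3

/-! ### The radial kernel -/

/-- The function `(π - α) / sin α` of `s = cos α`. All the kernels on the sphere are built from
it. -/
noncomputable def A (s : ℝ) : ℝ := Real.arccos (-s) / Real.sqrt (1 - s ^ 2)

/-- The derivative of `A` on `(-1, 1)`. -/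
noncomputable def A1 (s : ℝ) : ℝ := (1 + s * A s) / (1 - s ^ 2)

/-- The second derivative of `A` on `(-1, 1)`. -/
noncomputable def A2 (s : ℝ) : ℝ := (A s + 3 * s * A1 s) / (1 - s ^ 2)

/-- The squared distance between `u • y` and `x`, for points `x`, `y` of the sphere with
`⟪x, y⟫ = s`. -/
def quad (s u : ℝ) : ℝ := u ^ 2 - 2 * s * u + 1

lemma one_sub_sq_pos {s : ℝ} (hs : s ∈ Set.Ioo (-1 : ℝ) 1) : 0 < 1 - s ^ 2 := by
  nlinarith [hs.1, hs.2]

lemma quad_pos {s : ℝ} (hs : s ∈ Set.Ioo (-1 : ℝ) 1) (u : ℝ) : 0 < quad s u := by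
  have := one_sub_sq_pos hs
  unfold quad
  nlinarith [sq_nonneg (u - s)]

lemma hasDerivAt_quad (s u : ℝ) : HasDerivAt (quad s) (2 * u - 2 * s) u := by
  have := (((hasDerivAt_pow 2 u).sub ((hasDerivAt_id u).const_mul (2 * s))).add_const 1)
  exact HasDerivAt.congr_deriv (f := quad s) this (by simp)

lemma continuous_quad (s : ℝ) : Continuous (quad s) := by unfold quad; fun_prop

lemma measurable_A : Measurable A := by unfold A; fun_prop

lemma measurable_A1 : Measurable A1 := by
  have := measurable_A
  unfold A1; fun_prop

lemma integral_le_of_le {f : ℝ → ℝ} {C : ℝ} (hf : IntervalIntegrable f volume 0 1)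
    (h : ∀ u ∈ Set.Icc (0 : ℝ) 1, f u ≤ C) : ∫ u in (0 : ℝ)..1, f u ≤ C := by
  have := intervalIntegral.integral_mono_on zero_le_one hf
    (intervalIntegrable_const (c := C)) h
  simpa using this

section
variable {s : ℝ} (hs : s ∈ Set.Ioo (-1 : ℝ) 1)
include hs

lemma intervalIntegrable_div_quad {f : ℝ → ℝ} (hf : Continuous f) (n : ℕ) (a b : ℝ) :
    IntervalIntegrable (fun u => f u / quad s u ^ n) volume a b :=
  (hf.div ((continuous_quad s).pow n) fun u => (pow_pos (quad_pos hs u) n).ne').intervalIntegrable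
    _ _

lemma arctan_add_arctan :
    2 * (Real.arctan ((1 - s) / Real.sqrt (1 - s ^ 2))
      - Real.arctan ((0 - s) / Real.sqrt (1 - s ^ 2))) = Real.arccos (-s) := by
  set β := Real.arccos (-s) with hβ
  have hb0 : 0 < β := Real.arccos_pos.2 (by linarith [hs.1])
  have hbpi : β < Real.pi := by
    rw [hβ, Real.arccos_neg]
    have := Real.arccos_pos.2 hs.2
    linarith
  have hc : Real.cos β = -s := Real.cos_arccos (by linarith [hs.2]) (by linarith [hs.1])
  have hsin : Real.sin β = Real.sqrt (1 - s ^ 2) := by rw [hβ, Real.sin_arccos]; simp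
  have h1 : (1 - s) / Real.sqrt (1 - s ^ 2) = Real.tan (Real.pi / 2 - β / 2) := by
    rw [← hsin, show 1 - s = 1 + Real.cos β by rw [hc]; ring, Real.tan_pi_div_two_sub,
      Real.tan_eq_sin_div_cos, inv_div]
    have e1 : Real.sin β = 2 * Real.sin (β / 2) * Real.cos (β / 2) := by
      rw [← Real.sin_two_mul]; congr 1; ring
    have e2 : Real.cos β = 2 * Real.cos (β / 2) ^ 2 - 1 := by
      rw [← Real.cos_two_mul]; congr 1; ring
    have p1 : 0 < Real.sin (β / 2) := Real.sin_pos_of_pos_of_lt_pi (by linarith) (by linarith)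
    have p2 : 0 < Real.cos (β / 2) := Real.cos_pos_of_mem_Ioo ⟨by linarith, by linarith⟩
    rw [e1, e2]; field_simp; ring
  have h2 : (0 - s) / Real.sqrt (1 - s ^ 2) = Real.tan (Real.pi / 2 - β) := by
    rw [← hsin, show 0 - s = Real.cos β by rw [hc]; ring, Real.tan_pi_div_two_sub,
      Real.tan_eq_sin_div_cos, inv_div]
  rw [h1, h2, Real.arctan_tan (by linarith) (by linarith), Real.arctan_tan (by linarith)
    (by linarith)]
  ring

/-- The factor `(1 - s ^ 2) ^ (-1/2)` hides that `A` is regular at antipodal points, `s = -1`; the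
integral representations of `A`, `A1` and `A2` show this, and their positivity. -/
lemma A_eq_integral : A s = 2 * ∫ u in (0 : ℝ)..1, 1 / quad s u ^ 1 := by
  set r := Real.sqrt (1 - s ^ 2) with hr
  have hr0 : 0 < r := Real.sqrt_pos.2 (one_sub_sq_pos hs)
  have hr2 : r ^ 2 = 1 - s ^ 2 := Real.sq_sqrt (one_sub_sq_pos hs).le
  have hd : ∀ u ∈ Set.uIcc (0 : ℝ) 1,
      HasDerivAt (fun u => Real.arctan ((u - s) / r) / r) (1 / quad s u ^ 1) u := by
    intro u _
    have h := ((((hasDerivAt_id u).sub_const s).div_const r).arctan).div_const r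
    refine h.congr_deriv ?_
    have hq := quad_pos hs u
    have : 1 + ((u - s) / r) ^ 2 = quad s u / r ^ 2 := by
      rw [quad]; field_simp; rw [hr2]; ring
    simp only [id]
    rw [this]
    field_simp
  rw [intervalIntegral.integral_eq_sub_of_hasDerivAt hd
    (intervalIntegrable_div_quad hs continuous_const 1 _ _), ← sub_div, ← mul_div_assoc,
    arctan_add_arctan hs, A]

lemma A1_eq_integral : A1 s = 2 * ∫ u in (0 : ℝ)..1, 2 * u / quad s u ^ 2 := by
  have hd : ∀ u ∈ Set.uIcc (0 : ℝ) 1, HasDerivAt (fun u => (s * u - 1) / quad s u)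
      ((1 - s ^ 2) * (2 * u / quad s u ^ 2) - s * (1 / quad s u ^ 1)) u := by
    intro u _
    have hq := (quad_pos hs u).ne'
    refine ((((hasDerivAt_id u).const_mul s).sub_const 1).div (hasDerivAt_quad s u) hq).congr_deriv
      ?_
    field_simp
    simp only [quad, id]; ring
  have i1 := intervalIntegrable_div_quad hs (f := fun u => 2 * u) (by fun_prop) 2 0 1
  have i2 := intervalIntegrable_div_quad hs (f := fun _ => 1) (by fun_prop) 1 0 1
  have h := intervalIntegral.integral_eq_sub_of_hasDerivAt hd
    ((i1.const_mul _).sub (i2.const_mul _))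
  rw [intervalIntegral.integral_sub (i1.const_mul _) (i2.const_mul _),
    intervalIntegral.integral_const_mul, intervalIntegral.integral_const_mul] at h
  have hA := A_eq_integral hs
  have h0 := (one_sub_sq_pos hs).ne'
  have h1 : (s * 1 - 1) / quad s 1 - (s * 0 - 1) / quad s 0 = 1 / 2 := by
    have : (1 : ℝ) - s ≠ 0 := by linarith [hs.2]
    have e : quad s 1 = 2 * (1 - s) := by rw [quad]; ring
    have e0 : quad s 0 = 1 := by rw [quad]; ring
    rw [e, e0]; field_simp; ring
  rw [h1] at h
  rw [A1, div_eq_iff h0, hA]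
  linarith

lemma A2_eq_integral : A2 s = 2 * ∫ u in (0 : ℝ)..1, 8 * u ^ 2 / quad s u ^ 3 := by
  have hd : ∀ u ∈ Set.uIcc (0 : ℝ) 1, HasDerivAt (fun u => (u ^ 3 - u) / quad s u ^ 2)
      ((1 - s ^ 2) * (8 * u ^ 2 / quad s u ^ 3) - (1 / quad s u ^ 1)
        - 3 * s * (2 * u / quad s u ^ 2)) u := by
    intro u _
    have hq := (quad_pos hs u).ne'
    refine (((hasDerivAt_pow 3 u).sub (hasDerivAt_id u)).div ((hasDerivAt_quad s u).pow 2)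
      (pow_ne_zero 2 hq)).congr_deriv ?_
    simp
    field_simp
    simp only [quad]; ring
  have i0 := intervalIntegrable_div_quad hs (f := fun u => 8 * u ^ 2) (by fun_prop) 3 0 1
  have i1 := intervalIntegrable_div_quad hs (f := fun u => 2 * u) (by fun_prop) 2 0 1
  have i2 := intervalIntegrable_div_quad hs (f := fun _ => 1) (by fun_prop) 1 0 1
  have h := intervalIntegral.integral_eq_sub_of_hasDerivAt hd
    (((i0.const_mul _).sub i2).sub (i1.const_mul _))
  rw [intervalIntegral.integral_sub ((i0.const_mul _).sub i2) (i1.const_mul _),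
    intervalIntegral.integral_sub (i0.const_mul _) i2,
    intervalIntegral.integral_const_mul, intervalIntegral.integral_const_mul] at h
  have hA := A_eq_integral hs
  have hA1 := A1_eq_integral hs
  have h0 := (one_sub_sq_pos hs).ne'
  norm_num at h
  rw [A2, div_eq_iff h0, hA, hA1]
  norm_num
  linarith

/-- This combination occurs in the Laplacian of the dilated fundamental solution. -/
lemma two_A1_add_A2_eq_integral :
    2 * A1 s + s * A2 s = 2 * ∫ u in (0 : ℝ)..1, 4 * u * (1 + u ^ 2) / quad s u ^ 3 := by
  have i0 := intervalIntegrable_div_quad hs (f := fun u => 8 * u ^ 2) (by fun_prop) 3 0 1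
  have i1 := intervalIntegrable_div_quad hs (f := fun u => 2 * u) (by fun_prop) 2 0 1
  rw [A1_eq_integral hs, A2_eq_integral hs]
  have : ∀ u : ℝ, 4 * u * (1 + u ^ 2) / quad s u ^ 3
      = 2 * (2 * u / quad s u ^ 2) + s * (8 * u ^ 2 / quad s u ^ 3) := by
    intro u
    have hq := (quad_pos hs u).ne'
    field_simp
    simp only [quad]; ring
  simp only [this]
  rw [intervalIntegral.integral_add (i1.const_mul _) (i0.const_mul _),
    intervalIntegral.integral_const_mul, intervalIntegral.integral_const_mul]
  ring

lemma two_A1_add_A2_nonneg : 0 ≤ 2 * A1 s + s * A2 s := by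
  rw [two_A1_add_A2_eq_integral hs]
  refine mul_nonneg (by norm_num) (intervalIntegral.integral_nonneg zero_le_one fun u hu => ?_)
  have := quad_pos hs u
  have := hu.1
  positivity

lemma le_quad {δ : ℝ} (h1 : δ ≤ 1) (hsd : s ≤ 1 - δ) {u : ℝ} (hu : 0 ≤ u) :
    δ ≤ quad s u := by
  unfold quad
  rcases le_total s 0 with h | h
  · nlinarith [mul_nonneg hu (neg_nonneg.2 h)]
  · nlinarith [sq_nonneg (u - s), hs.2]

lemma two_A1_add_A2_le {δ : ℝ} (h0 : 0 < δ) (h1 : δ ≤ 1) (hsd : s ≤ 1 - δ) :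
    2 * A1 s + s * A2 s ≤ 16 / δ ^ 3 := by
  rw [two_A1_add_A2_eq_integral hs]
  have : ∫ u in (0 : ℝ)..1, 4 * u * (1 + u ^ 2) / quad s u ^ 3 ≤ 8 / δ ^ 3 := by
    refine integral_le_of_le (intervalIntegrable_div_quad hs (by fun_prop) 3 0 1) fun u hu => ?_
    have := le_quad hs h1 hsd hu.1
    gcongr
    nlinarith [hu.1, hu.2, mul_nonneg hu.1 (sub_nonneg.2 hu.2), pow_le_one₀ (n := 3) hu.1 hu.2]
  calc _ ≤ 2 * (8 / δ ^ 3) := by gcongr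
    _ = _ := by ring

lemma A_pos : 0 < A s :=
  div_pos (Real.arccos_pos.2 (by linarith [hs.1])) (Real.sqrt_pos.2 (one_sub_sq_pos hs))

lemma A1_nonneg : 0 ≤ A1 s := by
  rw [A1_eq_integral hs]
  refine mul_nonneg (by norm_num) (intervalIntegral.integral_nonneg zero_le_one fun u hu => ?_)
  have := quad_pos hs u
  have := hu.1
  positivity

lemma A_le : A s ≤ 4 / Real.sqrt (1 - s) := by
  have hp : 0 < 1 - s := by linarith [hs.2]
  have hq : 0 < Real.sqrt (1 - s) := Real.sqrt_pos.2 hp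
  rcases le_total s 0 with h | h
  · have h1 : A s ≤ 2 := by
      rw [A_eq_integral hs]
      have : ∫ u in (0 : ℝ)..1, 1 / quad s u ^ 1 ≤ 1 := by
        refine integral_le_of_le (intervalIntegrable_div_quad hs (by fun_prop) 1 0 1)
          fun u hu => ?_
        have := le_quad hs le_rfl (by linarith) hu.1
        rw [pow_one]
        exact div_le_one_of_le₀ this (by linarith)
      linarith
    refine h1.trans ?_
    rw [le_div_iff₀ hq]
    have : Real.sqrt (1 - s) ≤ 2 := Real.sqrt_le_iff.2 ⟨by norm_num, by linarith [hs.1]⟩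
    linarith
  · rw [A]
    have := Real.arccos_le_pi (-s)
    have := Real.pi_lt_four
    have := Real.arccos_nonneg (-s)
    gcongr
    · linarith
    · nlinarith

lemma A1_le : A1 s ≤ 8 / ((1 - s) * Real.sqrt (1 - s)) := by
  have hp : 0 < 1 - s := by linarith [hs.2]
  have hq : 0 < Real.sqrt (1 - s) := Real.sqrt_pos.2 hp
  rw [le_div_iff₀ (by positivity)]
  rcases le_total s 0 with h | h
  · have h1 : A1 s ≤ 2 := by
      rw [A1_eq_integral hs]
      have : ∫ u in (0 : ℝ)..1, 2 * u / quad s u ^ 2 ≤ ∫ u in (0 : ℝ)..1, 2 * u := by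
        refine intervalIntegral.integral_mono_on zero_le_one
          (intervalIntegrable_div_quad hs (by fun_prop) 2 0 1)
          (Continuous.intervalIntegrable (by fun_prop) _ _) fun u hu => ?_
        have := le_quad hs le_rfl (by linarith) hu.1
        exact div_le_self (by linarith [hu.1]) (one_le_pow₀ this)
      rw [intervalIntegral.integral_const_mul 2 fun u : ℝ => u, integral_id] at this
      linarith
    have : Real.sqrt (1 - s) ≤ 2 := Real.sqrt_le_iff.2 ⟨by norm_num, by linarith [hs.1]⟩
    have h3 : (1 - s) * Real.sqrt (1 - s) ≤ 2 * 2 := by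
      gcongr; linarith [hs.1]
    calc A1 s * ((1 - s) * Real.sqrt (1 - s)) ≤ 2 * (2 * 2) := by gcongr
      _ = 8 := by norm_num
  · have hA := A_le hs
    rw [le_div_iff₀ hq] at hA
    have hA0 := A_pos hs
    have hone : Real.sqrt (1 - s) ≤ 1 := Real.sqrt_le_one.2 (by linarith)
    have e : A1 s * ((1 - s) * Real.sqrt (1 - s)) * (1 + s)
        = Real.sqrt (1 - s) + s * (A s * Real.sqrt (1 - s)) := by
      have : 1 + s ≠ 0 := by linarith
      rw [A1, show 1 - s ^ 2 = (1 - s) * (1 + s) by ring]; field_simp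
    have h1 : 0 ≤ A1 s * ((1 - s) * Real.sqrt (1 - s)) := by
      have := A1_nonneg hs; positivity
    have : s * (A s * Real.sqrt (1 - s)) ≤ 1 * 4 :=
      mul_le_mul hs.2.le hA (by positivity) (by norm_num)
    nlinarith

lemma hasDerivAt_A : HasDerivAt A (A1 s) s := by
  have hp := one_sub_sq_pos hs
  have hr0 : 0 < Real.sqrt (1 - s ^ 2) := Real.sqrt_pos.2 hp
  have hr2 : Real.sqrt (1 - s ^ 2) ^ 2 = 1 - s ^ 2 := Real.sq_sqrt hp.le
  have h1 := (Real.hasDerivAt_arccos (x := -s) (by linarith [hs.2]) (by linarith [hs.1])).comp s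
    (hasDerivAt_neg s)
  have h2 := ((hasDerivAt_pow 2 s).const_sub 1).sqrt hp.ne'
  refine (h1.div h2 hr0.ne').congr_deriv ?_
  rw [neg_sq, Function.comp_apply, A1, A, ← hr2, Real.sqrt_sq hr0.le]
  field_simp
  ring

lemma hasDerivAt_A1 : HasDerivAt A1 (A2 s) s := by
  have hp := one_sub_sq_pos hs
  have h1 := (((hasDerivAt_id s).mul (hasDerivAt_A hs)).const_add 1).div
    ((hasDerivAt_pow 2 s).const_sub 1) hp.ne'
  refine h1.congr_deriv ?_
  simp
  have e : 1 + s * A s = (1 - s ^ 2) * A1 s := by rw [A1]; field_simp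
  rw [e, A2]
  field_simp
  ring

lemma A1_ode : (1 - s ^ 2) * A1 s = 1 + s * A s := by
  have hp := (one_sub_sq_pos hs).ne'
  rw [A1]; field_simp

lemma A2_ode : (1 - s ^ 2) * A2 s = A s + 3 * s * A1 s := by
  have hp := (one_sub_sq_pos hs).ne'
  rw [A2]; field_simp

end

lemma contDiffOn_A : ContDiffOn ℝ ∞ A (Set.Ioo (-1) 1) := by
  intro s hs
  have h1 : ContDiffAt ℝ ∞ (fun s => Real.arccos (-s)) s :=
    (Real.contDiffAt_arccos (x := -s) (by linarith [hs.2]) (by linarith [hs.1])).comp s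
      contDiff_neg.contDiffAt
  have h2 : ContDiffAt ℝ ∞ (fun s => Real.sqrt (1 - s ^ 2)) s :=
    ContDiffAt.sqrt (by fun_prop) (one_sub_sq_pos hs).ne'
  exact (h1.div h2 (Real.sqrt_pos.2 (one_sub_sq_pos hs)).ne').contDiffWithinAt

end S3

namespace S3

open Filter Topology

/-! ### Zonal functions and singular kernels -/

lemma inner_mem_Icc (x y : S3) : ⟪(x : E4), (y : E4)⟫ ∈ Set.Icc (-1 : ℝ) 1 := by
  have := abs_real_inner_le_norm (x : E4) (y : E4)
  simp only [norm_eq_of_mem_sphere, mul_one] at this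
  exact abs_le.1 this

lemma mul_inner_mem_Ioo {l : ℝ} (hl : l ∈ Set.Ioo (0 : ℝ) 1) (x y : S3) :
    l * ⟪(x : E4), (y : E4)⟫ ∈ Set.Ioo (-1 : ℝ) 1 := by
  obtain ⟨h1, h2⟩ := inner_mem_Icc x y
  constructor <;> nlinarith [hl.1, hl.2]

lemma contDiff_inner_const (w : E4) : ContDiff ℝ ∞ fun z : E4 => ⟪z, w⟫ :=
  contDiff_id.inner ℝ contDiff_const

lemma isSmooth_inner (w : E4) : IsSmooth fun x : S3 => ⟪(x : E4), w⟫ :=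
  isSmooth_of_ambient fun _ => (contDiff_inner_const w).contDiffAt

lemma isSmooth_inner_frame (i : Fin 3) (w : E4) : IsSmooth fun x : S3 => ⟪frame i (x : E4), w⟫ :=
  isSmooth_of_ambient (H := fun z => ⟪frame i z, w⟫) fun _ =>
    ((contDiff_inner_const w).comp (frame i).contDiff).contDiffAt

lemma D_inner_clm (L : E4 →L[ℝ] E4) (w : E4) (i : Fin 3) (x : S3) :
    D i (fun x : S3 => ⟪L (x : E4), w⟫) x = ⟪L (frame i (x : E4)), w⟫ := by
  have h : ∀ z : E4, ⟪L z, w⟫ = (innerSL ℝ w ∘L L) z := fun z => by simp [real_inner_comm]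
  simp only [h]
  exact D_clm i _ x

lemma D_inner (w : E4) (i : Fin 3) (x : S3) :
    D i (fun x : S3 => ⟪(x : E4), w⟫) x = ⟪frame i (x : E4), w⟫ :=
  D_inner_clm (ContinuousLinearMap.id ℝ E4) w i x

lemma D_inner_frame (w : E4) (i j : Fin 3) (x : S3) :
    D i (fun x : S3 => ⟪frame j (x : E4), w⟫) x = ⟪frame j (frame i (x : E4)), w⟫ :=
  D_inner_clm (frame j) w i x

lemma D_comp {k : ℝ → ℝ} {k' : ℝ} {f : S3 → ℝ} (hf : IsSmooth f) {y : S3}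
    (hk : HasDerivAt k k' (f y)) (i : Fin 3) : D i (fun y => k (f y)) y = k' * D i f y := by
  have h1 := (hf.differentiableAt (sphere_ne_zero y)).hasFDerivAt
  have h2 : HasDerivAt k k' ((fun z : E4 => f (proj z)) (y : E4)) := by simpa using hk
  have h : HasFDerivAt (fun z : E4 => k (f (proj z))) _ (y : E4) :=
    HasDerivAt.comp_hasFDerivAt (f := fun z : E4 => f (proj z)) (y : E4) h2 h1
  rw [D, h.fderiv]; simp [D]

lemma isSmooth_zonal {k : ℝ → ℝ} (hk : ContDiffOn ℝ ∞ k (Set.Ioo (-1) 1)) {l : ℝ}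
    (hl : l ∈ Set.Ioo (0 : ℝ) 1) (y : S3) :
    IsSmooth fun x : S3 => k (l * ⟪(x : E4), (y : E4)⟫) := by
  refine isSmooth_of_ambient (H := fun z => k (l * ⟪z, (y : E4)⟫)) fun x => ?_
  exact ContDiffAt.comp (x : E4)
    (hk.contDiffAt (isOpen_Ioo.mem_nhds (mul_inner_mem_Ioo hl x y)))
    (contDiffAt_const.mul (contDiff_inner_const _).contDiffAt)

lemma D_zonal {k k' : ℝ → ℝ} (hd : ∀ s ∈ Set.Ioo (-1 : ℝ) 1, HasDerivAt k (k' s) s) {l : ℝ}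
    (hl : l ∈ Set.Ioo (0 : ℝ) 1) (y x : S3) (i : Fin 3) :
    D i (fun x : S3 => k (l * ⟪(x : E4), (y : E4)⟫)) x
      = k' (l * ⟪(x : E4), (y : E4)⟫) * (l * ⟪frame i (x : E4), (y : E4)⟫) := by
  rw [D_comp ((isSmooth_const l).mul (isSmooth_inner (y : E4))) (hd _ (mul_inner_mem_Ioo hl x y)),
    D_const_mul (isSmooth_inner _), D_inner]

/-- The Laplacian on functions, as the sum of the squares of the frame derivatives. -/
noncomputable def lap (f : S3 → ℝ) (y : S3) : ℝ := ∑ i, D i (D i f) y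

lemma lap_zonal {k k' k'' : ℝ → ℝ} (hk' : ContDiffOn ℝ ∞ k' (Set.Ioo (-1) 1))
    (hd : ∀ s ∈ Set.Ioo (-1 : ℝ) 1, HasDerivAt k (k' s) s)
    (hd' : ∀ s ∈ Set.Ioo (-1 : ℝ) 1, HasDerivAt k' (k'' s) s) {l : ℝ}
    (hl : l ∈ Set.Ioo (0 : ℝ) 1) (y x : S3) :
    lap (fun x : S3 => k (l * ⟪(x : E4), (y : E4)⟫)) x
      = l ^ 2 * (1 - ⟪(x : E4), (y : E4)⟫ ^ 2) * k'' (l * ⟪(x : E4), (y : E4)⟫)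
        - 3 * (l * ⟪(x : E4), (y : E4)⟫) * k' (l * ⟪(x : E4), (y : E4)⟫) := by
  have h1 : ∀ i, D i (fun x : S3 => k (l * ⟪(x : E4), (y : E4)⟫)) = fun x : S3 =>
      k' (l * ⟪(x : E4), (y : E4)⟫) * (l * ⟪frame i (x : E4), (y : E4)⟫) := fun i => by
    ext x; exact D_zonal hd hl y x i
  have h2 : ∀ i, D i (D i (fun x : S3 => k (l * ⟪(x : E4), (y : E4)⟫))) x
      = l ^ 2 * k'' (l * ⟪(x : E4), (y : E4)⟫) * ⟪frame i (x : E4), (y : E4)⟫ ^ 2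
        - l * k' (l * ⟪(x : E4), (y : E4)⟫) * ⟪(x : E4), (y : E4)⟫ := fun i => by
    rw [h1, D_mul (isSmooth_zonal hk' hl y) ((isSmooth_const l).mul (isSmooth_inner_frame i _)),
      D_zonal hd' hl, D_const_mul (isSmooth_inner_frame i _), D_inner_frame, frame_frame_self,
      inner_neg_left]
    ring
  simp only [lap, h2]
  rw [Finset.sum_sub_distrib, ← Finset.mul_sum, sum_sq_inner_frame]
  simp
  ring

lemma isSmooth_lap {f : S3 → ℝ} (hf : IsSmooth f) : IsSmooth (lap f) :=
  IsSmooth.sum fun i => isSmooth_D (isSmooth_D hf i) i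

lemma integral_lap {f : S3 → ℝ} (hf : IsSmooth f) : ∫ x, lap f x ∂vol = 0 := by
  simp only [lap]
  rw [integral_finsetSum _ fun i _ =>
    integrable_of_continuous (isSmooth_D (isSmooth_D hf i) i).continuous]
  exact Finset.sum_eq_zero fun i _ => integral_D (isSmooth_D hf i) i

/-- The Laplacian of `-log (1 - l ⟪x, y⟫)` is at most `2 - 1 / (1 - l ⟪x, y⟫)`, and its integral
vanishes. This bounds the inverse square of the distance in the mean, uniformly in `l < 1`. -/
lemma integral_inv_le {l : ℝ} (hl : l ∈ Set.Ioo (0 : ℝ) 1) (y : S3) :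
    ∫ x : S3, (1 - l * ⟪(x : E4), (y : E4)⟫)⁻¹ ∂vol ≤ 4 * Real.pi ^ 2 := by
  have hne : ∀ s ∈ Set.Ioo (-1 : ℝ) 1, 1 - s ≠ 0 := fun s hs => by linarith [hs.2]
  have hc0 : ContDiffOn ℝ ∞ (fun s : ℝ => 1 - s) (Set.Ioo (-1) 1) := by fun_prop
  have hc : ContDiffOn ℝ ∞ (fun s : ℝ => -Real.log (1 - s)) (Set.Ioo (-1) 1) :=
    (hc0.log hne).neg
  have hc1 : ContDiffOn ℝ ∞ (fun s : ℝ => (1 - s)⁻¹) (Set.Ioo (-1) 1) := hc0.inv hne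
  have hd : ∀ s ∈ Set.Ioo (-1 : ℝ) 1,
      HasDerivAt (fun s : ℝ => -Real.log (1 - s)) ((1 - s)⁻¹) s := fun s hs => by
    refine ((((hasDerivAt_id s).const_sub 1).log (hne s hs)).neg).congr_deriv ?_
    simp [neg_div]
  have hd1 : ∀ s ∈ Set.Ioo (-1 : ℝ) 1,
      HasDerivAt (fun s : ℝ => (1 - s)⁻¹) (((1 - s) ^ 2)⁻¹) s := fun s hs => by
    refine (((hasDerivAt_id s).const_sub 1).inv (hne s hs)).congr_deriv ?_
    simp
  have h0 := integral_lap (isSmooth_zonal hc hl y)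
  have hi : Integrable (fun x : S3 => (1 - l * ⟪(x : E4), (y : E4)⟫)⁻¹) vol :=
    integrable_of_continuous (isSmooth_zonal hc1 hl y).continuous
  have hle : ∫ x, lap (fun x : S3 => -Real.log (1 - l * ⟪(x : E4), (y : E4)⟫)) x ∂vol
      ≤ ∫ x : S3, (2 - (1 - l * ⟪(x : E4), (y : E4)⟫)⁻¹) ∂vol := by
    refine integral_mono (integrable_of_continuous (isSmooth_lap (isSmooth_zonal hc hl y)).continuous)
      ((integrable_const 2).sub hi) fun x => ?_
    have hs := mul_inner_mem_Ioo hl x y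
    have e := lap_zonal hc1 hd hd1 hl y x
    rw [e]
    set t := ⟪(x : E4), (y : E4)⟫
    have hp : 0 < 1 - l * t := by linarith [hs.2]
    rw [← sub_nonneg]
    have : 2 - (1 - l * t)⁻¹ - (l ^ 2 * (1 - t ^ 2) * ((1 - l * t) ^ 2)⁻¹
        - 3 * (l * t) * (1 - l * t)⁻¹) = (1 - l ^ 2) / (1 - l * t) ^ 2 := by
      field_simp; ring
    rw [this]
    have : 0 ≤ 1 - l ^ 2 := by nlinarith [hl.1, hl.2]
    positivity
  rw [h0, integral_sub (integrable_const 2) hi, integral_const, vol_real_univ, smul_eq_mul] at hle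
  linarith

/-- A point mass at `y` would make the integrals of `integral_inv_le` unbounded as `l → 1`. -/
lemma vol_singleton (y : S3) : vol {y} = 0 := by
  have key : ∀ l ∈ Set.Ioo (0 : ℝ) 1, vol.real {y} ≤ 4 * Real.pi ^ 2 * (1 - l) := by
    intro l hl
    have hp : ∀ x : S3, 0 < 1 - l * ⟪(x : E4), (y : E4)⟫ := fun x => by
      linarith [(mul_inner_mem_Ioo hl x y).2]
    have hcont : Continuous fun x : S3 => (1 - l * ⟪(x : E4), (y : E4)⟫)⁻¹ :=
      Continuous.inv₀ (by fun_prop) fun x => (hp x).ne'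
    have h1 : ∫ x in {y}, (1 - l * ⟪(x : E4), (y : E4)⟫)⁻¹ ∂vol
        ≤ ∫ x : S3, (1 - l * ⟪(x : E4), (y : E4)⟫)⁻¹ ∂vol :=
      setIntegral_le_integral (integrable_of_continuous hcont)
        (.of_forall fun x => (inv_pos.2 (hp x)).le)
    rw [integral_singleton, inner_self_sphere, mul_one, smul_eq_mul, ← div_eq_mul_inv] at h1
    have := h1.trans (integral_inv_le hl y)
    rwa [div_le_iff₀ (by linarith [hl.2])] at this
  have h0 : vol.real {y} ≤ 0 := by
    refine ge_of_tendsto' (f := fun n : ℕ => 4 * Real.pi ^ 2 * (1 / ((n : ℝ) + 1 + 1)))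
      (a := 0) (x := atTop) ?_ fun n => ?_
    · have := (tendsto_one_div_add_atTop_nhds_zero_nat (𝕜 := ℝ)).comp (tendsto_add_atTop_nat 1)
      simpa [Function.comp_def] using this.const_mul (4 * Real.pi ^ 2)
    · have hn : (0 : ℝ) < (n : ℝ) + 1 + 1 := by positivity
      have hn1 : 1 / ((n : ℝ) + 1 + 1) < 1 := by
        rw [div_lt_one hn]; linarith [(Nat.cast_nonneg n : (0 : ℝ) ≤ n)]
      have := key (1 - 1 / ((n : ℝ) + 1 + 1)) ⟨by linarith, by linarith [one_div_pos.2 hn]⟩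
      simpa using this
  have := (measureReal_eq_zero_iff (measure_ne_top vol {y})).1 (le_antisymm h0 measureReal_nonneg)
  exact this

instance : NullSingletonClass vol := ⟨vol_singleton⟩

lemma inner_mem_Ioo {x y : S3} (h1 : x ≠ y) (h2 : x ≠ -y) :
    ⟪(x : E4), (y : E4)⟫ ∈ Set.Ioo (-1 : ℝ) 1 := by
  obtain ⟨ha, hb⟩ := inner_mem_Icc x y
  constructor
  · refine lt_of_le_of_ne ha fun h => h2 ?_
    have := (inner_eq_neg_one_iff_of_norm_eq_one (x := (x : E4)) (y := (y : E4)) (by simp)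
      (by simp)).1 h.symm
    exact Subtype.ext this
  · refine lt_of_le_of_ne hb fun h => h1 ?_
    have := (inner_eq_one_iff_of_norm_eq_one (x := (x : E4)) (y := (y : E4)) (by simp)
      (by simp)).1 h
    exact Subtype.ext this

lemma ae_inner_mem_Ioo (y : S3) :
    ∀ᵐ x : S3 ∂vol, ⟪(x : E4), (y : E4)⟫ ∈ Set.Ioo (-1 : ℝ) 1 := by
  filter_upwards [vol.ae_ne y, vol.ae_ne (-y)] with x h1 h2
  exact inner_mem_Ioo h1 h2

lemma lintegral_inv_le (y : S3) :
    ∫⁻ x : S3, ENNReal.ofReal (1 - ⟪(x : E4), (y : E4)⟫)⁻¹ ∂vol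
      ≤ ENNReal.ofReal (4 * Real.pi ^ 2) := by
  obtain ⟨l, hl⟩ := exists_seq_tendsto (𝓝[<] (1 : ℝ))
  have hmem : ∀ᶠ n in atTop, l n ∈ Set.Ioo (0 : ℝ) 1 :=
    hl.eventually (Ioo_mem_nhdsLT one_pos)
  have hl1 : Tendsto l atTop (𝓝 1) := hl.mono_right nhdsWithin_le_nhds
  calc ∫⁻ x : S3, ENNReal.ofReal (1 - ⟪(x : E4), (y : E4)⟫)⁻¹ ∂vol
      = ∫⁻ x : S3, liminf (fun n => ENNReal.ofReal (1 - l n * ⟪(x : E4), (y : E4)⟫)⁻¹) atTop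
          ∂vol := by
        refine lintegral_congr_ae ?_
        filter_upwards [ae_inner_mem_Ioo y] with x hx
        refine (Tendsto.liminf_eq ?_).symm
        have h : Tendsto (fun n => 1 - l n * ⟪(x : E4), (y : E4)⟫) atTop
            (𝓝 (1 - 1 * ⟪(x : E4), (y : E4)⟫)) := (hl1.mul_const _).const_sub 1
        rw [one_mul] at h
        exact ENNReal.tendsto_ofReal (h.inv₀ (by linarith [hx.2]))
    _ ≤ liminf (fun n => ∫⁻ x : S3, ENNReal.ofReal (1 - l n * ⟪(x : E4), (y : E4)⟫)⁻¹ ∂vol)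
          atTop := lintegral_liminf_le fun n => by fun_prop
    _ ≤ ENNReal.ofReal (4 * Real.pi ^ 2) := by
        refine liminf_le_of_frequently_le' (Eventually.frequently ?_)
        filter_upwards [hmem] with n hn
        have hp : ∀ x : S3, 0 < 1 - l n * ⟪(x : E4), (y : E4)⟫ := fun x => by
          linarith [(mul_inner_mem_Ioo hn x y).2]
        rw [← ofReal_integral_eq_lintegral_ofReal]
        · exact ENNReal.ofReal_le_ofReal (integral_inv_le hn y)
        · exact integrable_of_continuous (Continuous.inv₀ (by fun_prop) fun x => (hp x).ne')
        · exact .of_forall fun x => (inv_pos.2 (hp x)).le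

lemma integrable_inv (y : S3) : Integrable (fun x : S3 => (1 - ⟪(x : E4), (y : E4)⟫)⁻¹) vol := by
  refine ⟨Measurable.aestronglyMeasurable (by fun_prop), ?_⟩
  rw [hasFiniteIntegral_iff_ofReal]
  · exact (lintegral_inv_le y).trans_lt ENNReal.ofReal_lt_top
  · exact .of_forall fun x => inv_nonneg.2 (by linarith [(inner_mem_Icc x y).2])

lemma integrable_of_le_inv {F : Type*} [NormedAddCommGroup F] {g : S3 → F} {y : S3} {C : ℝ}
    (hg : AEStronglyMeasurable g vol)
    (h : ∀ x : S3, ⟪(x : E4), (y : E4)⟫ ∈ Set.Ioo (-1 : ℝ) 1 →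
      ‖g x‖ ≤ C * (1 - ⟪(x : E4), (y : E4)⟫)⁻¹) : Integrable g vol := by
  refine ((integrable_inv y).const_mul C).mono' hg ?_
  filter_upwards [ae_inner_mem_Ioo y] with x hx using h x hx

lemma abs_inner_frame_le (x y : S3) (i : Fin 3) :
    |⟪frame i (x : E4), (y : E4)⟫| ≤ 2 * Real.sqrt (1 - ⟪(x : E4), (y : E4)⟫) := by
  obtain ⟨h1, h2⟩ := inner_mem_Icc x y
  have h := sum_sq_inner_frame (x : E4) y
  have h3 : ⟪frame i (x : E4), (y : E4)⟫ ^ 2 ≤ ∑ i, ⟪frame i (x : E4), (y : E4)⟫ ^ 2 :=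
    Finset.single_le_sum (f := fun i => ⟪frame i (x : E4), (y : E4)⟫ ^ 2)
      (fun i _ => sq_nonneg _) (Finset.mem_univ i)
  refine abs_le_of_sq_le_sq ?_ (by positivity)
  rw [mul_pow, Real.sq_sqrt (by linarith)]
  simp only [norm_eq_of_mem_sphere] at h
  nlinarith

/-- A kernel `k` of the cosine of the distance, with derivative `k'`, whose singularity at the
diagonal is at most that of the inverse square of the distance, and the inverse cube for `k'`. Both
are bounded near antipodal points. -/
structure IsKernel (k k' : ℝ → ℝ) : Prop where
  contDiffOn : ContDiffOn ℝ ∞ k (Set.Ioo (-1) 1)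
  hasDerivAt : ∀ s ∈ Set.Ioo (-1 : ℝ) 1, HasDerivAt k (k' s) s
  measurable : Measurable k
  measurable' : Measurable k'
  bound : ∃ C, 0 ≤ C ∧ ∀ s ∈ Set.Ioo (-1 : ℝ) 1, |k s| ≤ C * (1 - s)⁻¹
  bound' : ∃ C, 0 ≤ C ∧ ∀ s ∈ Set.Ioo (-1 : ℝ) 1, |k' s| ≤ C * ((1 - s) * Real.sqrt (1 - s))⁻¹

section
variable {k k' : ℝ → ℝ} (hk : IsKernel k k')
include hk

/-- The derivative of `x ↦ ⟪x, y⟫` along the frame vanishes at `y`, so that the derivative of the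
kernel is no more singular than the inverse square of the distance. The bound is uniform in the
dilation `l`. -/
lemma IsKernel.exists_bound_frame : ∃ C, 0 ≤ C ∧ ∀ l ∈ Set.Ioc (0 : ℝ) 1, ∀ (x y : S3) (i : Fin 3),
    ⟪(x : E4), (y : E4)⟫ ∈ Set.Ioo (-1 : ℝ) 1 →
    |k (l * ⟪(x : E4), (y : E4)⟫)| ≤ C * (1 - ⟪(x : E4), (y : E4)⟫)⁻¹ ∧
    |k' (l * ⟪(x : E4), (y : E4)⟫) * (l * ⟪frame i (x : E4), (y : E4)⟫)|
      ≤ C * (1 - ⟪(x : E4), (y : E4)⟫)⁻¹ := by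
  obtain ⟨C, hC0, hC⟩ := hk.bound
  obtain ⟨C', hC0', hC'⟩ := hk.bound'
  refine ⟨2 * C + 8 * C', by positivity, fun l hl x y i hs => ?_⟩
  have hf := abs_inner_frame_le x y i
  set t := ⟪(x : E4), (y : E4)⟫
  have hlt : l * t ∈ Set.Ioo (-1 : ℝ) 1 := by
    constructor <;> nlinarith [hl.1, hl.2, hs.1, hs.2]
  have hp : 0 < 1 - t := by linarith [hs.2]
  have hge : (1 - t) / 2 ≤ 1 - l * t := by nlinarith [hl.1, hl.2, hs.1, hs.2]
  have hq : 0 < Real.sqrt (1 - t) := Real.sqrt_pos.2 hp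
  have hge2 : Real.sqrt (1 - t) / 2 ≤ Real.sqrt (1 - l * t) := by
    rw [Real.le_sqrt' (by positivity), div_pow, Real.sq_sqrt hp.le]
    linarith
  have hpl : 0 < 1 - l * t := by linarith
  have hb : C * (1 - l * t)⁻¹ ≤ 2 * C * (1 - t)⁻¹ := by
    calc C * (1 - l * t)⁻¹ ≤ C * ((1 - t) / 2)⁻¹ := by gcongr
      _ = _ := by field_simp
  have hb' : C' * ((1 - l * t) * Real.sqrt (1 - l * t))⁻¹ * (1 * (2 * Real.sqrt (1 - t)))
      ≤ 8 * C' * (1 - t)⁻¹ := by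
    calc _ ≤ C' * ((1 - t) / 2 * (Real.sqrt (1 - t) / 2))⁻¹ * (1 * (2 * Real.sqrt (1 - t))) := by
          gcongr
      _ = _ := by field_simp; ring
  have hn : 0 ≤ C * (1 - t)⁻¹ := by positivity
  have hn' : 0 ≤ C' * (1 - t)⁻¹ := by positivity
  constructor
  · have := hC _ hlt
    nlinarith
  · have h1 : |k' (l * t) * (l * ⟪frame i (x : E4), (y : E4)⟫)|
        ≤ C' * ((1 - l * t) * Real.sqrt (1 - l * t))⁻¹ * (1 * (2 * Real.sqrt (1 - t))) := by
      rw [abs_mul, abs_mul, abs_of_pos hl.1]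
      have h2 := hC' _ hlt
      have h3 := hl.2
      have h4 := hl.1.le
      gcongr
    nlinarith

lemma IsKernel.integrable (y : S3) {f : S3 → ℝ} (hf : Continuous f) :
    Integrable (fun x : S3 => k ⟪(x : E4), (y : E4)⟫ * f x) vol := by
  obtain ⟨C, hC0, hC⟩ := hk.exists_bound_frame
  obtain ⟨M, hM0, hM⟩ := exists_bound hf
  have := hk.measurable
  refine integrable_of_le_inv (y := y) (C := C * M)
    (Measurable.aestronglyMeasurable (by have := hf.measurable; fun_prop)) fun x hx => ?_
  have h1 := (hC 1 (by simp) x y 0 hx).1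
  rw [one_mul] at h1
  rw [norm_mul, Real.norm_eq_abs, mul_right_comm]
  have h2 : 0 < 1 - ⟪(x : E4), (y : E4)⟫ := by linarith [hx.2]
  exact mul_le_mul h1 (hM x) (norm_nonneg _) (by positivity)

lemma IsKernel.integrable_deriv (y : S3) (i : Fin 3) {f : S3 → ℝ} (hf : Continuous f) :
    Integrable (fun x : S3 => k' ⟪(x : E4), (y : E4)⟫ * ⟪frame i (x : E4), (y : E4)⟫ * f x) vol := by
  obtain ⟨C, hC0, hC⟩ := hk.exists_bound_frame
  obtain ⟨M, hM0, hM⟩ := exists_bound hf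
  have := hk.measurable'
  refine integrable_of_le_inv (y := y) (C := C * M)
    (Measurable.aestronglyMeasurable (by have := hf.measurable; fun_prop)) fun x hx => ?_
  have h1 := (hC 1 (by simp) x y i hx).2
  rw [one_mul, one_mul] at h1
  rw [norm_mul, Real.norm_eq_abs, mul_right_comm]
  have h2 : 0 < 1 - ⟪(x : E4), (y : E4)⟫ := by linarith [hx.2]
  exact mul_le_mul h1 (hM x) (norm_nonneg _) (by positivity)

lemma IsKernel.tendsto_integral (y : S3) {f : S3 → ℝ} (hf : Continuous f) :
    Tendsto (fun l => ∫ x : S3, k (l * ⟪(x : E4), (y : E4)⟫) * f x ∂vol) (𝓝[<] 1)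
      (𝓝 (∫ x : S3, k ⟪(x : E4), (y : E4)⟫ * f x ∂vol)) := by
  obtain ⟨C, hC0, hC⟩ := hk.exists_bound_frame
  obtain ⟨M, hM0, hM⟩ := exists_bound hf
  have := hk.measurable
  have hfm := hf.measurable
  have hl : ∀ᶠ l in 𝓝[<] (1 : ℝ), l ∈ Set.Ioo (0 : ℝ) 1 := Ioo_mem_nhdsLT one_pos
  refine tendsto_integral_filter_of_dominated_convergence
    (fun x => C * (1 - ⟪(x : E4), (y : E4)⟫)⁻¹ * M)
    (.of_forall fun l => Measurable.aestronglyMeasurable (by fun_prop)) ?_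
    (((integrable_inv y).const_mul C).mul_const M) ?_
  · filter_upwards [hl] with l hl
    filter_upwards [ae_inner_mem_Ioo y] with x hx
    rw [norm_mul, Real.norm_eq_abs]
    have h2 : 0 < 1 - ⟪(x : E4), (y : E4)⟫ := by linarith [hx.2]
    exact mul_le_mul (hC l ⟨hl.1, hl.2.le⟩ x y 0 hx).1 (hM x) (norm_nonneg _) (by positivity)
  · filter_upwards [ae_inner_mem_Ioo y] with x hx
    refine Tendsto.mul_const _ ?_
    have h := (hk.hasDerivAt _ hx).continuousAt.tendsto
    refine h.comp ?_
    have h3 : Tendsto (fun l : ℝ => l * ⟪(x : E4), (y : E4)⟫) (𝓝 1) (𝓝 (1 * ⟪(x : E4), (y : E4)⟫)) :=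
      tendsto_id.mul_const _
    rw [one_mul] at h3
    exact h3.mono_left nhdsWithin_le_nhds

/-- Integration by parts against a singular kernel: the dilated kernels `k (l ⟪x, y⟫)`, `l < 1`,
are smooth, and `l → 1` is harmless by dominated convergence. -/
lemma IsKernel.integral_mul_D (hk'c : ContinuousOn k' (Set.Ioo (-1) 1)) (y : S3) (i : Fin 3)
    {f : S3 → ℝ} (hf : IsSmooth f) :
    ∫ x : S3, k ⟪(x : E4), (y : E4)⟫ * D i f x ∂vol
      = -∫ x : S3, k' ⟪(x : E4), (y : E4)⟫ * ⟪frame i (x : E4), (y : E4)⟫ * f x ∂vol := by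
  obtain ⟨C, hC0, hC⟩ := hk.exists_bound_frame
  obtain ⟨M, hM0, hM⟩ := exists_bound hf.continuous
  have := hk.measurable'
  have hfm := hf.continuous.measurable
  have hl : ∀ᶠ l in 𝓝[<] (1 : ℝ), l ∈ Set.Ioo (0 : ℝ) 1 := Ioo_mem_nhdsLT one_pos
  have h1 := hk.tendsto_integral y (isSmooth_D hf i).continuous
  have h2 : Tendsto (fun l => ∫ x : S3, k' (l * ⟪(x : E4), (y : E4)⟫)
      * (l * ⟪frame i (x : E4), (y : E4)⟫) * f x ∂vol) (𝓝[<] 1)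
      (𝓝 (∫ x : S3, k' ⟪(x : E4), (y : E4)⟫ * ⟪frame i (x : E4), (y : E4)⟫ * f x ∂vol)) := by
    refine tendsto_integral_filter_of_dominated_convergence
      (fun x => C * (1 - ⟪(x : E4), (y : E4)⟫)⁻¹ * M)
      (.of_forall fun l => Measurable.aestronglyMeasurable (by fun_prop)) ?_
      (((integrable_inv y).const_mul C).mul_const M) ?_
    · filter_upwards [hl] with l hl
      filter_upwards [ae_inner_mem_Ioo y] with x hx
      rw [norm_mul, Real.norm_eq_abs]
      have h2 : 0 < 1 - ⟪(x : E4), (y : E4)⟫ := by linarith [hx.2]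
      exact mul_le_mul (hC l ⟨hl.1, hl.2.le⟩ x y i hx).2 (hM x) (norm_nonneg _) (by positivity)
    · filter_upwards [ae_inner_mem_Ioo y] with x hx
      refine Tendsto.mul_const _ ?_
      have h := (hk'c.continuousAt (isOpen_Ioo.mem_nhds hx)).tendsto
      have h3 : Tendsto (fun l : ℝ => l * ⟪(x : E4), (y : E4)⟫) (𝓝[<] 1)
          (𝓝 (1 * ⟪(x : E4), (y : E4)⟫)) :=
        (tendsto_id.mul_const _).mono_left nhdsWithin_le_nhds
      have h4 : Tendsto (fun l : ℝ => l * ⟪frame i (x : E4), (y : E4)⟫) (𝓝[<] 1)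
          (𝓝 (1 * ⟪frame i (x : E4), (y : E4)⟫)) :=
        (tendsto_id.mul_const _).mono_left nhdsWithin_le_nhds
      rw [one_mul] at h3 h4
      exact (h.comp h3).mul h4
  refine tendsto_nhds_unique h1 (h2.neg.congr' ?_)
  filter_upwards [hl] with l hl
  rw [S3.integral_mul_D (isSmooth_zonal hk.contDiffOn hl y) hf i]
  simp only [D_zonal hk.hasDerivAt hl]

end

end S3

namespace S3

open Filter Topology

/-! ### Convolution with a zonal kernel -/

/-- Convolution of a function on the sphere with a kernel depending on the distance. -/
noncomputable def conv (k : ℝ → ℝ) (f : S3 → ℝ) (y : S3) : ℝ :=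
  ∫ x : S3, k ⟪(x : E4), (y : E4)⟫ * f x ∂vol

/-- The substitution `x = g y` turns the convolution into an average of left translates,
which commutes with left-invariant derivatives. -/
lemma conv_eq (k : ℝ → ℝ) (f : S3 → ℝ) (y : S3) :
    conv k f y = ∫ g : S3, k ((g : E4) 0) * f (mul g y) ∂vol := by
  rw [conv, ← integral_mul_right _ y]
  simp [inner_qmul_right]

lemma inner_pole (g : S3) : ⟪(g : E4), (pole : E4)⟫ = (g : E4) 0 := by
  rw [inner_E4]; simp [pole, stdVec]

lemma isSmooth_comp_mul {f : S3 → ℝ} (hf : IsSmooth f) (g : S3) : IsSmooth fun y => f (mul g y) := by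
  have h : ContDiffOn ℝ ∞ ((fun z : E4 => f (proj z)) ∘ leftMul g) {0}ᶜ :=
    ContDiffOn.comp hf (leftMul (g : E4)).contDiff.contDiffOn fun z hz => qmul_ne_zero g hz
  refine h.congr fun z hz => ?_
  simp only [Function.comp, leftMul_apply, proj_qmul g hz]

lemma D_comp_mul {f : S3 → ℝ} (hf : IsSmooth f) (g : S3) (i : Fin 3) (y : S3) :
    D i (fun y => f (mul g y)) y = D i f (mul g y) := by
  have hy := sphere_ne_zero y
  have e : (fun z : E4 => f (mul g (proj z))) =ᶠ[𝓝 (y : E4)]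
      (fun z : E4 => f (proj z)) ∘ leftMul g := by
    filter_upwards [compl_zero_mem_nhds hy] with z hz
    simp only [Function.comp, leftMul_apply, proj_qmul g hz]
  have h1 : HasFDerivAt (fun z : E4 => f (proj z))
      (fderiv ℝ (fun z : E4 => f (proj z)) (leftMul g y)) (leftMul g y) :=
    (hf.differentiableAt (qmul_ne_zero g hy)).hasFDerivAt
  rw [D, e.fderiv_eq, (h1.comp (y : E4) (leftMul (g : E4)).hasFDerivAt).fderiv]
  simp only [ContinuousLinearMap.comp_apply, leftMul_apply, D, coe_mul, frame_qmul]

/-- The coframe at `z`, extended to be homogeneous of degree `-1`. -/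
noncomputable def coframe (i : Fin 3) (z : E4) : E4 →L[ℝ] ℝ :=
  (‖z‖ ^ 2)⁻¹ • innerSL ℝ (frame i z)

lemma coframe_apply (i : Fin 3) (z w : E4) : coframe i z w = (‖z‖ ^ 2)⁻¹ * ⟪frame i z, w⟫ := rfl

lemma norm_coframe (i : Fin 3) (z : E4) : ‖coframe i z‖ = ‖z‖⁻¹ := by
  rw [coframe, norm_smul, innerSL_apply_norm, norm_frame]
  by_cases h : ‖z‖ = 0
  · simp [h]
  · simp; field_simp

lemma contDiffOn_coframe (i : Fin 3) : ContDiffOn ℝ ∞ (coframe i) {0}ᶜ := by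
  have h1 : ContDiffOn ℝ ∞ (fun z : E4 => (‖z‖ ^ 2)⁻¹) {0}ᶜ :=
    ContDiffOn.inv (contDiff_norm_sq ℝ).contDiffOn fun z hz => by
      simpa using hz
  exact h1.smul ((innerSL ℝ (E := E4)).contDiff.comp (frame i).contDiff).contDiffOn

lemma hasFDerivAt_proj {f : S3 → ℝ} (hf : IsSmooth f) {z : E4} (hz : z ≠ 0) :
    HasFDerivAt (fun z : E4 => f (proj z)) (∑ i, D i f (proj z) • coframe i z) z := by
  refine (hf.differentiableAt hz).hasFDerivAt.congr_fderiv ?_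
  ext w
  rw [fderiv_proj_apply hf hz]
  simp only [sum_apply, smul_apply, coframe_apply,
    smul_eq_mul]
  exact Finset.sum_congr rfl fun i _ => mul_comm _ _

section
variable {k k' : ℝ → ℝ} (hk : IsKernel k k')
include hk

lemma IsKernel.integrable_zero : Integrable (fun g : S3 => k ((g : E4) 0)) vol := by
  simpa [inner_pole] using hk.integrable pole (continuous_const (y := (1 : ℝ)))

lemma IsKernel.integrable_mul (y : S3) {f : S3 → ℝ} (hf : Continuous f) :
    Integrable (fun g : S3 => k ((g : E4) 0) * f (mul g y)) vol := by
  have h := (integrable_mul_right_iff y).2 (hk.integrable y hf)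
  simpa [inner_qmul_right] using h

lemma IsKernel.hasFDerivAt_conv {f : S3 → ℝ} (hf : IsSmooth f) {z : E4} (hz : z ≠ 0) :
    HasFDerivAt (fun z : E4 => conv k f (proj z))
      (∑ i, conv k (D i f) (proj z) • coframe i z) z := by
  have hM : ∀ i, ∃ C, 0 ≤ C ∧ ∀ x, ‖D i f x‖ ≤ C := fun i =>
    exists_bound (isSmooth_D hf i).continuous
  choose M hM0 hM using hM
  have hz' : 0 < ‖z‖ := norm_pos_iff.2 hz
  have hball : ∀ w ∈ Metric.ball z (‖z‖ / 2), ‖z‖ / 2 ≤ ‖w‖ := fun w hw => by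
    have h1 := norm_sub_norm_le z w
    rw [mem_ball_iff_norm'] at hw
    linarith
  have hmeas := hk.integrable_zero.aestronglyMeasurable
  have h := hasFDerivAt_integral_of_dominated_of_fderiv_le (μ := vol) (x₀ := z) (𝕜 := ℝ)
    (s := Metric.ball z (‖z‖ / 2))
    (F := fun w (g : S3) => k ((g : E4) 0) * f (mul g (proj w)))
    (F' := fun w (g : S3) => k ((g : E4) 0) • ∑ i, D i f (mul g (proj w)) • coframe i w)
    (bound := fun g : S3 => ‖k ((g : E4) 0)‖ * ∑ i, M i * (‖z‖ / 2)⁻¹)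
    (Metric.ball_mem_nhds z (by positivity))
    (.of_forall fun w => (hk.integrable_mul (proj w) hf.continuous).aestronglyMeasurable)
    (hk.integrable_mul (proj z) hf.continuous)
    (hmeas.smul (Continuous.aestronglyMeasurable (continuous_finsetSum _ fun i _ =>
      ((isSmooth_D hf i).continuous.comp (continuous_mul_right _)).smul continuous_const)))
    (.of_forall fun g w hw => by
      rw [norm_smul]
      gcongr
      refine (norm_sum_le _ _).trans (Finset.sum_le_sum fun i _ => ?_)
      rw [norm_smul, norm_coframe]
      have := hball w hw
      have := hM0 i
      gcongr
      exact hM i _)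
    (hk.integrable_zero.norm.mul_const _)
    (.of_forall fun g w hw => by
      have hw0 : w ≠ 0 := by
        rw [← norm_pos_iff]; linarith [hball w hw]
      have h1 := (hasFDerivAt_proj (isSmooth_comp_mul hf g) hw0).const_mul (k ((g : E4) 0))
      simpa only [D_comp_mul hf] using h1)
  have e1 : (fun z : E4 => conv k f (proj z))
      = fun w => ∫ g : S3, k ((g : E4) 0) * f (mul g (proj w)) ∂vol := by
    ext w; rw [conv_eq]
  rw [e1]
  refine h.congr_fderiv ?_
  simp only [Finset.smul_sum, smul_smul, conv_eq]
  rw [integral_finsetSum]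
  · exact Finset.sum_congr rfl fun i _ => integral_smul_const _ _
  · exact fun i _ => (hk.integrable_mul _ (isSmooth_D hf i).continuous).smul_const _

lemma IsKernel.isSmooth_conv {f : S3 → ℝ} (hf : IsSmooth f) : IsSmooth (conv k f) := by
  have key : ∀ (n : ℕ) (f : S3 → ℝ), IsSmooth f →
      ContDiffOn ℝ n (fun z : E4 => conv k f (proj z)) {0}ᶜ := by
    intro n
    induction n with
    | zero =>
      intro f hf
      refine contDiffOn_zero.2 fun z hz => ?_
      exact (hk.hasFDerivAt_conv hf hz).continuousAt.continuousWithinAt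
    | succ n ih =>
      intro f hf
      push_cast
      rw [contDiffOn_succ_iff_fderiv_of_isOpen isOpen_compl_singleton]
      refine ⟨fun z hz => (hk.hasFDerivAt_conv hf hz).differentiableAt.differentiableWithinAt,
        fun h => absurd h (by simp), ?_⟩
      have h1 : ContDiffOn ℝ n (fun z => ∑ i, conv k (D i f) (proj z) • coframe i z) {0}ᶜ :=
        ContDiffOn.sum fun i _ => (ih _ (isSmooth_D hf i)).smul
          ((contDiffOn_coframe i).of_le (by exact_mod_cast le_top))
      exact h1.congr fun z hz => (hk.hasFDerivAt_conv hf hz).fderiv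
  exact contDiffOn_infty.2 fun n => key n f hf

lemma IsKernel.D_conv {f : S3 → ℝ} (hf : IsSmooth f) (i : Fin 3) (y : S3) :
    D i (conv k f) y = conv k (D i f) y := by
  rw [D, (hk.hasFDerivAt_conv hf (sphere_ne_zero y)).fderiv]
  simp [coframe_apply, inner_frame_frame]

lemma IsKernel.conv_sum {ι : Type*} {s : Finset ι} {f : ι → S3 → ℝ} (hf : ∀ i, Continuous (f i))
    (y : S3) : conv k (fun x => ∑ i ∈ s, f i x) y = ∑ i ∈ s, conv k (f i) y := by
  simp only [conv, Finset.mul_sum]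
  exact integral_finsetSum _ fun i _ => hk.integrable y (hf i)

end

end S3

namespace S3

open Filter Topology

/-! ### Green's function -/

/-- The fundamental solution `-(π - α) cot α / (4 π²)` as a function of `s = cos α`. -/
noncomputable def F0 (s : ℝ) : ℝ := -(s * A s) / (4 * Real.pi ^ 2)

/-- The derivative of `F0` on `(-1, 1)`. -/
noncomputable def F0' (s : ℝ) : ℝ := -(A s + s * A1 s) / (4 * Real.pi ^ 2)

/-- The kernel `phiOne` as a function of `s = cos α`. Its Laplacian is `F0` up to a constant. -/
noncomputable def F1 (s : ℝ) : ℝ := phiOne (Real.arccos s)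

/-- The derivative of `F1` on `(-1, 1)`. -/
noncomputable def F1' (s : ℝ) : ℝ := A s / (8 * Real.pi ^ 2)

section
variable {s : ℝ} (hs : s ∈ Set.Ioo (-1 : ℝ) 1)
include hs

lemma inv_sqrt_le : (Real.sqrt (1 - s))⁻¹ ≤ 2 * (1 - s)⁻¹ := by
  have hp : 0 < 1 - s := by linarith [hs.2]
  have hq : 0 < Real.sqrt (1 - s) := Real.sqrt_pos.2 hp
  have h2 : Real.sqrt (1 - s) ≤ 2 := Real.sqrt_le_iff.2 ⟨by norm_num, by linarith [hs.1]⟩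
  rw [← div_eq_mul_inv, le_div_iff₀ hp, inv_mul_le_iff₀ hq]
  nlinarith [Real.mul_self_sqrt hp.le]

lemma inv_le_inv_mul_sqrt : (1 - s)⁻¹ ≤ 2 * ((1 - s) * Real.sqrt (1 - s))⁻¹ := by
  have hp : 0 < 1 - s := by linarith [hs.2]
  have hq : 0 < Real.sqrt (1 - s) := Real.sqrt_pos.2 hp
  have h2 : Real.sqrt (1 - s) ≤ 2 := Real.sqrt_le_iff.2 ⟨by norm_num, by linarith [hs.1]⟩
  rw [← div_eq_mul_inv, le_div_iff₀ (by positivity), inv_mul_le_iff₀ hp]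
  nlinarith

lemma abs_A_le : |A s| ≤ 8 * (1 - s)⁻¹ := by
  rw [abs_of_pos (A_pos hs)]
  have h := A_le hs
  rw [div_eq_mul_inv] at h
  linarith [inv_sqrt_le hs]

lemma abs_A1_le : |A1 s| ≤ 8 * ((1 - s) * Real.sqrt (1 - s))⁻¹ := by
  rw [abs_of_nonneg (A1_nonneg hs), ← div_eq_mul_inv]
  exact A1_le hs

lemma hasDerivAt_F0 : HasDerivAt F0 (F0' s) s := by
  refine ((((hasDerivAt_id s).mul (hasDerivAt_A hs)).neg).div_const (4 * Real.pi ^ 2)).congr_deriv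
    ?_
  simp [F0']

lemma hasDerivAt_F0' : HasDerivAt F0' (-(2 * A1 s + s * A2 s) / (4 * Real.pi ^ 2)) s := by
  refine ((((hasDerivAt_A hs).add ((hasDerivAt_id s).mul (hasDerivAt_A1 hs))).neg).div_const
    (4 * Real.pi ^ 2)).congr_deriv ?_
  simp; ring

lemma hasDerivAt_F1 : HasDerivAt F1 (F1' s) s := by
  have h1 := Real.hasDerivAt_arccos (x := s) (by linarith [hs.1]) (by linarith [hs.2])
  have h2 : HasDerivAt phiOne ((-(2 * Real.pi - Real.arccos s) + Real.arccos s)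
      / (16 * Real.pi ^ 2)) (Real.arccos s) := by
    refine (((hasDerivAt_neg _).mul ((hasDerivAt_id _).const_sub (2 * Real.pi))).div_const
      (16 * Real.pi ^ 2)).congr_deriv ?_
    simp
  refine (h2.comp s h1).congr_deriv ?_
  rw [F1', A, Real.arccos_neg]
  ring

end

lemma isKernel_A : IsKernel A A1 where
  contDiffOn := contDiffOn_A
  hasDerivAt _ hs := hasDerivAt_A hs
  measurable := measurable_A
  measurable' := measurable_A1
  bound := ⟨8, by norm_num, fun _ hs => abs_A_le hs⟩
  bound' := ⟨8, by norm_num, fun _ hs => abs_A1_le hs⟩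

lemma four_pi_sq_ge_one : 1 ≤ 4 * Real.pi ^ 2 := by nlinarith [Real.pi_gt_three]

lemma contDiffOn_F0 : ContDiffOn ℝ ∞ F0 (Set.Ioo (-1) 1) :=
  ((contDiffOn_id.mul contDiffOn_A).neg).div_const _

lemma isKernel_F0 : IsKernel F0 F0' where
  contDiffOn := contDiffOn_F0
  hasDerivAt _ hs := hasDerivAt_F0 hs
  measurable := by have := measurable_A; unfold F0; fun_prop
  measurable' := by have := measurable_A; have := measurable_A1; unfold F0'; fun_prop
  bound := by
    refine ⟨8, by norm_num, fun s hs => ?_⟩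
    have h1 : |s| ≤ 1 := (abs_lt.2 hs).le
    have h := abs_A_le hs
    rw [F0, abs_div, abs_neg, abs_of_pos (by positivity : 0 < 4 * Real.pi ^ 2), abs_mul]
    refine (div_le_self (by positivity) four_pi_sq_ge_one).trans ?_
    nlinarith [abs_nonneg (A s), abs_nonneg s]
  bound' := by
    refine ⟨24, by norm_num, fun s hs => ?_⟩
    have h1 : |s| ≤ 1 := (abs_lt.2 hs).le
    have h := abs_A_le hs
    have h' := abs_A1_le hs
    have h2 := inv_le_inv_mul_sqrt hs
    rw [F0', abs_div, abs_neg, abs_of_pos (by positivity : 0 < 4 * Real.pi ^ 2)]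
    refine (div_le_self (by positivity) four_pi_sq_ge_one).trans ((abs_add_le _ _).trans ?_)
    rw [abs_mul]
    nlinarith [abs_nonneg (A1 s), abs_nonneg s]

lemma isKernel_F1 : IsKernel F1 F1' where
  contDiffOn := fun s hs => by
    have h1 : ContDiffAt ℝ ∞ Real.arccos s :=
      Real.contDiffAt_arccos (by linarith [hs.1]) (by linarith [hs.2])
    have h2 : ContDiff ℝ ∞ phiOne := by unfold phiOne; fun_prop
    exact (h2.contDiffAt.comp s h1).contDiffWithinAt
  hasDerivAt _ hs := hasDerivAt_F1 hs
  measurable := by unfold F1 phiOne; fun_prop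
  measurable' := by have := measurable_A; unfold F1'; fun_prop
  bound := by
    refine ⟨2, by norm_num, fun s hs => ?_⟩
    have hp : 0 < 1 - s := by linarith [hs.2]
    have h0 := Real.arccos_nonneg s
    have h1 := Real.arccos_le_pi s
    have hb : |F1 s| ≤ 1 := by
      rw [F1, phiOne, abs_div, abs_of_pos (by positivity : 0 < 16 * Real.pi ^ 2), abs_mul, abs_neg,
        abs_of_nonneg h0, abs_of_nonneg (by linarith), div_le_one (by positivity)]
      nlinarith [Real.pi_pos]
    refine hb.trans ?_
    rw [← div_eq_mul_inv, le_div_iff₀ hp]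
    linarith [hs.1]
  bound' := by
    refine ⟨16, by norm_num, fun s hs => ?_⟩
    have h := abs_A_le hs
    have h2 := inv_le_inv_mul_sqrt hs
    rw [F1', abs_div, abs_of_pos (by positivity : 0 < 8 * Real.pi ^ 2)]
    refine (div_le_self (abs_nonneg _) (by nlinarith [four_pi_sq_ge_one])).trans ?_
    linarith

lemma continuousOn_A1 : ContinuousOn A1 (Set.Ioo (-1) 1) := fun _ hs =>
  (hasDerivAt_A1 hs).continuousAt.continuousWithinAt

lemma continuousOn_F0' : ContinuousOn F0' (Set.Ioo (-1) 1) := fun _ hs =>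
  (hasDerivAt_F0' hs).continuousAt.continuousWithinAt

lemma continuousOn_F1' : ContinuousOn F1' (Set.Ioo (-1) 1) := fun _ hs =>
  ((hasDerivAt_A hs).div_const _).continuousAt.continuousWithinAt

lemma contDiffOn_F0' : ContDiffOn ℝ ∞ F0' (Set.Ioo (-1) 1) := by
  have h : ContDiffOn ℝ ∞ (deriv F0) (Set.Ioo (-1) 1) :=
    contDiffOn_F0.deriv_of_isOpen isOpen_Ioo (by simp)
  exact h.congr fun s hs => (hasDerivAt_F0 hs).deriv.symm

lemma integral_mul_lap {f g : S3 → ℝ} (hf : IsSmooth f) (hg : IsSmooth g) :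
    ∫ x, f x * lap g x ∂vol = ∫ x, lap f x * g x ∂vol := by
  have h1 (i : Fin 3) : Integrable (fun x => f x * D i (D i g) x) vol :=
    integrable_of_continuous (hf.continuous.mul (isSmooth_D (isSmooth_D hg i) i).continuous)
  have h2 (i : Fin 3) : Integrable (fun x => D i (D i f) x * g x) vol :=
    integrable_of_continuous ((isSmooth_D (isSmooth_D hf i) i).continuous.mul hg.continuous)
  simp only [lap, Finset.mul_sum, Finset.sum_mul]
  rw [integral_finsetSum _ fun i _ => h1 i, integral_finsetSum _ fun i _ => h2 i]
  refine Finset.sum_congr rfl fun i _ => ?_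
  rw [integral_mul_D hf (isSmooth_D hg i), integral_mul_D (isSmooth_D hf i) hg, neg_neg]

/-- The Laplacian of the dilated fundamental solution, plus the constant `1 / (2 π²)`: an
approximation of the identity at `y`. -/
noncomputable def peak (y : S3) (l : ℝ) (x : S3) : ℝ :=
  (1 - l ^ 2) * (2 * A1 (l * ⟪(x : E4), (y : E4)⟫)
    + l * ⟪(x : E4), (y : E4)⟫ * A2 (l * ⟪(x : E4), (y : E4)⟫)) / (4 * Real.pi ^ 2)

section
variable {l : ℝ} (hl : l ∈ Set.Ioo (0 : ℝ) 1) (y : S3)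
include hl

lemma lap_zonal_F0 (x : S3) :
    lap (fun x : S3 => F0 (l * ⟪(x : E4), (y : E4)⟫)) x = peak y l x - 1 / (2 * Real.pi ^ 2) := by
  rw [lap_zonal contDiffOn_F0' (fun _ hs => hasDerivAt_F0 hs) (fun _ hs => hasDerivAt_F0' hs) hl,
    peak]
  have hs := mul_inner_mem_Ioo hl x y
  set t := ⟪(x : E4), (y : E4)⟫
  have h1 := A1_ode hs
  have h2 := A2_ode hs
  have hpi := Real.pi_ne_zero
  simp only [F0']
  field_simp
  linear_combination -4 * h1 - 2 * (l * t) * h2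

lemma isSmooth_F0 : IsSmooth fun x : S3 => F0 (l * ⟪(x : E4), (y : E4)⟫) :=
  isSmooth_zonal contDiffOn_F0 hl y

lemma continuous_peak : Continuous (peak y l) := by
  have h := (isSmooth_lap (isSmooth_F0 hl y)).continuous.add
    (continuous_const (y := 1 / (2 * Real.pi ^ 2)))
  have e : peak y l = fun x => lap (fun x : S3 => F0 (l * ⟪(x : E4), (y : E4)⟫)) x
      + 1 / (2 * Real.pi ^ 2) := by
    ext x; rw [lap_zonal_F0 hl]; ring
  rw [e]
  exact h

lemma integral_peak : ∫ x, peak y l x ∂vol = 1 := by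
  have h := integral_lap (isSmooth_F0 hl y)
  simp only [lap_zonal_F0 hl] at h
  rw [integral_sub (integrable_of_continuous (continuous_peak hl y)) (integrable_const _),
    integral_const, vol_real_univ] at h
  have hpi := Real.pi_ne_zero
  have e : (2 * Real.pi ^ 2) • (1 / (2 * Real.pi ^ 2)) = (1 : ℝ) := by
    rw [smul_eq_mul]; field_simp
  rw [e] at h
  linarith

lemma peak_nonneg (x : S3) : 0 ≤ peak y l x := by
  have := two_A1_add_A2_nonneg (mul_inner_mem_Ioo hl x y)
  have : 0 ≤ 1 - l ^ 2 := by nlinarith [hl.1, hl.2]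
  unfold peak; positivity

lemma peak_le {δ : ℝ} (h0 : 0 < δ) (h1 : δ ≤ 1) {x : S3} (hx : ⟪(x : E4), (y : E4)⟫ ≤ 1 - δ) :
    peak y l x ≤ (1 - l ^ 2) * (16 / δ ^ 3) := by
  have hs := mul_inner_mem_Ioo hl x y
  have h2 : l * ⟪(x : E4), (y : E4)⟫ ≤ 1 - δ := by
    rcases le_total 0 ⟪(x : E4), (y : E4)⟫ with h | h <;> nlinarith [hl.1, hl.2]
  have h3 : 0 ≤ 1 - l ^ 2 := by nlinarith [hl.1, hl.2]
  have h4 := two_A1_add_A2_nonneg hs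
  unfold peak
  refine (div_le_self (by positivity) four_pi_sq_ge_one).trans ?_
  gcongr
  exact two_A1_add_A2_le hs h0 h1 h2

end

lemma tendstoUniformlyOn_peak (y : S3) {u : Set S3} (hu : IsOpen u) (hy : y ∈ u) :
    TendstoUniformlyOn (peak y) 0 (𝓝[<] 1) uᶜ := by
  obtain ⟨δ, h0, h1, hδ⟩ : ∃ δ : ℝ, 0 < δ ∧ δ ≤ 1 ∧
      ∀ x ∈ uᶜ, ⟪(x : E4), (y : E4)⟫ ≤ 1 - δ := by
    rcases uᶜ.eq_empty_or_nonempty with h | h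
    · exact ⟨1, one_pos, le_rfl, by simp [h]⟩
    · obtain ⟨x₀, hx₀, hmax⟩ := hu.isClosed_compl.isCompact.exists_isMaxOn h
        (f := fun x : S3 => ⟪(x : E4), (y : E4)⟫) (by fun_prop)
      have hlt : ⟪(x₀ : E4), (y : E4)⟫ < 1 := by
        refine lt_of_le_of_ne (inner_mem_Icc x₀ y).2 fun e => hx₀ ?_
        have := (inner_eq_one_iff_of_norm_eq_one (x := (x₀ : E4)) (y := (y : E4)) (by simp)
          (by simp)).1 e
        rw [Subtype.ext this]
        exact hy
      refine ⟨min 1 (1 - ⟪(x₀ : E4), (y : E4)⟫), lt_min one_pos (by linarith), min_le_left _ _,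
        fun x hx => ?_⟩
      have h2 := hmax hx
      simp only [Set.mem_ofPred_eq] at h2
      linarith [min_le_right 1 (1 - ⟪(x₀ : E4), (y : E4)⟫)]
  rw [Metric.tendstoUniformlyOn_iff]
  intro ε hε
  have hlim : Tendsto (fun l : ℝ => (1 - l ^ 2) * (16 / δ ^ 3)) (𝓝[<] 1) (𝓝 0) := by
    have h : Continuous fun l : ℝ => (1 - l ^ 2) * (16 / δ ^ 3) := by fun_prop
    have := h.tendsto 1
    norm_num at this
    exact this.mono_left nhdsWithin_le_nhds
  filter_upwards [Ioo_mem_nhdsLT one_pos, hlim.eventually (gt_mem_nhds hε)] with l hl h x hx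
  rw [Pi.zero_apply, dist_zero_left, Real.norm_of_nonneg (peak_nonneg hl y x)]
  exact (peak_le hl y h0 h1 (hδ x hx)).trans_lt h

/-- Convolution with `F0` inverts the Laplacian up to the mean value. -/
lemma conv_F0_lap {f : S3 → ℝ} (hf : IsSmooth f) (y : S3) :
    conv F0 (lap f) y = f y - 1 / (2 * Real.pi ^ 2) * ∫ x, f x ∂vol := by
  have h1 := isKernel_F0.tendsto_integral y (isSmooth_lap hf).continuous
  have hpeak := tendsto_integral_peak_smul_of_integrable_of_tendsto (μ := vol) (φ := peak y)
    (l := 𝓝[<] (1 : ℝ)) (x₀ := y) (t := Set.univ) (g := f) (a := f y) MeasurableSet.univ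
    univ_mem (measure_ne_top _ _)
    (by filter_upwards [Ioo_mem_nhdsLT one_pos] with l hl x using peak_nonneg hl y x)
    (fun u hu hy => tendstoUniformlyOn_peak y hu hy)
    (by
      refine tendsto_const_nhds.congr' ?_
      filter_upwards [Ioo_mem_nhdsLT one_pos] with l hl
      rw [setIntegral_univ, integral_peak hl])
    (by
      filter_upwards [Ioo_mem_nhdsLT one_pos] with l hl using
        (continuous_peak hl y).aestronglyMeasurable)
    (integrable_of_continuous hf.continuous) hf.continuous.continuousAt
  refine tendsto_nhds_unique h1 ((hpeak.sub_const _).congr' ?_)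
  filter_upwards [Ioo_mem_nhdsLT one_pos] with l hl
  rw [integral_mul_lap (isSmooth_F0 hl y) hf]
  simp only [lap_zonal_F0 hl, sub_mul, smul_eq_mul]
  rw [integral_sub, integral_const_mul]
  · exact integrable_of_continuous ((continuous_peak hl y).mul hf.continuous)
  · exact integrable_of_continuous (continuous_const.mul hf.continuous)

end S3

/-! ### Cross products -/

lemma det4_eq (a b c d : E4) : det4 a b c d =
    a 0 * (b 1 * (c 2 * d 3 - c 3 * d 2) - b 2 * (c 1 * d 3 - c 3 * d 1)
      + b 3 * (c 1 * d 2 - c 2 * d 1))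
    - a 1 * (b 0 * (c 2 * d 3 - c 3 * d 2) - b 2 * (c 0 * d 3 - c 3 * d 0)
      + b 3 * (c 0 * d 2 - c 2 * d 0))
    + a 2 * (b 0 * (c 1 * d 3 - c 3 * d 1) - b 1 * (c 0 * d 3 - c 3 * d 0)
      + b 3 * (c 0 * d 1 - c 1 * d 0))
    - a 3 * (b 0 * (c 1 * d 2 - c 2 * d 1) - b 1 * (c 0 * d 2 - c 2 * d 0)
      + b 2 * (c 0 * d 1 - c 1 * d 0)) := by
  simp [det4, Matrix.det_succ_row_zero, Fin.sum_univ_succ, Fin.succAbove]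
  ring

namespace S3

open Filter Topology

lemma cross_apply (x : S3) (v w : E4) (k : Fin 4) : cross x v w k = det4 x v w (stdVec k) := rfl

lemma cross_add_left (x : S3) (a b c : E4) : cross x (a + b) c = cross x a c + cross x b c := by
  ext k; simp only [cross_apply, det4_eq, PiLp.add_apply]; ring

lemma cross_smul_left (x : S3) (r : ℝ) (a c : E4) : cross x (r • a) c = r • cross x a c := by
  ext k; simp only [cross_apply, det4_eq, PiLp.smul_apply, smul_eq_mul]; ring

lemma cross_anticomm (x : S3) (a b : E4) : cross x a b = -cross x b a := by
  ext k; simp only [cross_apply, det4_eq, PiLp.neg_apply]; ring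

lemma cross_add_right (x : S3) (a b c : E4) : cross x c (a + b) = cross x c a + cross x c b := by
  rw [cross_anticomm, cross_add_left, cross_anticomm x c a, cross_anticomm x c b, neg_add]

lemma cross_smul_right (x : S3) (r : ℝ) (a c : E4) : cross x c (r • a) = r • cross x c a := by
  rw [cross_anticomm, cross_smul_left, cross_anticomm x c a, smul_neg]

lemma cross_self (x : S3) (a : E4) : cross x a a = 0 := by
  ext k; simp only [cross_apply, det4_eq, PiLp.zero_apply]; ring

lemma cross_base (x : S3) (a : E4) : cross x a x = 0 := by
  ext k; simp only [cross_apply, det4_eq, PiLp.zero_apply]; ring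

lemma cross_frame_zero_one (y : S3) :
    cross y (frame 0 (y : E4)) (frame 1 (y : E4)) = frame 2 (y : E4) := by
  have h := congrArg (· • frame 2 (y : E4)) (sphere_sq y)
  simp only [one_smul] at h
  rw [← h]
  apply ext_E4 <;> simp [cross_apply, det4_eq, stdVec, frame_zero, frame_one, frame_two] <;> ring

lemma cross_frame_one_two (y : S3) :
    cross y (frame 1 (y : E4)) (frame 2 (y : E4)) = frame 0 (y : E4) := by
  have h := congrArg (· • frame 0 (y : E4)) (sphere_sq y)
  simp only [one_smul] at h
  rw [← h]
  apply ext_E4 <;> simp [cross_apply, det4_eq, stdVec, frame_zero, frame_one, frame_two] <;> ring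

lemma cross_frame_two_zero (y : S3) :
    cross y (frame 2 (y : E4)) (frame 0 (y : E4)) = frame 1 (y : E4) := by
  have h := congrArg (· • frame 1 (y : E4)) (sphere_sq y)
  simp only [one_smul] at h
  rw [← h]
  apply ext_E4 <;> simp [cross_apply, det4_eq, stdVec, frame_zero, frame_one, frame_two] <;> ring

/-- The tangent vector at `y` with given components in the left-invariant frame. -/
noncomputable def vec (y : S3) (a : Fin 3 → ℝ) : E4 := ∑ i, a i • frame i (y : E4)

/-- The cross product of `ℝ³`, in components. -/
def cp (a b : Fin 3 → ℝ) : Fin 3 → ℝ :=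
  ![a 1 * b 2 - a 2 * b 1, a 2 * b 0 - a 0 * b 2, a 0 * b 1 - a 1 * b 0]

lemma inner_vec (y : S3) (a b : Fin 3 → ℝ) : ⟪vec y a, vec y b⟫ = ∑ i, a i * b i := by
  simp [vec, sum_inner, inner_sum, real_inner_smul_left, real_inner_smul_right, inner_frame_frame,
    mul_comm]

lemma inner_frame_vec (y : S3) (i : Fin 3) (a : Fin 3 → ℝ) : ⟪frame i (y : E4), vec y a⟫ = a i := by
  simp [vec, inner_sum, real_inner_smul_right, inner_frame_frame]

lemma inner_base_vec (y : S3) (a : Fin 3 → ℝ) : ⟪(y : E4), vec y a⟫ = 0 := by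
  rw [real_inner_comm]
  simp [vec, sum_inner, real_inner_smul_left, inner_frame_self]

/-- Left-invariant vector fields are compatible with the orientation of the sphere, so the cross
product has the usual formula in their frame. -/
lemma cross_vec (y : S3) (a b : Fin 3 → ℝ) : cross y (vec y a) (vec y b) = vec y (cp a b) := by
  have h10 := cross_anticomm y (frame 1 (y : E4)) (frame 0 (y : E4))
  have h21 := cross_anticomm y (frame 2 (y : E4)) (frame 1 (y : E4))
  have h02 := cross_anticomm y (frame 0 (y : E4)) (frame 2 (y : E4))
  rw [cross_frame_zero_one] at h10
  rw [cross_frame_one_two] at h21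
  rw [cross_frame_two_zero] at h02
  simp only [vec, Fin.sum_univ_three, cross_add_left, cross_add_right, cross_smul_left,
    cross_smul_right, cross_self, cross_frame_zero_one, cross_frame_one_two, cross_frame_two_zero,
    h10, h21, h02, cp]
  simp
  module

/-- The components of a field in the left-invariant frame. -/
noncomputable def comp (v : S3 → E4) (i : Fin 3) (x : S3) : ℝ := ⟪frame i (x : E4), v x⟫

/-- A tangent vector is determined by its components. -/
lemma eq_vec_comp {v : S3 → E4} (hv : IsSmoothField v) (x : S3) :
    v x = vec x fun i => comp v i x := tangent_expansion x (hv.tangent x)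

lemma isSmooth_frame (i : Fin 3) : IsSmooth fun x : S3 => frame i (x : E4) := isSmooth_clm (frame i)

lemma isSmooth_comp {v : S3 → E4} (hv : IsSmoothField v) (i : Fin 3) : IsSmooth (comp v i) :=
  (isSmooth_frame i).inner (isSmooth_of_contMDiff hv.smooth)

lemma isSmooth_vec {u : Fin 3 → S3 → ℝ} (hu : ∀ i, IsSmooth (u i)) :
    IsSmooth fun x => vec x fun i => u i x :=
  IsSmooth.sum fun i => (hu i).smul (isSmooth_frame i)

lemma isSmoothField_vec {u : Fin 3 → S3 → ℝ} (hu : ∀ i, IsSmooth (u i)) :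
    IsSmoothField fun x => vec x fun i => u i x :=
  ⟨(isSmooth_vec hu).contMDiff, fun x => inner_base_vec x _⟩

/-! ### Gradient, divergence and curl in the left-invariant frame -/

/-- The gradient of a function that extends, near `y`, to an arbitrary function on `ℝ⁴`. -/
lemma grad_eq_vec_of_ambient {f : S3 → ℝ} {H : E4 → ℝ} {H' : E4 →L[ℝ] ℝ} {y : S3}
    (hH : HasFDerivAt H H' (y : E4)) (hf : ∀ᶠ x : S3 in 𝓝 y, f x = H (x : E4)) :
    grad f y = vec y fun i => H' (frame i (y : E4)) := by
  have hy := sphere_ne_zero y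
  have hP : ContDiffAt ℝ ∞ (fun z => (proj z : E4)) (y : E4) :=
    contDiffOn_coe_proj.contDiffAt (compl_zero_mem_nhds hy)
  have hPd : DifferentiableAt ℝ (fun z => (proj z : E4)) (y : E4) :=
    hP.differentiableAt (by simp)
  have hproj : Tendsto proj (𝓝 (y : E4)) (𝓝 y) := by
    rw [tendsto_subtype_rng]
    simpa using hPd.continuousAt.tendsto
  have e : (fun z => f (proj z)) =ᶠ[𝓝 (y : E4)] fun z => H (proj z : E4) := hproj.eventually hf
  have h2 : HasFDerivAt H H' ((fun z => (proj z : E4)) (y : E4)) := by simpa using hH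
  have h3 : fderiv ℝ (fun z => H (proj z : E4)) y = _ := (h2.comp (y : E4) hPd.hasFDerivAt).fderiv
  have hP' := fderiv_proj_apply (f := fun x : S3 => (x : E4)) contDiffOn_coe_proj hy
  have hD : ∀ i, D i (fun x : S3 => (x : E4)) y = frame i (y : E4) := fun i =>
    D_clm i (ContinuousLinearMap.id ℝ E4) y
  refine ext_inner_right ℝ fun w => ?_
  rw [grad, gradient, InnerProductSpace.toDual_symm_apply, e.fderiv_eq, h3,
    ContinuousLinearMap.comp_apply, hP']
  simp [hD, vec, sum_inner, real_inner_smul_left, mul_comm]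

lemma grad_eq_vec {f : S3 → ℝ} (hf : IsSmooth f) (y : S3) : grad f y = vec y fun i => D i f y :=
  grad_eq_vec_of_ambient (hf.differentiableAt (sphere_ne_zero y)).hasFDerivAt
    (.of_forall fun x => by simp)

lemma dirDeriv_eq {v : S3 → E4} (hv : IsSmooth v) (y : S3) (w : E4) :
    dirDeriv v y w = ∑ i, ⟪frame i (y : E4), w⟫ • D i v y := by
  rw [dirDeriv, fderiv_proj_apply hv (sphere_ne_zero y)]; simp

lemma inner_stdVec (w : E4) (k : Fin 4) : ⟪w, stdVec k⟫ = w k := by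
  rw [inner_E4]; fin_cases k <;> simp [stdVec]

lemma div_eq_sum_inner {v : S3 → E4} (hv : IsSmooth v) (y : S3) :
    div v y = ∑ i, ⟪frame i (y : E4), D i v y⟫ := by
  simp only [div, dirDeriv_eq hv, inner_stdVec]
  simp only [inner_E4, Fin.sum_univ_three, Fin.sum_univ_four, PiLp.add_apply, PiLp.smul_apply,
    smul_eq_mul]
  ring

lemma curl_eq_sum_cross {v : S3 → E4} (hv : IsSmooth v) (y : S3) :
    curl v y = ∑ i, cross y (frame i (y : E4)) (D i v y) := by
  have h : ∀ (a w : E4), cross y a w = ∑ k, a k • cross y (stdVec k) w := by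
    intro a w
    have ha : a = ∑ k, a k • stdVec k := by
      apply ext_E4 <;> simp [stdVec, Fin.sum_univ_four]
    conv_lhs => rw [ha]
    simp only [Fin.sum_univ_four, cross_add_left, cross_smul_left]
  simp only [curl, dirDeriv_eq hv, inner_stdVec]
  simp only [h (frame _ (y : E4)), Fin.sum_univ_three, cross_add_right, cross_smul_right,
    Finset.sum_add_distrib]

lemma D_vec {u : Fin 3 → S3 → ℝ} (hu : ∀ i, IsSmooth (u i)) (i : Fin 3) (y : S3) :
    D i (fun x => vec x fun j => u j x) y
      = vec y (fun j => D i (u j) y) + ∑ j, u j y • frame j (frame i (y : E4)) := by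
  simp only [vec]
  rw [D_sum (fun j => (hu j).smul (isSmooth_frame j)), ← Finset.sum_add_distrib]
  refine Finset.sum_congr rfl fun j _ => ?_
  rw [D_smul (isSmooth_frame j) i y (hu j), D_clm]

lemma div_vec {u : Fin 3 → S3 → ℝ} (hu : ∀ i, IsSmooth (u i)) (y : S3) :
    div (fun x => vec x fun j => u j x) y = ∑ i, D i (u i) y := by
  rw [div_eq_sum_inner (isSmooth_vec hu)]
  refine Finset.sum_congr rfl fun i _ => ?_
  rw [D_vec hu, inner_add_right, inner_frame_vec, inner_sum, add_eq_left]
  refine Finset.sum_eq_zero fun j _ => ?_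
  rw [real_inner_smul_right, real_inner_comm, inner_frame_self, mul_zero]

/-- The components of the curl of a field with components `u`. The term `-2 u` comes from the
rotation of the left-invariant frame. -/
noncomputable def curlComp (u : Fin 3 → S3 → ℝ) : Fin 3 → S3 → ℝ :=
  ![fun y => D 1 (u 2) y - D 2 (u 1) y - 2 * u 0 y,
    fun y => D 2 (u 0) y - D 0 (u 2) y - 2 * u 1 y,
    fun y => D 0 (u 1) y - D 1 (u 0) y - 2 * u 2 y]

lemma curl_vec {u : Fin 3 → S3 → ℝ} (hu : ∀ i, IsSmooth (u i)) (y : S3) :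
    curl (fun x => vec x fun j => u j x) y = vec y fun i => curlComp u i y := by
  rw [curl_eq_sum_cross (isSmooth_vec hu)]
  have h10 := cross_anticomm y (frame 1 (y : E4)) (frame 0 (y : E4))
  have h21 := cross_anticomm y (frame 2 (y : E4)) (frame 1 (y : E4))
  have h02 := cross_anticomm y (frame 0 (y : E4)) (frame 2 (y : E4))
  rw [cross_frame_zero_one] at h10
  rw [cross_frame_one_two] at h21
  rw [cross_frame_two_zero] at h02
  have hn : ∀ a b, cross y a (-b) = -cross y a b := fun a b => by
    rw [← neg_one_smul ℝ b, cross_smul_right, neg_one_smul]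
  simp only [D_vec hu]
  simp only [vec, Fin.sum_univ_three, frame_frame_self, frame_one_frame_zero,
    frame_zero_frame_one, frame_two_frame_one, frame_one_frame_two, frame_zero_frame_two,
    frame_two_frame_zero, cross_add_right, cross_smul_right, cross_self, cross_base, hn,
    cross_frame_zero_one, cross_frame_one_two, cross_frame_two_zero, h10, h21, h02, curlComp]
  simp
  module

end S3

namespace S3

open Filter Topology

/-! ### The magnetic field -/

/-- Two integrations by parts against `F1`. -/
lemma conv_F1_D_D {f : S3 → ℝ} (hf : IsSmooth f) (m j : Fin 3) (y : S3) :
    conv F1 (D m (D j f)) y = 1 / (8 * Real.pi ^ 2) *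
      ∫ x : S3, (A ⟪(x : E4), (y : E4)⟫ * ⟪frame m (frame j (x : E4)), (y : E4)⟫ * f x
        + A1 ⟪(x : E4), (y : E4)⟫ * ⟪frame j (x : E4), (y : E4)⟫
          * (⟪frame m (x : E4), (y : E4)⟫ * f x)) ∂vol := by
  have hg : IsSmooth fun x : S3 => ⟪frame m (x : E4), (y : E4)⟫ * f x :=
    (isSmooth_inner_frame m _).mul hf
  have h1 := isKernel_F1.integral_mul_D continuousOn_F1' y m (isSmooth_D hf j)
  have h2 := isKernel_A.integral_mul_D continuousOn_A1 y j hg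
  simp only [D_mul (isSmooth_inner_frame m (y : E4)) hf, D_inner_frame, mul_add] at h2
  have hi1 : Integrable (fun x : S3 => A ⟪(x : E4), (y : E4)⟫
      * (⟪frame m (frame j (x : E4)), (y : E4)⟫ * f x)) vol := by
    refine isKernel_A.integrable y (Continuous.mul (by fun_prop) hf.continuous)
  have hi2 : Integrable (fun x : S3 => A ⟪(x : E4), (y : E4)⟫
      * (⟪frame m (x : E4), (y : E4)⟫ * D j f x)) vol :=
    isKernel_A.integrable y (Continuous.mul (by fun_prop) (isSmooth_D hf j).continuous)
  rw [integral_add hi1 hi2] at h2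
  have hi3 := isKernel_A.integrable_deriv y j hg.continuous
  simp only [mul_assoc] at hi1 hi3 h1 h2 ⊢
  rw [conv, h1, integral_add hi1 hi3]
  have e : ∀ x : S3, F1' ⟪(x : E4), (y : E4)⟫ * (⟪frame m (x : E4), (y : E4)⟫ * D j f x)
      = 1 / (8 * Real.pi ^ 2)
        * (A ⟪(x : E4), (y : E4)⟫ * (⟪frame m (x : E4), (y : E4)⟫ * D j f x)) := fun x => by
    rw [F1']; ring
  simp only [e]
  rw [integral_const_mul]
  linear_combination (-1 / (8 * Real.pi ^ 2)) * h2

/-- The Laplacian of `F1` is `F0` plus a constant. -/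
lemma conv_F1_lap {f : S3 → ℝ} (hf : IsSmooth f) (y : S3) :
    conv F1 (lap f) y = conv F0 f y + 1 / (8 * Real.pi ^ 2) * ∫ x, f x ∂vol := by
  have h : conv F1 (lap f) y = ∑ i, conv F1 (D i (D i f)) y :=
    isKernel_F1.conv_sum (fun i => (isSmooth_D (isSmooth_D hf i) i).continuous) y
  have hint (i : Fin 3) : Integrable (fun x : S3 =>
      A ⟪(x : E4), (y : E4)⟫ * ⟪frame i (frame i (x : E4)), (y : E4)⟫ * f x
        + A1 ⟪(x : E4), (y : E4)⟫ * ⟪frame i (x : E4), (y : E4)⟫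
          * (⟪frame i (x : E4), (y : E4)⟫ * f x)) vol := by
    refine Integrable.add ?_ (isKernel_A.integrable_deriv y i
      (Continuous.mul (by fun_prop) hf.continuous))
    simp only [mul_assoc]
    exact isKernel_A.integrable y (Continuous.mul (by fun_prop) hf.continuous)
  simp only [h, conv_F1_D_D hf]
  rw [← Finset.mul_sum, ← integral_finsetSum _ fun i _ => hint i, conv, ← integral_const_mul,
    ← integral_const_mul, ← integral_add (isKernel_F0.integrable y hf.continuous)
      ((integrable_of_continuous hf.continuous).const_mul _)]
  refine integral_congr_ae ?_
  filter_upwards [ae_inner_mem_Ioo y] with x hx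
  have h1 := sum_sq_inner_frame (x : E4) y
  simp only [norm_eq_of_mem_sphere, Fin.sum_univ_three] at h1
  have h2 := A1_ode hx
  have hpi := Real.pi_ne_zero
  simp only [Fin.sum_univ_three, frame_frame_self, inner_neg_left, F0]
  field_simp
  linear_combination 4 * A1 ⟪(x : E4), (y : E4)⟫ * f x * h1 + 4 * f x * h2

lemma lap_conv {k k' : ℝ → ℝ} (hk : IsKernel k k') {f : S3 → ℝ} (hf : IsSmooth f) (y : S3) :
    lap (conv k f) y = conv k (lap f) y := by
  have h : conv k (lap f) y = ∑ i, conv k (D i (D i f)) y :=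
    hk.conv_sum (fun i => (isSmooth_D (isSmooth_D hf i) i).continuous) y
  rw [h, lap]
  refine Finset.sum_congr rfl fun i _ => ?_
  have e : D i (conv k f) = conv k (D i f) := funext fun y => hk.D_conv hf i y
  rw [e, hk.D_conv (isSmooth_D hf i)]

/-- The divergence of the field with components `u`. -/
noncomputable def divComp (u : Fin 3 → S3 → ℝ) (y : S3) : ℝ := ∑ i, D i (u i) y

lemma isSmooth_divComp {u : Fin 3 → S3 → ℝ} (hu : ∀ i, IsSmooth (u i)) : IsSmooth (divComp u) :=
  IsSmooth.sum fun i => isSmooth_D (hu i) i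

lemma integral_divComp {u : Fin 3 → S3 → ℝ} (hu : ∀ i, IsSmooth (u i)) :
    ∫ x, divComp u x ∂vol = 0 := by
  simp only [divComp]
  rw [integral_finsetSum _ fun i _ => integrable_of_continuous (isSmooth_D (hu i) i).continuous]
  exact Finset.sum_eq_zero fun i _ => integral_D (hu i) i

/-- The components of the magnetic field of the current with components `u`. With `W = F0 * u`, it
is `-(curl W + 2 W)`, corrected by a constant (in the left-invariant frame) and by a gradient. -/
noncomputable def magComp (u : Fin 3 → S3 → ℝ) : Fin 3 → S3 → ℝ :=
  ![fun y => D 2 (conv F0 (u 1)) y - D 1 (conv F0 (u 2)) y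
      - 1 / (4 * Real.pi ^ 2) * ∫ x, u 0 x ∂vol + 2 * D 0 (conv F1 (divComp u)) y,
    fun y => D 0 (conv F0 (u 2)) y - D 2 (conv F0 (u 0)) y
      - 1 / (4 * Real.pi ^ 2) * ∫ x, u 1 x ∂vol + 2 * D 1 (conv F1 (divComp u)) y,
    fun y => D 1 (conv F0 (u 0)) y - D 0 (conv F0 (u 1)) y
      - 1 / (4 * Real.pi ^ 2) * ∫ x, u 2 x ∂vol + 2 * D 2 (conv F1 (divComp u)) y]

section
variable {a b p : S3 → ℝ} (ha : IsSmooth a) (hb : IsSmooth b) (hp : IsSmooth p) (c : ℝ)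
include ha hb hp

lemma isSmooth_magComp_aux (i j k : Fin 3) :
    IsSmooth fun y => D i a y - D j b y - c + 2 * D k p y :=
  (((isSmooth_D ha i).sub (isSmooth_D hb j)).sub (isSmooth_const c)).add
    ((isSmooth_const 2).mul (isSmooth_D hp k))

lemma D_magComp_aux (l i j k : Fin 3) (y : S3) :
    D l (fun y => D i a y - D j b y - c + 2 * D k p y) y
      = D l (D i a) y - D l (D j b) y + 2 * D l (D k p) y := by
  have h1 := isSmooth_D ha i
  have h2 := isSmooth_D hb j
  have h3 := isSmooth_D hp k
  rw [D_add ((h1.sub h2).sub (isSmooth_const c)) ((isSmooth_const 2).mul h3),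
    D_sub (h1.sub h2) (isSmooth_const c), D_sub h1 h2, D_const_mul h3, D_const, sub_zero]

end

section
variable {u : Fin 3 → S3 → ℝ} (hu : ∀ i, IsSmooth (u i))
include hu

lemma isSmooth_conv_F0 (i : Fin 3) : IsSmooth (conv F0 (u i)) := isKernel_F0.isSmooth_conv (hu i)

lemma isSmooth_conv_F1_div : IsSmooth (conv F1 (divComp u)) :=
  isKernel_F1.isSmooth_conv (isSmooth_divComp hu)

lemma isSmooth_magComp (i : Fin 3) : IsSmooth (magComp u i) := by
  have h := isSmooth_conv_F0 hu
  have hp := isSmooth_conv_F1_div hu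
  fin_cases i
  · exact isSmooth_magComp_aux (h 1) (h 2) hp _ 2 1 0
  · exact isSmooth_magComp_aux (h 2) (h 0) hp _ 0 2 1
  · exact isSmooth_magComp_aux (h 0) (h 1) hp _ 1 0 2

lemma conv_F0_divComp (y : S3) :
    conv F0 (divComp u) y = divComp (fun i => conv F0 (u i)) y := by
  have h : conv F0 (divComp u) y = ∑ i, conv F0 (D i (u i)) y :=
    isKernel_F0.conv_sum (fun i => (isSmooth_D (hu i) i).continuous) y
  rw [h, divComp]
  exact Finset.sum_congr rfl fun i _ => (isKernel_F0.D_conv (hu i) i y).symm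

lemma lap_conv_F1_div (y : S3) :
    lap (conv F1 (divComp u)) y = divComp (fun i => conv F0 (u i)) y := by
  rw [lap_conv isKernel_F1 (isSmooth_divComp hu), conv_F1_lap (isSmooth_divComp hu),
    integral_divComp hu, mul_zero, add_zero, conv_F0_divComp hu]

lemma lap_conv_F0 (i : Fin 3) (y : S3) :
    lap (conv F0 (u i)) y = u i y - 1 / (2 * Real.pi ^ 2) * ∫ x, u i x ∂vol := by
  rw [lap_conv isKernel_F0 (hu i), conv_F0_lap (hu i)]

lemma divComp_magComp (y : S3) : divComp (magComp u) y = 0 := by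
  have h := isSmooth_conv_F0 hu
  have hp := isSmooth_conv_F1_div hu
  have h1 := lap_conv_F1_div hu y
  have c0 := D_one_two (h 0) y
  have c1 := D_two_zero (h 1) y
  have c2 := D_zero_one (h 2) y
  simp only [lap, divComp, Fin.sum_univ_three, smul_eq_mul] at h1 c0 c1 c2
  simp only [divComp, Fin.sum_univ_three, magComp, Matrix.cons_val_zero, Matrix.cons_val_one,
    Matrix.cons_val]
  rw [D_magComp_aux (h 1) (h 2) hp, D_magComp_aux (h 2) (h 0) hp, D_magComp_aux (h 0) (h 1) hp]
  linear_combination 2 * h1 - c0 - c1 - c2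

lemma curlComp_magComp (i : Fin 3) (y : S3) :
    curlComp (magComp u) i y = u i y - D i (conv F0 (divComp u)) y := by
  have h := isSmooth_conv_F0 hu
  have hp := isSmooth_conv_F1_div hu
  have e : conv F0 (divComp u) = divComp fun i => conv F0 (u i) :=
    funext fun y => conv_F0_divComp hu y
  have hq : D i (conv F0 (divComp u)) y = ∑ j, D i (D j (conv F0 (u j))) y := by
    rw [e]; exact D_sum (fun j => isSmooth_D (h j) j) i y
  have hl := lap_conv_F0 hu i y
  have p0 := D_one_two hp y
  have p1 := D_two_zero hp y
  have p2 := D_zero_one hp y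
  have hm : 1 / (2 * Real.pi ^ 2) * ∫ x, u i x ∂vol
      = 2 * (1 / (4 * Real.pi ^ 2) * ∫ x, u i x ∂vol) := by ring
  rw [hm] at hl
  rw [hq]
  simp only [lap, Fin.sum_univ_three, smul_eq_mul] at hl p0 p1 p2 ⊢
  fin_cases i
  · have c1 := D_zero_one (h 1) y
    have c2 := D_two_zero (h 2) y
    simp only [smul_eq_mul, Fin.zero_eta] at c1 c2 hl ⊢
    simp only [curlComp, magComp, Matrix.cons_val_zero, Matrix.cons_val_one, Matrix.cons_val]
    rw [D_magComp_aux (h 2) (h 0) hp, D_magComp_aux (h 0) (h 1) hp]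
    linear_combination hl + c1 - c2 + 2 * p0
  · have c1 := D_one_two (h 2) y
    have c2 := D_zero_one (h 0) y
    simp only [smul_eq_mul, Fin.mk_one] at c1 c2 hl ⊢
    simp only [curlComp, magComp, Matrix.cons_val_zero, Matrix.cons_val_one, Matrix.cons_val]
    rw [D_magComp_aux (h 0) (h 1) hp, D_magComp_aux (h 1) (h 2) hp]
    linear_combination hl + c1 - c2 + 2 * p1
  · have c1 := D_two_zero (h 0) y
    have c2 := D_one_two (h 1) y
    simp only [smul_eq_mul, Fin.reduceFinMk] at c1 c2 hl ⊢
    simp only [curlComp, magComp, Matrix.cons_val_zero, Matrix.cons_val_one, Matrix.cons_val]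
    rw [D_magComp_aux (h 1) (h 2) hp, D_magComp_aux (h 2) (h 0) hp]
    linear_combination hl + c1 - c2 + 2 * p2

/-- A divergence-free and curl-free field on the sphere vanishes: its components in the
left-invariant frame are harmonic, hence constant, and the curl of such a field `u` is `-2 u`. -/
lemma eq_zero_of_curlComp_of_divComp (hd : ∀ y, divComp u y = 0) (hc : ∀ i y, curlComp u i y = 0)
    (i : Fin 3) (y : S3) : u i y = 0 := by
  have hc0 : curlComp u 0 = fun _ => 0 := funext (hc 0)
  have hc1 : curlComp u 1 = fun _ => 0 := funext (hc 1)
  have hc2 : curlComp u 2 = fun _ => 0 := funext (hc 2)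
  have hdf : divComp u = fun _ => 0 := funext hd
  have aux : ∀ (l a b c d e : Fin 3) (y : S3),
      D l (fun y => D a (u b) y - D c (u d) y - 2 * u e y) y
        = D l (D a (u b)) y - D l (D c (u d)) y - 2 * D l (u e) y := fun l a b c d e y => by
    rw [D_sub ((isSmooth_D (hu b) a).sub (isSmooth_D (hu d) c)) ((isSmooth_const 2).mul (hu e)),
      D_sub (isSmooth_D (hu b) a) (isSmooth_D (hu d) c), D_const_mul (hu e)]
  have k0 : ∀ l y, D l (curlComp u 0) y = 0 := fun l y => by rw [hc0, D_const]
  have k1 : ∀ l y, D l (curlComp u 1) y = 0 := fun l y => by rw [hc1, D_const]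
  have k2 : ∀ l y, D l (curlComp u 2) y = 0 := fun l y => by rw [hc2, D_const]
  have kd : ∀ l y, ∑ j, D l (D j (u j)) y = 0 := fun l y => by
    rw [← D_sum (fun j => isSmooth_D (hu j) j)]
    change D l (divComp u) y = 0
    rw [hdf, D_const]
  simp only [curlComp, Matrix.cons_val_zero, Matrix.cons_val_one, Matrix.cons_val, aux] at k0 k1 k2
  simp only [Fin.sum_univ_three] at kd
  have hlap : ∀ i y, lap (u i) y = 0 := by
    intro i y
    simp only [lap, Fin.sum_univ_three]
    fin_cases i
    · have c1 := D_zero_one (hu 1) y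
      have c2 := D_two_zero (hu 2) y
      simp only [smul_eq_mul, Fin.zero_eta] at c1 c2 ⊢
      linear_combination kd 0 y - k2 1 y + k1 2 y - c1 + c2
    · have c1 := D_one_two (hu 2) y
      have c2 := D_zero_one (hu 0) y
      simp only [smul_eq_mul, Fin.mk_one] at c1 c2 ⊢
      linear_combination kd 1 y - k0 2 y + k2 0 y - c1 + c2
    · have c1 := D_two_zero (hu 0) y
      have c2 := D_one_two (hu 1) y
      simp only [smul_eq_mul, Fin.reduceFinMk] at c1 c2 ⊢
      linear_combination kd 2 y - k1 0 y + k0 1 y - c1 + c2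
  have hconst : ∀ i, u i = fun _ => 1 / (2 * Real.pi ^ 2) * ∫ x, u i x ∂vol := fun i => by
    ext y
    have h := conv_F0_lap (hu i) y
    have h0 : conv F0 (lap (u i)) y = 0 := by simp [conv, hlap]
    linarith
  have hD : ∀ i j y, D j (u i) y = 0 := fun i j y => by rw [hconst i, D_const]
  have h := hc i y
  fin_cases i <;> simp [curlComp, hD] at h ⊢ <;> exact h

end

/-! ### The Biot-Savart field -/

lemma A_eq_arccos (t : ℝ) : A t = (Real.pi - Real.arccos t) / Real.sin (Real.arccos t) := by
  rw [A, Real.arccos_neg, Real.sin_arccos]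

lemma phiLeft_geoDist (x y : S3) : phiLeft (geoDist x y) = -F0 ⟪(x : E4), (y : E4)⟫ := by
  have ht := inner_mem_Icc x y
  rw [phiLeft, geoDist, F0, A_eq_arccos, Real.cot_eq_cos_div_sin, Real.cos_arccos ht.1 ht.2]
  ring

lemma phiPar_geoDist (x y : S3) :
    phiPar (geoDist x y) = A ⟪(x : E4), (y : E4)⟫ / (4 * Real.pi ^ 2) := by
  rw [phiPar, geoDist, A_eq_arccos]

lemma phiOne_geoDist (x y : S3) : phiOne (geoDist x y) = F1 ⟪(x : E4), (y : E4)⟫ := rfl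

lemma gradSnd_eq {φ F : ℝ → ℝ} (hφ : ∀ x y : S3, φ (geoDist x y) = F ⟪(x : E4), (y : E4)⟫)
    {x y : S3} {F' : ℝ} (hF : HasDerivAt F F' ⟪(x : E4), (y : E4)⟫) :
    gradSnd φ x y = vec y fun i => F' * ⟪(x : E4), frame i (y : E4)⟫ := by
  have h1 : HasFDerivAt (fun z : E4 => ⟪(x : E4), z⟫) (innerSL ℝ (x : E4)) (y : E4) :=
    (innerSL ℝ (x : E4)).hasFDerivAt
  have h2 := HasDerivAt.comp_hasFDerivAt (f := fun z : E4 => ⟪(x : E4), z⟫) (y : E4) hF h1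
  rw [gradSnd, grad_eq_vec_of_ambient h2 (.of_forall fun y' => hφ x y')]
  simp

lemma geoDist_comm (x y : S3) : geoDist x y = geoDist y x := by
  rw [geoDist, geoDist, real_inner_comm]

lemma gradFst_eq_gradSnd (φ : ℝ → ℝ) (x y : S3) : gradFst φ x y = gradSnd φ y x := by
  simp only [gradFst, gradSnd, geoDist_comm]

section
variable {v : S3 → E4} (hv : IsSmoothField v)
include hv

/-- The scalar potential of Maxwell's equation is the convolution of `-F0` with the divergence. -/
lemma integral_inner_gradFst (y : S3) :
    ∫ x, ⟪v x, gradFst (fun α => -phiLeft α) x y⟫ ∂vol = -conv F0 (divComp (comp v)) y := by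
  have hu := isSmooth_comp hv
  have h0 : conv F0 (divComp (comp v)) y = ∑ i, conv F0 (D i (comp v i)) y :=
    isKernel_F0.conv_sum (fun i => (isSmooth_D (hu i) i).continuous) y
  have h1 : ∀ i, conv F0 (D i (comp v i)) y = _ := fun i =>
    isKernel_F0.integral_mul_D continuousOn_F0' y i (hu i)
  simp only [h0, h1]
  rw [Finset.sum_neg_distrib, neg_neg, ← integral_finsetSum _ fun i _ =>
    isKernel_F0.integrable_deriv y i (hu i).continuous]
  refine integral_congr_ae ?_
  filter_upwards [ae_inner_mem_Ioo y] with x hx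
  rw [real_inner_comm] at hx
  rw [gradFst_eq_gradSnd, gradSnd_eq (F := F0) (fun x y => by rw [phiLeft_geoDist, neg_neg])
    (hasDerivAt_F0 hx), eq_vec_comp hv x, inner_vec]
  refine Finset.sum_congr rfl fun i _ => ?_
  rw [real_inner_comm (y : E4) (x : E4), real_inner_comm (y : E4) (frame i (x : E4))]
  ring

/-- The magnetic field of `v`. -/
lemma isMagneticField_magComp :
    IsMagneticField v fun y => vec y fun i => magComp (comp v) i y := by
  have hu := isSmooth_comp hv
  have hm := isSmooth_magComp hu
  refine ⟨isSmoothField_vec hm, fun y => ?_, fun y => ?_⟩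
  · rw [div_vec hm]
    exact divComp_magComp hu y
  · have hq : IsSmooth fun y => -conv F0 (divComp (comp v)) y :=
      (isKernel_F0.isSmooth_conv (isSmooth_divComp hu)).neg
    simp only [integral_inner_gradFst hv]
    rw [curl_vec hm, grad_eq_vec hq, eq_vec_comp hv y]
    simp only [curlComp_magComp hu, D_neg (isKernel_F0.isSmooth_conv (isSmooth_divComp hu)), vec]
    rw [← Finset.sum_add_distrib]
    refine Finset.sum_congr rfl fun i _ => ?_
    rw [← add_smul, sub_eq_add_neg]

end

lemma IsMagneticField.unique {v B B' : S3 → E4} (h : IsMagneticField v B)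
    (h' : IsMagneticField v B') : B = B' := by
  have hu := isSmooth_comp h.isSmoothField
  have hu' := isSmooth_comp h'.isSmoothField
  have e : B = fun x => vec x fun i => comp B i x := funext fun x => eq_vec_comp h.isSmoothField x
  have e' : B' = fun x => vec x fun i => comp B' i x :=
    funext fun x => eq_vec_comp h'.isSmoothField x
  have hs : ∀ i, IsSmooth fun x => comp B i x - comp B' i x := fun i => (hu i).sub (hu' i)
  have hD : ∀ i j y, D j (fun x => comp B i x - comp B' i x) y
      = D j (comp B i) y - D j (comp B' i) y := fun i j y => D_sub (hu i) (hu' i) j y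
  have key := eq_zero_of_curlComp_of_divComp (u := fun i x => comp B i x - comp B' i x) hs ?_ ?_
  · rw [e, e']
    ext1 x
    have : (fun i => comp B i x) = fun i => comp B' i x := funext fun i => sub_eq_zero.1 (key i x)
    rw [this]
  · intro y
    have d := h.div_eq_zero y
    have d' := h'.div_eq_zero y
    rw [e, div_vec hu] at d
    rw [e', div_vec hu'] at d'
    simp only [divComp, hD, Finset.sum_sub_distrib, d, d', sub_zero]
  · intro i y
    have c := (h.maxwell y).trans (h'.maxwell y).symm
    rw [e, e', curl_vec hu, curl_vec hu'] at c
    have c2 := congrArg (fun w => ⟪frame i (y : E4), w⟫) c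
    simp only [inner_frame_vec] at c2
    fin_cases i <;> simp [curlComp, hD] at c2 ⊢ <;> linarith

lemma existsUnique_isMagneticField {v : S3 → E4} (hv : IsSmoothField v) :
    ∃! B : S3 → E4, IsMagneticField v B :=
  ⟨_, isMagneticField_magComp hv, fun _ h => h.unique (isMagneticField_magComp hv)⟩

lemma BS_eq {v : S3 → E4} (hv : IsSmoothField v) :
    BS v = fun y => vec y fun i => magComp (comp v) i y := by
  have hex : ∃ B, IsMagneticField v B := ⟨_, isMagneticField_magComp hv⟩
  rw [BS, dif_pos hex]
  exact hex.choose_spec.unique (isMagneticField_magComp hv)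

end S3

namespace S3

open Filter Topology

/-! ### Integrability on the product -/

lemma ae_prod_inner_mem_Ioo :
    ∀ᵐ p : S3 × S3 ∂(vol.prod vol), ⟪(p.1 : E4), (p.2 : E4)⟫ ∈ Set.Ioo (-1 : ℝ) 1 := by
  have hm : Measurable fun p : S3 × S3 => ⟪(p.1 : E4), (p.2 : E4)⟫ := by
    have : Continuous fun p : S3 × S3 => ⟪(p.1 : E4), (p.2 : E4)⟫ := by fun_prop
    exact this.measurable
  rw [ae_iff]
  refine (Measure.measure_prod_null (hm measurableSet_Ioo).compl).2 (.of_forall fun x => ?_)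
  have h := ae_inner_mem_Ioo x
  simp only [real_inner_comm (x : E4)] at h
  exact h

lemma integrable_prod_inv :
    Integrable (fun p : S3 × S3 => (1 - ⟪(p.1 : E4), (p.2 : E4)⟫)⁻¹) (vol.prod vol) := by
  have hc : Continuous fun p : S3 × S3 => 1 - ⟪(p.1 : E4), (p.2 : E4)⟫ := by fun_prop
  have hm : Measurable fun p : S3 × S3 => (1 - ⟪(p.1 : E4), (p.2 : E4)⟫)⁻¹ := hc.measurable.inv
  refine ⟨hm.aestronglyMeasurable, ?_⟩
  rw [hasFiniteIntegral_iff_ofReal]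
  · rw [lintegral_prod_symm _ hm.ennreal_ofReal.aemeasurable]
    calc _ ≤ ∫⁻ _ : S3, ENNReal.ofReal (4 * Real.pi ^ 2) ∂vol :=
          lintegral_mono fun y => lintegral_inv_le y
      _ < ⊤ := by
          rw [lintegral_const]
          exact ENNReal.mul_lt_top ENNReal.ofReal_lt_top (measure_lt_top _ _)
  · exact .of_forall fun p => inv_nonneg.2 (by linarith [(inner_mem_Icc p.1 p.2).2])

section
variable {k k' : ℝ → ℝ} (hk : IsKernel k k') {f : S3 × S3 → ℝ} (hf : Continuous f)
include hk hf

lemma IsKernel.integrable_prod_deriv (i : Fin 3) :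
    Integrable (fun p : S3 × S3 =>
      k' ⟪(p.1 : E4), (p.2 : E4)⟫ * ⟪frame i (p.1 : E4), (p.2 : E4)⟫ * f p) (vol.prod vol) := by
  obtain ⟨C, hC0, hC⟩ := hk.exists_bound_frame
  obtain ⟨M, hM⟩ := isCompact_univ.exists_bound_of_continuousOn hf.continuousOn
  have hc : Continuous fun p : S3 × S3 => ⟪(p.1 : E4), (p.2 : E4)⟫ := by fun_prop
  have hc' : Continuous fun p : S3 × S3 => ⟪frame i (p.1 : E4), (p.2 : E4)⟫ := by fun_prop
  refine ((integrable_prod_inv.const_mul C).mul_const M).mono'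
    (((hk.measurable'.comp hc.measurable).mul hc'.measurable).mul hf.measurable).aestronglyMeasurable
    ?_
  filter_upwards [ae_prod_inner_mem_Ioo] with p hp
  have h1 := (hC 1 (by simp) p.1 p.2 i hp).2
  rw [one_mul, one_mul] at h1
  rw [norm_mul, Real.norm_eq_abs]
  have h2 : 0 < 1 - ⟪(p.1 : E4), (p.2 : E4)⟫ := by linarith [hp.2]
  exact mul_le_mul h1 (hM p trivial) (norm_nonneg _) (by positivity)

lemma IsKernel.integrable_prod :
    Integrable (fun p : S3 × S3 => k ⟪(p.1 : E4), (p.2 : E4)⟫ * f p) (vol.prod vol) := by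
  obtain ⟨C, hC0, hC⟩ := hk.exists_bound_frame
  obtain ⟨M, hM⟩ := isCompact_univ.exists_bound_of_continuousOn hf.continuousOn
  have hc : Continuous fun p : S3 × S3 => ⟪(p.1 : E4), (p.2 : E4)⟫ := by fun_prop
  refine ((integrable_prod_inv.const_mul C).mul_const M).mono'
    ((hk.measurable.comp hc.measurable).mul hf.measurable).aestronglyMeasurable ?_
  filter_upwards [ae_prod_inner_mem_Ioo] with p hp
  have h1 := (hC 1 (by simp) p.1 p.2 0 hp).1
  rw [one_mul] at h1
  rw [norm_mul, Real.norm_eq_abs]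
  have h2 : 0 < 1 - ⟪(p.1 : E4), (p.2 : E4)⟫ := by linarith [hp.2]
  exact mul_le_mul h1 (hM p trivial) (norm_nonneg _) (by positivity)

end

/-! ### The integrands in the left-invariant frame -/

lemma leftTrans_vec (y x : S3) (a : Fin 3 → ℝ) : leftTrans y x (vec x a) = vec y a :=
  leftTrans_sum_frame y x a

section
variable {v : S3 → E4} (hv : IsSmoothField v)
include hv

lemma leftIntegrand₂_eq (x y : S3) :
    leftIntegrand₂ v (x, y) = ∑ i, comp v i x * comp v i y := by
  rw [leftIntegrand₂, eq_vec_comp hv x, eq_vec_comp hv y, leftTrans_vec, inner_vec]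

lemma leftIntegrand₁_eq {x y : S3} (h : ⟪(x : E4), (y : E4)⟫ ∈ Set.Ioo (-1 : ℝ) 1) :
    leftIntegrand₁ v (x, y) = ∑ i, F0' ⟪(x : E4), (y : E4)⟫ * ⟪frame i (x : E4), (y : E4)⟫
      * cp (fun i => comp v i x) (fun i => comp v i y) i := by
  rw [leftIntegrand₁, eq_vec_comp hv x, eq_vec_comp hv y, leftTrans_vec, cross_vec,
    gradSnd_eq (F := fun s => -F0 s) phiLeft_geoDist (hasDerivAt_F0 h).neg, inner_vec]
  refine Finset.sum_congr rfl fun i _ => ?_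
  rw [inner_frame_left]
  ring

/-- The Hessian of `F1`, which is singular only at coinciding and at antipodal points. -/
lemma leftIntegrand₃_eq {x y : S3} (h : ⟪(x : E4), (y : E4)⟫ ∈ Set.Ioo (-1 : ℝ) 1) :
    leftIntegrand₃ v (x, y) = 1 / (8 * Real.pi ^ 2) * ∑ m, ∑ j,
      (A ⟪(x : E4), (y : E4)⟫
          * (⟪frame m (frame j (x : E4)), (y : E4)⟫ * comp v j x * comp v m y)
        + A1 ⟪(x : E4), (y : E4)⟫ * ⟪frame j (x : E4), (y : E4)⟫
          * (⟪frame m (x : E4), (y : E4)⟫ * comp v j x * comp v m y)) := by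
  have hev : ∀ᶠ y' : S3 in 𝓝 y, ⟪leftTrans y' x (v x), gradSnd phiOne x y'⟫
      = ∑ j, comp v j x * (F1' ⟪(x : E4), (y' : E4)⟫ * ⟪(x : E4), frame j (y' : E4)⟫) := by
    have hc : Continuous fun y' : S3 => ⟪(x : E4), (y' : E4)⟫ := by fun_prop
    filter_upwards [hc.continuousAt.preimage_mem_nhds (isOpen_Ioo.mem_nhds h)] with y' h'
    rw [eq_vec_comp hv x, leftTrans_vec, gradSnd_eq phiOne_geoDist (hasDerivAt_F1 h'), inner_vec]
  have hd : ∀ j, HasFDerivAt (fun z : E4 =>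
      comp v j x * (F1' ⟪(x : E4), z⟫ * ⟪(x : E4), frame j z⟫)) _ (y : E4) := fun j =>
    ((HasDerivAt.comp_hasFDerivAt (f := fun z : E4 => ⟪(x : E4), z⟫) (y : E4)
      ((hasDerivAt_A h).div_const (8 * Real.pi ^ 2)) (innerSL ℝ (x : E4)).hasFDerivAt).mul
      (((innerSL ℝ (x : E4)) ∘L frame j).hasFDerivAt)).const_mul _
  have hsum : HasFDerivAt (fun z : E4 =>
      ∑ j, comp v j x * (F1' ⟪(x : E4), z⟫ * ⟪(x : E4), frame j z⟫)) _ (y : E4) :=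
    HasFDerivAt.fun_sum fun j _ => hd j
  rw [leftIntegrand₃, grad_eq_vec_of_ambient hsum hev, eq_vec_comp hv y, inner_vec, Finset.mul_sum]
  refine Finset.sum_congr rfl fun m _ => ?_
  rw [sum_apply, Finset.sum_mul, Finset.mul_sum]
  refine Finset.sum_congr rfl fun j _ => ?_
  rw [inner_frame_left m (frame j (x : E4)), inner_frame_left j (x : E4) (frame m (y : E4)),
    inner_frame_left m (x : E4), inner_frame_left j (x : E4)]
  simp
  ring

lemma continuous_comp (i : Fin 3) : Continuous (comp v i) := (isSmooth_comp hv i).continuous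

lemma integrable_leftIntegrand₁ : Integrable (leftIntegrand₁ v) (vol.prod vol) := by
  have hc := continuous_comp hv
  have hcp : ∀ i, Continuous fun p : S3 × S3 =>
      cp (fun i => comp v i p.1) (fun i => comp v i p.2) i := fun i => by
    fin_cases i <;> simp only [cp] <;> simp <;> fun_prop
  have h : Integrable (fun p : S3 × S3 => ∑ i, F0' ⟪(p.1 : E4), (p.2 : E4)⟫
      * ⟪frame i (p.1 : E4), (p.2 : E4)⟫
      * cp (fun i => comp v i p.1) (fun i => comp v i p.2) i) (vol.prod vol) :=
    integrable_finsetSum _ fun i _ => isKernel_F0.integrable_prod_deriv (hcp i) i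
  refine h.congr ?_
  filter_upwards [ae_prod_inner_mem_Ioo] with p hp using (leftIntegrand₁_eq hv hp).symm

lemma integrable_leftIntegrand₂ : Integrable (leftIntegrand₂ v) (vol.prod vol) := by
  have hc := continuous_comp hv
  have h : Continuous (leftIntegrand₂ v) := by
    have e : leftIntegrand₂ v = fun p => ∑ i, comp v i p.1 * comp v i p.2 :=
      funext fun p => leftIntegrand₂_eq hv p.1 p.2
    rw [e]; fun_prop
  obtain ⟨M, hM⟩ := isCompact_univ.exists_bound_of_continuousOn h.continuousOn
  exact Integrable.of_bound h.aestronglyMeasurable M (.of_forall fun p => hM p trivial)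

lemma integrable_leftIntegrand₃ : Integrable (leftIntegrand₃ v) (vol.prod vol) := by
  have hc := continuous_comp hv
  have h : Integrable (fun p : S3 × S3 => 1 / (8 * Real.pi ^ 2) * ∑ m, ∑ j,
      (A ⟪(p.1 : E4), (p.2 : E4)⟫
          * (⟪frame m (frame j (p.1 : E4)), (p.2 : E4)⟫ * comp v j p.1 * comp v m p.2)
        + A1 ⟪(p.1 : E4), (p.2 : E4)⟫ * ⟪frame j (p.1 : E4), (p.2 : E4)⟫
          * (⟪frame m (p.1 : E4), (p.2 : E4)⟫ * comp v j p.1 * comp v m p.2))) (vol.prod vol) :=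
    (integrable_finsetSum _ fun m _ => integrable_finsetSum _ fun j _ =>
      (isKernel_A.integrable_prod (by fun_prop)).add
        (isKernel_A.integrable_prod_deriv (by fun_prop) j)).const_mul _
  refine h.congr ?_
  filter_upwards [ae_prod_inner_mem_Ioo] with p hp using (leftIntegrand₃_eq hv hp).symm

/-- Integration by parts moves the derivatives from the kernel to the field. -/
lemma integral_leftIntegrand₁_left (y : S3) :
    ∫ x, leftIntegrand₁ v (x, y) ∂vol =
      comp v 0 y * (D 2 (conv F0 (comp v 1)) y - D 1 (conv F0 (comp v 2)) y)
      + comp v 1 y * (D 0 (conv F0 (comp v 2)) y - D 2 (conv F0 (comp v 0)) y)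
      + comp v 2 y * (D 1 (conv F0 (comp v 0)) y - D 0 (conv F0 (comp v 1)) y) := by
  have hu := isSmooth_comp hv
  have hD : ∀ i j, D i (conv F0 (comp v j)) y = -∫ x : S3, F0' ⟪(x : E4), (y : E4)⟫
      * ⟪frame i (x : E4), (y : E4)⟫ * comp v j x ∂vol := fun i j =>
    (isKernel_F0.D_conv (hu j) i y).trans (isKernel_F0.integral_mul_D continuousOn_F0' y i (hu j))
  have hint : ∀ i j, Integrable (fun x : S3 => F0' ⟪(x : E4), (y : E4)⟫
      * ⟪frame i (x : E4), (y : E4)⟫ * comp v j x) vol := fun i j =>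
    isKernel_F0.integrable_deriv y i (hu j).continuous
  -- The coefficients of `F0' * ⟪frame i x, y⟫ * comp v j x` in the triple product.
  let c : Fin 3 → Fin 3 → ℝ := ![![0, comp v 2 y, -comp v 1 y], ![-comp v 2 y, 0, comp v 0 y],
    ![comp v 1 y, -comp v 0 y, 0]]
  have e : ∫ x, leftIntegrand₁ v (x, y) ∂vol = ∫ x : S3, ∑ i, ∑ j, c i j
      * (F0' ⟪(x : E4), (y : E4)⟫ * ⟪frame i (x : E4), (y : E4)⟫ * comp v j x) ∂vol := by
    refine integral_congr_ae ?_
    filter_upwards [ae_inner_mem_Ioo y] with x hx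
    rw [leftIntegrand₁_eq hv hx]
    simp [Fin.sum_univ_three, cp, c]
    ring
  rw [e, integral_finsetSum _ fun i _ => integrable_finsetSum _ fun j _ => (hint i j).const_mul _]
  have e' : ∀ i, ∫ x : S3, ∑ j, c i j * (F0' ⟪(x : E4), (y : E4)⟫ * ⟪frame i (x : E4), (y : E4)⟫
      * comp v j x) ∂vol = ∑ j, c i j * -D i (conv F0 (comp v j)) y := fun i => by
    rw [integral_finsetSum _ fun j _ => (hint i j).const_mul _]
    exact Finset.sum_congr rfl fun j _ => by rw [integral_const_mul, hD, neg_neg]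
  simp only [e']
  simp [Fin.sum_univ_three, c]
  ring

lemma integral_leftIntegrand₂_left (y : S3) :
    ∫ x, leftIntegrand₂ v (x, y) ∂vol = ∑ m, comp v m y * ∫ x, comp v m x ∂vol := by
  simp only [leftIntegrand₂_eq hv]
  rw [integral_finsetSum _ fun i _ =>
    (integrable_of_continuous (continuous_comp hv i)).mul_const _]
  exact Finset.sum_congr rfl fun i _ => by rw [integral_mul_const, mul_comm]

lemma integral_leftIntegrand₃_left (y : S3) :
    ∫ x, leftIntegrand₃ v (x, y) ∂vol
      = ∑ m, comp v m y * D m (conv F1 (divComp (comp v))) y := by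
  have hu := isSmooth_comp hv
  have hD : ∀ m, D m (conv F1 (divComp (comp v))) y
      = ∑ j, conv F1 (D m (D j (comp v j))) y := fun m => by
    rw [isKernel_F1.D_conv (isSmooth_divComp hu)]
    have e : D m (divComp (comp v)) = fun y => ∑ j, D m (D j (comp v j)) y :=
      funext fun y => D_sum (fun j => isSmooth_D (hu j) j) m y
    rw [e, isKernel_F1.conv_sum fun j => (isSmooth_D (isSmooth_D (hu j) j) m).continuous]
  have hint : ∀ m j, Integrable (fun x : S3 =>
      A ⟪(x : E4), (y : E4)⟫ * ⟪frame m (frame j (x : E4)), (y : E4)⟫ * comp v j x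
        + A1 ⟪(x : E4), (y : E4)⟫ * ⟪frame j (x : E4), (y : E4)⟫
          * (⟪frame m (x : E4), (y : E4)⟫ * comp v j x)) vol := fun m j => by
    refine Integrable.add ?_ (isKernel_A.integrable_deriv y j
      (Continuous.mul (by fun_prop) (hu j).continuous))
    simp only [mul_assoc]
    exact isKernel_A.integrable y (Continuous.mul (by fun_prop) (hu j).continuous)
  have e : ∫ x, leftIntegrand₃ v (x, y) ∂vol = ∫ x : S3, ∑ m, ∑ j,
      (comp v m y * (1 / (8 * Real.pi ^ 2))) * (A ⟪(x : E4), (y : E4)⟫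
        * ⟪frame m (frame j (x : E4)), (y : E4)⟫ * comp v j x
        + A1 ⟪(x : E4), (y : E4)⟫ * ⟪frame j (x : E4), (y : E4)⟫
          * (⟪frame m (x : E4), (y : E4)⟫ * comp v j x)) ∂vol := by
    refine integral_congr_ae ?_
    filter_upwards [ae_inner_mem_Ioo y] with x hx
    rw [leftIntegrand₃_eq hv hx, Finset.mul_sum]
    refine Finset.sum_congr rfl fun m _ => ?_
    rw [Finset.mul_sum]
    refine Finset.sum_congr rfl fun j _ => ?_
    ring
  rw [e, integral_finsetSum _ fun m _ => integrable_finsetSum _ fun j _ => (hint m j).const_mul _]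
  refine Finset.sum_congr rfl fun m _ => ?_
  rw [integral_finsetSum _ fun j _ => (hint m j).const_mul _, hD, Finset.mul_sum]
  refine Finset.sum_congr rfl fun j _ => ?_
  rw [integral_const_mul, conv_F1_D_D (hu j), mul_assoc]

lemma inner_BS (y : S3) :
    ⟪BS v y, v y⟫ = ∫ x, leftIntegrand₁ v (x, y) ∂vol
      - 1 / (4 * Real.pi ^ 2) * ∫ x, leftIntegrand₂ v (x, y) ∂vol
      + 2 * ∫ x, leftIntegrand₃ v (x, y) ∂vol := by
  rw [BS_eq hv, eq_vec_comp hv y, inner_vec, integral_leftIntegrand₁_left hv,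
    integral_leftIntegrand₂_left hv, integral_leftIntegrand₃_left hv]
  simp [Fin.sum_univ_three, magComp]
  ring

lemma integrable_inner_BS : Integrable (fun y => ⟪BS v y, v y⟫) vol := by
  have hB : IsSmooth (BS v) := by
    rw [BS_eq hv]
    exact isSmooth_vec (isSmooth_magComp (isSmooth_comp hv))
  exact integrable_of_continuous (hB.inner (isSmooth_of_contMDiff hv.smooth)).continuous

/-- The left-translation format. -/
lemma helicity_eq_left : helicity v =
    (∫ p, leftIntegrand₁ v p ∂(vol.prod vol))
      - 1 / (4 * Real.pi ^ 2) * (∫ p, leftIntegrand₂ v p ∂(vol.prod vol))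
      + 2 * (∫ p, leftIntegrand₃ v p ∂(vol.prod vol)) := by
  have h1 := integrable_leftIntegrand₁ hv
  have h2 := integrable_leftIntegrand₂ hv
  have h3 := integrable_leftIntegrand₃ hv
  rw [helicity, integral_prod_symm _ h1, integral_prod_symm _ h2, integral_prod_symm _ h3]
  simp only [inner_BS hv]
  have i1 := h1.integral_prod_right
  have i2 := h2.integral_prod_right.const_mul (1 / (4 * Real.pi ^ 2))
  have i3 := h3.integral_prod_right.const_mul 2
  have i12 : Integrable (fun y => (∫ x, leftIntegrand₁ v (x, y) ∂vol)
      - 1 / (4 * Real.pi ^ 2) * ∫ x, leftIntegrand₂ v (x, y) ∂vol) vol := i1.sub i2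
  rw [integral_add i12 i3, integral_sub i1 i2, integral_const_mul, integral_const_mul]

/-! ### Parallel transport -/

/-- Away from coinciding and antipodal points, the parallel transport integrand is the combination
of the left translation integrands. Along the geodesic from `x` to `y`, parallel transport differs
from left translation by a rotation about the direction of the geodesic, by the angle `α`. -/
lemma parIntegrand_eq {x y : S3} (h : ⟪(x : E4), (y : E4)⟫ ∈ Set.Ioo (-1 : ℝ) 1) :
    parIntegrand v (x, y) = leftIntegrand₁ v (x, y)
      - 1 / (4 * Real.pi ^ 2) * leftIntegrand₂ v (x, y) + 2 * leftIntegrand₃ v (x, y) := by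
  have hcross : ∀ (a : E4) (b : Fin 3 → ℝ),
      cross y a (vec y b) = vec y (cp (fun i => ⟪frame i (y : E4), a⟫) b) := by
    intro a b
    have ha : a = ⟪(y : E4), a⟫ • (y : E4) + vec y fun i => ⟪frame i (y : E4), a⟫ := by
      simpa [vec] using frame_expansion (y : E4) a
    conv_lhs => rw [ha]
    rw [cross_add_left, cross_smul_left, cross_anticomm y (y : E4), cross_base, cross_vec]
    simp
  have hpar := gradSnd_eq (F := fun s => A s / (4 * Real.pi ^ 2)) phiPar_geoDist
    ((hasDerivAt_A h).div_const _)
  rw [leftIntegrand₁_eq hv h, leftIntegrand₂_eq hv, leftIntegrand₃_eq hv h, parIntegrand, hpar,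
    eq_vec_comp hv y, hcross, inner_vec]
  have hs := sum_sq_inner_frame (x : E4) y
  simp only [norm_eq_of_mem_sphere, Fin.sum_univ_three, inner_frame_left] at hs
  -- The angle of rotation enters through this equation for `A = (π - α) csc α`.
  have hode := A1_ode h
  have ht : 1 + ⟪(x : E4), (y : E4)⟫ ≠ 0 := by linarith [h.1]
  have hpi := Real.pi_ne_zero
  have hx := eq_vec_comp hv x
  have hb : ⟪(y : E4), v x⟫ = -∑ i, comp v i x * ⟪(x : E4), frame i (y : E4)⟫ := by
    rw [real_inner_comm, hx]
    simp [vec, sum_inner, real_inner_smul_left, inner_frame_left]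
  have hfr : ∀ j, ⟪frame j (y : E4), v x⟫
      = -∑ i, comp v i x * ⟪(x : E4), frame i (frame j (y : E4))⟫ := fun j => by
    rw [real_inner_comm, hx]
    simp [vec, sum_inner, real_inner_smul_left, inner_frame_left]
  have htr : ∀ j, ⟪frame j (y : E4), transport y x (v x)⟫
      = -∑ i, comp v i x * ⟪(x : E4), frame i (frame j (y : E4))⟫
        + (∑ i, comp v i x * ⟪(x : E4), frame i (y : E4)⟫) / (1 + ⟪(x : E4), (y : E4)⟫)
          * ⟪(x : E4), frame j (y : E4)⟫ := fun j => by
    rw [transport, inner_sub_right, real_inner_smul_right, inner_add_right, inner_frame_self, hfr,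
      hb, real_inner_comm (x : E4) (y : E4), real_inner_comm (x : E4) (frame j (y : E4))]
    ring
  simp only [htr, inner_frame_left, Fin.sum_univ_three, cp, frame_frame_self, frame_one_frame_zero,
    frame_zero_frame_one, frame_two_frame_one, frame_one_frame_two, frame_zero_frame_two,
    frame_two_frame_zero, inner_neg_right, F0', Matrix.cons_val_zero, Matrix.cons_val_one,
    Matrix.cons_val]
  generalize comp v 0 x = u0, comp v 1 x = u1, comp v 2 x = u2, comp v 0 y = w0,
    comp v 1 y = w1, comp v 2 y = w2 at *
  generalize A1 ⟪(x : E4), (y : E4)⟫ = a1, A ⟪(x : E4), (y : E4)⟫ = a at *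
  generalize ⟪(x : E4), (y : E4)⟫ = t, ⟪(x : E4), frame 0 (y : E4)⟫ = s0,
    ⟪(x : E4), frame 1 (y : E4)⟫ = s1, ⟪(x : E4), frame 2 (y : E4)⟫ = s2 at *
  field_simp
  linear_combination -8 * (1 + t) * (u0 * w0 + u1 * w1 + u2 * w2) * (a1 * hs + hode)

lemma integrable_parIntegrand : Integrable (parIntegrand v) (vol.prod vol) := by
  refine (((integrable_leftIntegrand₁ hv).sub ((integrable_leftIntegrand₂ hv).const_mul
    (1 / (4 * Real.pi ^ 2)))).add ((integrable_leftIntegrand₃ hv).const_mul 2)).congr ?_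
  filter_upwards [ae_prod_inner_mem_Ioo] with p hp using (parIntegrand_eq hv hp).symm

/-- The parallel transport format. -/
lemma helicity_eq_par : helicity v = ∫ p, parIntegrand v p ∂(vol.prod vol) := by
  have i1 := integrable_leftIntegrand₁ hv
  have i2 := (integrable_leftIntegrand₂ hv).const_mul (1 / (4 * Real.pi ^ 2))
  have i3 := (integrable_leftIntegrand₃ hv).const_mul 2
  have i12 : Integrable (fun p => leftIntegrand₁ v p
      - 1 / (4 * Real.pi ^ 2) * leftIntegrand₂ v p) (vol.prod vol) := i1.sub i2
  rw [helicity_eq_left hv, ← integral_const_mul, ← integral_const_mul, ← integral_sub i1 i2,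
    ← integral_add i12 i3]
  refine integral_congr_ae ?_
  filter_upwards [ae_prod_inner_mem_Ioo] with p hp using (parIntegrand_eq hv hp).symm

end

end S3

namespace H3

open Filter Topology

/-! ### The Minkowski form -/

lemma inner_flip (a b : E4) : ⟪a, flip b⟫ = dot a b := by
  simp [PiLp.inner_apply, Fin.sum_univ_four, flip, dot, mink]
  ring

lemma flip_flip (a : E4) : flip (flip a) = a := by
  ext k; fin_cases k <;> simp [flip]

lemma flip_smul (r : ℝ) (a : E4) : flip (r • a) = r • flip a := by
  ext k; fin_cases k <;> simp [flip]

lemma continuous_flip : Continuous flip := by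
  unfold flip; fun_prop

lemma mink_smul_right (r : ℝ) (a b : E4) : mink a (r • b) = r * mink a b := by
  simp [mink]; ring

lemma _root_.Continuous.mink {X : Type*} [TopologicalSpace X] {f g : X → E4} (hf : Continuous f)
    (hg : Continuous g) : Continuous fun x => mink (f x) (g x) := by
  simp only [_root_.mink]; fun_prop

lemma hasFDerivAt_coord (k : Fin 4) (y : E4) :
    HasFDerivAt (fun z : E4 => z k) (EuclideanSpace.proj k : E4 →L[ℝ] ℝ) y :=
  (EuclideanSpace.proj k : E4 →L[ℝ] ℝ).hasFDerivAt

lemma one_le_mink (x y : H3) : 1 ≤ mink x y := by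
  obtain ⟨hx, hx0⟩ := x.2
  obtain ⟨hy, hy0⟩ := y.2
  generalize (x : E4) = x, (y : E4) = y at *
  rw [mink] at hx hy ⊢
  have hxy := mul_pos hx0 hy0
  by_contra! h
  -- Cauchy–Schwarz for the last three coordinates
  have h1 : (x 1 * y 1 + x 2 * y 2 + x 3 * y 3) ^ 2
      ≤ (x 1 * x 1 + x 2 * x 2 + x 3 * x 3) * (y 1 * y 1 + y 2 * y 2 + y 3 * y 3) := by
    nlinarith [sq_nonneg (x 1 * y 2 - x 2 * y 1), sq_nonneg (x 1 * y 3 - x 3 * y 1),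
      sq_nonneg (x 2 * y 3 - x 3 * y 2)]
  have h2 : (x 0 * y 0) ^ 2 = (1 + (x 1 * x 1 + x 2 * x 2 + x 3 * x 3))
      * (1 + (y 1 * y 1 + y 2 * y 2 + y 3 * y 3)) := by
    rw [mul_pow, ← sub_eq_zero]; linear_combination (y 0 ^ 2) * hx
      + (1 + (x 1 * x 1 + x 2 * x 2 + x 3 * x 3)) * hy
  nlinarith [sq_nonneg (x 1 - y 1), sq_nonneg (x 2 - y 2), sq_nonneg (x 3 - y 3)]

/-- On bounded sets, `cosh α - 1` dominates the square of the Euclidean distance. -/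
lemma norm_sub_sq_le (x y : H3) :
    ‖(x : E4) - y‖ ^ 2 ≤ ((x : E4) 0 + (y : E4) 0) ^ 2 * (mink x y - 1) := by
  have ht := one_le_mink x y
  obtain ⟨hx, hx0⟩ := x.2
  obtain ⟨hy, hy0⟩ := y.2
  generalize (x : E4) = x, (y : E4) = y at *
  rw [EuclideanSpace.real_norm_sq_eq]
  simp only [mink, Fin.sum_univ_four, PiLp.sub_apply] at hx hy ht ⊢
  set d := (x 1 - y 1) ^ 2 + (x 2 - y 2) ^ 2 + (x 3 - y 3) ^ 2 with hd
  set t := x 0 * y 0 - x 1 * y 1 - x 2 * y 2 - x 3 * y 3 with hdt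
  have hde : 2 * (t - 1) = d - (x 0 - y 0) ^ 2 := by
    rw [hd, hdt]; linear_combination hx + hy
  have hP : (x 1 + y 1) ^ 2 + (x 2 + y 2) ^ 2 + (x 3 + y 3) ^ 2
      = (x 0 + y 0) ^ 2 - 2 * (1 + t) := by
    rw [hdt]; linear_combination -hx - hy
  have he : (x 0 - y 0) * (x 0 + y 0)
      = (x 1 - y 1) * (x 1 + y 1) + (x 2 - y 2) * (x 2 + y 2) + (x 3 - y 3) * (x 3 + y 3) := by
    linear_combination hx - hy
  have hcs : ((x 0 - y 0) * (x 0 + y 0)) ^ 2 ≤ d * ((x 0 + y 0) ^ 2 - 2 * (1 + t)) := by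
    rw [he, ← hP, hd]
    nlinarith [sq_nonneg ((x 1 - y 1) * (x 2 + y 2) - (x 2 - y 2) * (x 1 + y 1)),
      sq_nonneg ((x 1 - y 1) * (x 3 + y 3) - (x 3 - y 3) * (x 1 + y 1)),
      sq_nonneg ((x 2 - y 2) * (x 3 + y 3) - (x 3 - y 3) * (x 2 + y 2))]
  have hd0 : 0 ≤ d := by positivity
  rw [mul_pow] at hcs
  nlinarith [mul_nonneg hd0 (sub_nonneg.2 ht)]

lemma one_lt_mink {x y : H3} (h : x ≠ y) : 1 < mink x y := by
  refine (one_le_mink x y).lt_of_ne fun h1 => h (Subtype.ext (sub_eq_zero.1 ?_))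
  have h2 := norm_sub_sq_le x y
  rw [← h1, sub_self, mul_zero] at h2
  exact norm_eq_zero.1 (pow_eq_zero_iff two_ne_zero |>.1 (le_antisymm h2 (sq_nonneg _)))

/-! ### Gradients of functions of the distance -/

/-- The gradient of `z ↦ ⟨x, z⟩` at `y` is the tangential part of `-x`, as `dot` is the negative of
the Minkowski form. -/
lemma gradSnd_eq {φ F : ℝ → ℝ} {F' : ℝ} {x y : H3} (hφ : ∀ t, 1 ≤ t → φ (Real.arcosh t) = F t)
    (hF : HasDerivAt F F' (mink x y)) :
    gradSnd φ x y = -F' • ((x : E4) - mink x y • (y : E4)) := by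
  have hyy : mink (y : E4) y = 1 := y.2.1
  have hev : (fun z : E4 => φ (geoDist x (proj z))) =ᶠ[𝓝 (y : E4)]
      fun z => F (mink x z * (√(mink z z))⁻¹) := by
    have hc : Continuous fun z : E4 => mink z z := continuous_id.mink continuous_id
    have hc0 : Continuous fun z : E4 => z 0 := by fun_prop
    filter_upwards [hc.continuousAt.eventually_const_lt (u := 0) (by simp [hyy]),
      hc0.continuousAt.eventually_const_lt (u := 0) y.2.2] with z h1 h2
    rw [geoDist, hφ _ (one_le_mink _ _), proj, dif_pos ⟨h1, h2⟩, mink_smul_right,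
      mul_comm]
  have hp := fun k => hasFDerivAt_coord k (y : E4)
  have hxz : HasFDerivAt (fun z : E4 => mink x z) _ (y : E4) :=
    ((((hp 0).const_mul _).sub ((hp 1).const_mul _)).sub ((hp 2).const_mul _)).sub
      ((hp 3).const_mul _)
  have hzz : HasFDerivAt (fun z : E4 => mink z z) _ (y : E4) :=
    ((((hp 0).mul (hp 0)).sub ((hp 1).mul (hp 1))).sub ((hp 2).mul (hp 2))).sub
      ((hp 3).mul (hp 3))
  have hq := hxz.mul ((hasDerivAt_inv (by simp [hyy])).comp_hasFDerivAt (y : E4)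
    (hzz.sqrt (by simp [hyy])))
  have hF' : HasDerivAt F F' (mink x y * (√(mink (y : E4) y))⁻¹) := by simpa [hyy] using hF
  have hd := (hF'.comp_hasFDerivAt (y : E4) hq).congr_of_eventuallyEq hev
  have hg : gradient (fun z : E4 => φ (geoDist x (proj z))) (y : E4)
      = -F' • flip ((x : E4) - mink x y • (y : E4)) := by
    refine ext_inner_right ℝ fun w => ?_
    rw [gradient, InnerProductSpace.toDual_symm_apply, hd.fderiv, real_inner_smul_left,
      real_inner_comm, inner_flip, dot]
    simp only [hyy, Function.comp_apply, Real.sqrt_one]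
    simp [mink]
    ring
  rw [gradSnd, grad, hg, flip_smul, flip_flip]

/-- The derivative of `(t ^ 2 - 1) ^ (-1/2) / (4 π)` is the negative of this function. -/
noncomputable def K (t : ℝ) : ℝ := t / ((t ^ 2 - 1) * √(t ^ 2 - 1)) / (4 * Real.pi)

lemma hasDerivAt_inv_sqrt {t : ℝ} (ht : 1 < t) :
    HasDerivAt (fun t => (√(t ^ 2 - 1))⁻¹ / (4 * Real.pi)) (-K t) t := by
  have h : 0 < t ^ 2 - 1 := by nlinarith
  have hs := Real.sqrt_pos.2 h
  have h1 : HasDerivAt (fun t : ℝ => t ^ 2 - 1) (2 * t) t := by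
    simpa using (hasDerivAt_pow 2 t).sub_const 1
  refine (((h1.sqrt h.ne').fun_inv hs.ne').div_const _).congr_deriv ?_
  rw [K, Real.sq_sqrt h.le]
  field_simp

lemma gradSnd_phiPar {x y : H3} (h : x ≠ y) :
    gradSnd phiPar x y = K (mink x y) • ((x : E4) - mink x y • (y : E4)) := by
  rw [gradSnd_eq (fun t ht => by rw [phiPar, Real.sinh_arcosh ht])
    (hasDerivAt_inv_sqrt (one_lt_mink h)), neg_neg]

lemma gradSnd_neg_phiPar {x y : H3} (h : x ≠ y) : gradSnd (fun α => -phiPar α) x y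
    = -K (mink x y) • ((x : E4) - mink x y • (y : E4)) := by
  rw [gradSnd_eq (F := fun t => -((√(t ^ 2 - 1))⁻¹ / (4 * Real.pi)))
    (fun t ht => by rw [phiPar, Real.sinh_arcosh ht]) (hasDerivAt_inv_sqrt (one_lt_mink h)).neg,
    neg_neg]


/-! ### The integrands -/

/-- A cross product at `y` ignores the component of its arguments along `y`. -/
lemma cross_smul_sub_smul (y : H3) (a x : E4) (r s : ℝ) :
    cross y a (r • (x - s • (y : E4))) = r • cross y a (x - (y : E4)) := by
  rw [cross, cross, ← flip_smul]
  congr 1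
  ext k
  simp only [det4_eq, PiLp.smul_apply, PiLp.sub_apply, smul_eq_mul]
  ring

lemma dot_cross (y : H3) (a b c : E4) : dot (cross y a b) c = det4 y a b c := by
  simp [dot, cross, flip, mink, det4_eq, stdVec]
  ring

lemma BSIntegrand_eq (v : H3 → E4) {x y : H3} (h : x ≠ y) : BSIntegrand v y x
    = -K (mink x y) • cross y (transport y x (v x)) ((x : E4) - y) := by
  rw [BSIntegrand, gradSnd_neg_phiPar h, cross_smul_sub_smul]

lemma parIntegrand_eq (v : H3 → E4) {x y : H3} (h : x ≠ y) :
    parIntegrand v (x, y) = dot (BSIntegrand v y x) (v y) := by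
  rw [parIntegrand, BSIntegrand, gradSnd_neg_phiPar h, gradSnd_phiPar h, dot_cross, dot_cross]
  simp only [det4_eq, PiLp.smul_apply, PiLp.sub_apply, smul_eq_mul]
  ring

end H3

namespace H3

open Filter Topology

/-! ### The hyperbolic volume -/

/-- The inverse of the chart `ofE3`. -/
def toE3 (x : H3) : E3 := !₂[(x : E4) 1, (x : E4) 2, (x : E4) 3]

lemma toE3_ofE3 (u : E3) : toE3 (ofE3 u) = u := by
  ext k; fin_cases k <;> simp [toE3, ofE3]

lemma norm_toE3_sq (x : H3) : ‖toE3 x‖ ^ 2 = (x : E4) 0 ^ 2 - 1 := by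
  have h := x.2.1
  rw [mink] at h
  rw [EuclideanSpace.real_norm_sq_eq]
  simp only [Fin.sum_univ_three, toE3]
  simp
  linear_combination -h

lemma ofE3_toE3 (x : H3) : ofE3 (toE3 x) = x := by
  refine Subtype.ext ?_
  ext k
  fin_cases k
  · simp [ofE3, norm_toE3_sq, Real.sqrt_sq x.2.2.le]
  all_goals simp [ofE3, toE3]

lemma continuous_toE3 : Continuous toE3 := by
  unfold toE3; fun_prop

lemma continuous_ofE3 : Continuous ofE3 := by
  refine Continuous.subtype_mk ?_ _
  fun_prop

/-- The chart is the projection along the `0`-th axis, which is a contraction. -/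
lemma norm_sub_le_chart (u w : E3) : ‖u - w‖ ≤ ‖(ofE3 u : E4) - ofE3 w‖ := by
  refine abs_le_of_sq_le_sq' ?_ (norm_nonneg _) |>.2
  rw [EuclideanSpace.real_norm_sq_eq, EuclideanSpace.real_norm_sq_eq]
  simp only [Fin.sum_univ_three, Fin.sum_univ_four, PiLp.sub_apply, ofE3]
  simp
  nlinarith [sq_nonneg (√(1 + ‖u‖ ^ 2) - √(1 + ‖w‖ ^ 2))]

/-- The density of the volume in the chart is at most one. -/
lemma lintegral_vol_le {f : H3 → ENNReal} (hf : Measurable f) :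
    ∫⁻ x, f x ∂vol ≤ ∫⁻ u, f (ofE3 u) := by
  rw [vol, lintegral_map hf continuous_ofE3.measurable]
  refine lintegral_mono' ?_ le_rfl
  conv_rhs => rw [← withDensity_one (μ := (volume : Measure E3))]
  refine withDensity_mono (.of_forall fun u => ENNReal.ofReal_le_one.2 (inv_le_one_of_one_le₀ ?_))
  exact Real.one_le_sqrt.2 (by nlinarith [sq_nonneg ‖u‖])

instance : SFinite vol := by unfold vol; infer_instance

instance : NullSingletonClass vol where
  measure_singleton y := by
    rw [vol, Measure.map_apply continuous_ofE3.measurable (measurableSet_singleton y)]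
    refine withDensity_absolutelyContinuous _ _ (Set.Subsingleton.measure_zero ?_ _)
    intro u hu w hw
    rw [← toE3_ofE3 u, ← toE3_ofE3 w, (hu : ofE3 u = y), (hw : ofE3 w = y)]

lemma ae_ne (y : H3) : ∀ᵐ x ∂vol, x ≠ y := by
  simp [ae_iff]

lemma ae_prod_ne : ∀ᵐ p : H3 × H3 ∂(vol.prod vol), p.1 ≠ p.2 := by
  have hm : MeasurableSet {p : H3 × H3 | p.1 ≠ p.2} :=
    (isClosed_eq continuous_fst continuous_snd).measurableSet.compl
  rw [ae_iff]
  refine (Measure.measure_prod_null hm.compl).2 (.of_forall fun x => ?_)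
  refine measure_mono_null (t := {x}) (fun y hy => ?_) (measure_singleton x)
  simpa [eq_comm] using hy

/-! ### Integrability of the singularity -/

/-- A bounded region of hyperbolic space. -/
def bdd (R : ℝ) : Set H3 := {x | ‖(x : E4)‖ ≤ R}

lemma measurableSet_bdd (R : ℝ) : MeasurableSet (bdd R) :=
  (isClosed_le (by fun_prop) continuous_const).measurableSet

lemma exists_subset_bdd {S : Set H3} (hS : IsCompact S) : ∃ R, 0 < R ∧ S ⊆ bdd R := by
  obtain ⟨R, hR⟩ := hS.exists_bound_of_continuousOn (f := fun x : H3 => (x : E4))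
    continuous_subtype_val.continuousOn
  exact ⟨max R 1, by simp, fun x hx => (hR x hx).trans (le_max_left _ _)⟩

lemma coord_zero_le {R : ℝ} {x : H3} (hx : x ∈ bdd R) : (x : E4) 0 ≤ R :=
  ((le_abs_self _).trans (PiLp.norm_apply_le (x : E4) 0)).trans hx

lemma norm_le_of_ofE3_mem {R : ℝ} {u : E3} (hu : ofE3 u ∈ bdd R) : ‖u‖ ≤ R := by
  refine le_trans ?_ (coord_zero_le hu)
  simp only [ofE3]
  simpa using Real.le_sqrt_of_sq_le (y := 1 + ‖u‖ ^ 2) (x := ‖u‖) (by linarith)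

lemma vol_bdd_lt_top (R : ℝ) : vol (bdd R) < ⊤ := by
  rw [← lintegral_indicator_one (measurableSet_bdd R)]
  refine (lintegral_vol_le (measurable_one.indicator (measurableSet_bdd R))).trans_lt ?_
  calc _ ≤ ∫⁻ u : E3, (Metric.closedBall 0 R).indicator 1 u := by
        refine lintegral_mono fun u => ?_
        by_cases hu : ofE3 u ∈ bdd R
        · have : u ∈ Metric.closedBall (0 : E3) R := by simpa using norm_le_of_ofE3_mem hu
          simp [hu, this]
        · simp [hu]
    _ < ⊤ := by
        rw [lintegral_indicator_one measurableSet_closedBall]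
        exact measure_closedBall_lt_top

lemma integrableOn_norm_sq_inv (r : ℝ) :
    IntegrableOn (fun z : E3 => (‖z‖ ^ 2)⁻¹) (Metric.ball 0 r) := by
  rw [integrableOn_fun_norm_addHaar volume (f := fun s => (s ^ 2)⁻¹)]
  have h : IntegrableOn (fun _ : ℝ => (1 : ℝ)) (Set.Ioo 0 r) := by simp
  refine h.congr_fun (fun s hs => ?_) measurableSet_Ioo
  have := hs.1.ne'
  simp [this]

lemma measurable_sub_inv : Measurable fun p : H3 × H3 => (mink p.1 p.2 - 1)⁻¹ := by
  have h : Continuous fun p : H3 × H3 => mink p.1 p.2 - 1 :=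
    ((continuous_subtype_val.comp continuous_fst).mink
      (continuous_subtype_val.comp continuous_snd)).sub continuous_const
  exact h.measurable.inv

lemma sub_inv_nonneg (x y : H3) : 0 ≤ (mink x y - 1)⁻¹ :=
  inv_nonneg.2 (sub_nonneg.2 (one_le_mink x y))

lemma sub_inv_le {R : ℝ} {u w : E3} (hu : ofE3 u ∈ bdd R) (hw : ofE3 w ∈ bdd R) (h : u ≠ w) :
    (mink (ofE3 u) (ofE3 w) - 1)⁻¹ ≤ (2 * R) ^ 2 * (‖u - w‖ ^ 2)⁻¹ := by
  have hne : ofE3 u ≠ ofE3 w := fun e => h (by rw [← toE3_ofE3 u, e, toE3_ofE3])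
  have h1 := one_lt_mink hne
  have h2 := norm_sub_sq_le (ofE3 u) (ofE3 w)
  have h3 : ‖u - w‖ ^ 2 ≤ ‖(ofE3 u : E4) - ofE3 w‖ ^ 2 := by
    gcongr; exact norm_sub_le_chart u w
  have h4 : ((ofE3 u : E4) 0 + (ofE3 w : E4) 0) ^ 2 ≤ (2 * R) ^ 2 := by
    have := (ofE3 u).2.2
    have := (ofE3 w).2.2
    gcongr
    linarith [coord_zero_le hu, coord_zero_le hw]
  have h5 : 0 < ‖u - w‖ := norm_pos_iff.2 (sub_ne_zero.2 h)
  have h6 : 0 < mink (ofE3 u) (ofE3 w) - 1 := by linarith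
  rw [← div_eq_mul_inv, inv_eq_one_div, div_le_div_iff₀ h6 (by positivity), one_mul]
  exact (h3.trans h2).trans (by gcongr)

/-- The singularity `|u - w|⁻²` is locally integrable on `ℝ³`, uniformly in `w`. -/
lemma exists_lintegral_le (R : ℝ) : ∃ C < (⊤ : ENNReal), ∀ y ∈ bdd R,
    ∫⁻ x in bdd R, ENNReal.ofReal (mink x y - 1)⁻¹ ∂vol ≤ C := by
  have hi := (integrableOn_norm_sq_inv (2 * R + 1)).const_mul ((2 * R) ^ 2)
  refine ⟨∫⁻ z : E3 in Metric.ball 0 (2 * R + 1), ENNReal.ofReal ((2 * R) ^ 2 * (‖z‖ ^ 2)⁻¹),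
    ?_, fun y hy => ?_⟩
  · have h := hi.2
    rwa [hasFiniteIntegral_iff_ofReal (.of_forall fun z => by positivity)] at h
  · have hm : Measurable fun x : H3 => ENNReal.ofReal (mink x y - 1)⁻¹ :=
      (measurable_sub_inv.comp (measurable_id.prodMk measurable_const)).ennreal_ofReal
    rw [← lintegral_indicator (measurableSet_bdd R)]
    refine (lintegral_vol_le (hm.indicator (measurableSet_bdd R))).trans ?_
    rw [← lintegral_indicator measurableSet_ball,
      ← lintegral_sub_right_eq_self (μ := (volume : Measure E3))
        ((Metric.ball (0 : E3) (2 * R + 1)).indicator _) (toE3 y)]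
    refine lintegral_mono_ae ?_
    have hne : ∀ᵐ u : E3, u ≠ toE3 y := by simp [ae_iff]
    filter_upwards [hne] with u hu
    by_cases h : ofE3 u ∈ bdd R
    · have h1 := norm_le_of_ofE3_mem h
      have hy' : ofE3 (toE3 y) ∈ bdd R := by rwa [ofE3_toE3]
      have h2 := norm_le_of_ofE3_mem hy'
      have h3 : u - toE3 y ∈ Metric.ball (0 : E3) (2 * R + 1) := by
        rw [mem_ball_zero_iff]
        linarith [norm_sub_le u (toE3 y)]
      rw [Set.indicator_of_mem h, Set.indicator_of_mem h3]
      refine ENNReal.ofReal_le_ofReal ?_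
      simpa [ofE3_toE3] using sub_inv_le h hy' hu
    · simp [Set.indicator_of_notMem h]

lemma integrableOn_sub_inv {R : ℝ} {y : H3} (hy : y ∈ bdd R) :
    IntegrableOn (fun x : H3 => (mink x y - 1)⁻¹) (bdd R) vol := by
  obtain ⟨C, hC, h⟩ := exists_lintegral_le R
  refine ⟨(measurable_sub_inv.comp
    (measurable_id.prodMk measurable_const)).aestronglyMeasurable, ?_⟩
  rw [hasFiniteIntegral_iff_ofReal (.of_forall fun x => sub_inv_nonneg x y)]
  exact (h y hy).trans_lt hC

lemma integrableOn_prod_sub_inv (R : ℝ) :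
    IntegrableOn (fun p : H3 × H3 => (mink p.1 p.2 - 1)⁻¹) (bdd R ×ˢ bdd R) (vol.prod vol) := by
  obtain ⟨C, hC, h⟩ := exists_lintegral_le R
  refine ⟨measurable_sub_inv.aestronglyMeasurable, ?_⟩
  rw [hasFiniteIntegral_iff_ofReal (.of_forall fun p : H3 × H3 => sub_inv_nonneg p.1 p.2),
    ← Measure.prod_restrict, lintegral_prod_symm' _ measurable_sub_inv.ennreal_ofReal]
  calc _ ≤ ∫⁻ _ in bdd R, C ∂vol :=
        setLIntegral_mono measurable_const fun y hy => h y hy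
    _ < ⊤ := by
        rw [setLIntegral_const]
        exact ENNReal.mul_lt_top hC (vol_bdd_lt_top R)

/-! ### Absolute convergence and Fubini -/

/-- The gradient of the kernel is of the order of `α⁻²`, that is, of `(cosh α - 1)⁻¹`. -/
lemma K_mul_norm_le (x y : H3) :
    |K (mink x y)| * ‖(x : E4) - y‖ ≤ ((x : E4) 0 + (y : E4) 0) * (mink x y - 1)⁻¹ := by
  have hx := x.2.2
  have hy := y.2.2
  rcases eq_or_ne x y with rfl | h
  · have := sub_inv_nonneg x x
    simp only [sub_self, norm_zero, mul_zero]
    positivity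
  have ht := one_lt_mink h
  have hn := norm_sub_sq_le x y
  set t := mink x y
  set P := (x : E4) 0 + (y : E4) 0
  have hP : 0 < P := add_pos hx hy
  have h1 : 0 < t - 1 := by linarith
  have h2 : 0 < t ^ 2 - 1 := by nlinarith
  have h3 : ‖(x : E4) - y‖ ≤ P * √(t ^ 2 - 1) := by
    refine abs_le_of_sq_le_sq' ?_ (by positivity) |>.2
    rw [mul_pow, Real.sq_sqrt h2.le]
    exact hn.trans (by gcongr; nlinarith)
  have hs := Real.sqrt_pos.2 h2
  have hK : 0 ≤ K t := by rw [K]; positivity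
  have hpi : 1 ≤ 4 * Real.pi := by linarith [Real.pi_gt_three]
  rw [abs_of_nonneg hK]
  calc K t * ‖(x : E4) - y‖ ≤ K t * (P * √(t ^ 2 - 1)) := by gcongr
    _ = P * (t / (t + 1) * (t - 1)⁻¹) / (4 * Real.pi) := by
        have : t ^ 2 - 1 = (t + 1) * (t - 1) := by ring
        have h5 : t + 1 ≠ 0 := by linarith
        rw [K]
        have h6 := h1.ne'
        have h7 := hs.ne'
        generalize √(t ^ 2 - 1) = s at *
        rw [this]
        field_simp
    _ ≤ P * (t / (t + 1) * (t - 1)⁻¹) := div_le_self (by positivity) hpi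
    _ ≤ P * (1 * (t - 1)⁻¹) := by
        gcongr
        exact (div_le_one (by linarith)).2 (by linarith)
    _ = _ := by rw [one_mul]

section
variable {v : H3 → E4} (hv : IsSmoothField v)
include hv

lemma continuous_field : Continuous v := by
  have h : v = (fun u => v (ofE3 u)) ∘ toE3 := by ext1 x; simp [ofE3_toE3]
  rw [h]
  exact hv.smooth.continuous.comp continuous_toE3

lemma continuous_cross_transport : Continuous fun q : H3 × H3 × E4 =>
    cross q.2.1 (transport q.2.1 q.1 (v q.1)) q.2.2 := by
  have hc := continuous_field hv
  have ht : Continuous fun q : H3 × H3 × E4 => transport q.2.1 q.1 (v q.1) := by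
    have h0 : ∀ q : H3 × H3 × E4, 1 + mink q.2.1 q.1 ≠ 0 := fun q => by
      linarith [one_le_mink q.2.1 q.1]
    have h1 : Continuous fun q : H3 × H3 × E4 => mink q.2.1 q.1 :=
      Continuous.mink (by fun_prop) (by fun_prop)
    have h2 : Continuous fun q : H3 × H3 × E4 => mink q.2.1 (v q.1) :=
      Continuous.mink (by fun_prop) (by fun_prop)
    unfold transport
    exact Continuous.sub (by fun_prop)
      ((h2.div (continuous_const.add h1) h0).smul (by fun_prop))
  unfold cross
  refine continuous_flip.comp ?_
  simp only [det4_eq]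
  fun_prop

lemma aestronglyMeasurable_BSIntegrand :
    AEStronglyMeasurable (fun p : H3 × H3 => BSIntegrand v p.2 p.1) (vol.prod vol) := by
  have hm : Measurable fun p : H3 × H3 =>
      -K (mink p.1 p.2) • cross p.2 (transport p.2 p.1 (v p.1)) ((p.1 : E4) - p.2) := by
    have h1 : Continuous fun p : H3 × H3 => mink p.1 p.2 :=
      Continuous.mink (by fun_prop) (by fun_prop)
    have hK : Measurable K := by unfold K; fun_prop
    have h2 : Continuous fun p : H3 × H3 =>
        cross p.2 (transport p.2 p.1 (v p.1)) ((p.1 : E4) - p.2) :=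
      (continuous_cross_transport hv).comp (g := _)
        (f := fun p : H3 × H3 => (p.1, p.2, (p.1 : E4) - p.2)) (by fun_prop)
    exact (hK.comp h1.measurable).neg.smul h2.measurable
  refine hm.aestronglyMeasurable.congr ?_
  filter_upwards [ae_prod_ne] with p hp using (BSIntegrand_eq v hp).symm

lemma aestronglyMeasurable_BSIntegrand_left (y : H3) :
    AEStronglyMeasurable (BSIntegrand v y) vol := by
  have hm : Measurable fun x : H3 =>
      -K (mink x y) • cross y (transport y x (v x)) ((x : E4) - y) := by
    have h1 : Continuous fun x : H3 => mink x y :=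
      Continuous.mink (by fun_prop) (by fun_prop)
    have hK : Measurable K := by unfold K; fun_prop
    have h2 : Continuous fun x : H3 => cross y (transport y x (v x)) ((x : E4) - y) :=
      (continuous_cross_transport hv).comp (g := _)
        (f := fun x : H3 => (x, y, (x : E4) - y)) (by fun_prop)
    exact (hK.comp h1.measurable).neg.smul h2.measurable
  refine hm.aestronglyMeasurable.congr ?_
  filter_upwards [ae_ne y] with x hx using (BSIntegrand_eq v hx).symm

lemma exists_norm_BSIntegrand_le {S L : Set H3} (hS : IsCompact S) (hL : IsCompact L) :
    ∃ C, ∀ x ∈ S, ∀ y ∈ L, x ≠ y → ‖BSIntegrand v y x‖ ≤ C * (mink x y - 1)⁻¹ := by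
  obtain ⟨M, hM⟩ := (hS.prod (hL.prod (isCompact_sphere (0 : E4) 1))).exists_bound_of_continuousOn
    (continuous_cross_transport hv).continuousOn
  obtain ⟨R, hR0, hR⟩ := exists_subset_bdd (hS.union hL)
  refine ⟨2 * R * max M 0, fun x hx y hy h => ?_⟩
  have hn : 0 < ‖(x : E4) - y‖ :=
    norm_pos_iff.2 (sub_ne_zero.2 fun e => h (Subtype.ext e))
  -- By homogeneity, it suffices to bound the cross product with unit vectors, by compactness.
  have h1 := hM (x, y, ‖(x : E4) - y‖⁻¹ • ((x : E4) - y))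
    ⟨hx, hy, by simp [norm_smul, hn.ne']⟩
  have e := cross_smul_sub_smul y (transport y x (v x)) x ‖(x : E4) - y‖⁻¹ 1
  rw [one_smul] at e
  simp only [e, norm_smul, norm_inv, norm_norm] at h1
  rw [inv_mul_le_iff₀ hn] at h1
  rw [BSIntegrand_eq v h, norm_smul, norm_neg, Real.norm_eq_abs]
  have hi := sub_inv_nonneg x y
  calc _ ≤ |K (mink x y)| * (‖(x : E4) - y‖ * max M 0) := by
        gcongr; exact h1.trans (by gcongr; exact le_max_left _ _)
    _ = |K (mink x y)| * ‖(x : E4) - y‖ * max M 0 := by ring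
    _ ≤ (2 * R) * (mink x y - 1)⁻¹ * max M 0 := by
        refine mul_le_mul_of_nonneg_right ((K_mul_norm_le x y).trans ?_) (le_max_right _ _)
        gcongr
        linarith [coord_zero_le (hR (.inl hx)), coord_zero_le (hR (.inr hy))]
    _ = _ := by ring

omit hv in
lemma BSIntegrand_eq_zero {x y : H3} (h : x ≠ y) (hx : v x = 0) : BSIntegrand v y x = 0 := by
  rw [BSIntegrand_eq v h, hx]
  have : cross y (transport y x 0) ((x : E4) - y) = 0 := by
    ext k
    have : mink y 0 = 0 := by simp [mink]
    fin_cases k <;> simp [cross, flip, det4_eq, transport, this]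
  rw [this, smul_zero]

variable (hc : HasCompactSupport v)
include hc

lemma integrable_BSIntegrand (y : H3) : Integrable (BSIntegrand v y) vol := by
  obtain ⟨C, hC⟩ := exists_norm_BSIntegrand_le hv hc (isCompact_singleton (x := y))
  obtain ⟨R, hR0, hR⟩ := exists_subset_bdd (hc.isCompact.union (isCompact_singleton (x := y)))
  have hi := (integrable_indicator_iff (measurableSet_bdd R)).2
    ((integrableOn_sub_inv (hR (.inr rfl))).const_mul C)
  refine (hi.norm).mono' (aestronglyMeasurable_BSIntegrand_left hv y) ?_
  filter_upwards [ae_ne y] with x hx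
  by_cases h : x ∈ tsupport v
  · rw [Set.indicator_of_mem (hR (.inl h))]
    exact (hC x h y rfl hx).trans (le_abs_self _)
  · rw [BSIntegrand_eq_zero hx (image_eq_zero_of_notMem_tsupport h), norm_zero]
    positivity

lemma integrable_parIntegrand : Integrable (parIntegrand v) (vol.prod vol) := by
  obtain ⟨C, hC⟩ := exists_norm_BSIntegrand_le hv hc hc
  obtain ⟨R, hR0, hR⟩ := exists_subset_bdd hc.isCompact
  have hvc := continuous_field hv
  obtain ⟨M, hM⟩ := hc.exists_bound_of_continuousOn (continuous_flip.comp hvc).continuousOn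
  have hi := (integrable_indicator_iff ((measurableSet_bdd R).prod (measurableSet_bdd R))).2
    (((integrableOn_prod_sub_inv R).const_mul C).mul_const M)
  have hm : AEStronglyMeasurable (parIntegrand v) (vol.prod vol) := by
    refine ((aestronglyMeasurable_BSIntegrand hv).inner (𝕜 := ℝ)
      ((continuous_flip.comp hvc).comp continuous_snd).aestronglyMeasurable).congr ?_
    filter_upwards [ae_prod_ne] with p hp
    rw [parIntegrand_eq v hp]
    exact inner_flip _ _
  refine hi.norm.mono' hm ?_
  filter_upwards [ae_prod_ne] with p hp
  have e : parIntegrand v p = ⟪BSIntegrand v p.2 p.1, flip (v p.2)⟫ := by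
    rw [inner_flip]; exact parIntegrand_eq v hp
  rw [e]
  by_cases h : p.1 ∈ tsupport v ∧ p.2 ∈ tsupport v
  · rw [Set.indicator_of_mem (show p ∈ bdd R ×ˢ bdd R from ⟨hR h.1, hR h.2⟩)]
    refine (norm_inner_le_norm _ _).trans (le_trans ?_ (le_abs_self _))
    have h1 := hC p.1 h.1 p.2 h.2 hp
    exact mul_le_mul h1 (hM _ h.2) (norm_nonneg _) ((norm_nonneg _).trans h1)
  · rw [not_and_or] at h
    have : ⟪BSIntegrand v p.2 p.1, flip (v p.2)⟫ = 0 := by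
      rcases h with h | h
      · rw [BSIntegrand_eq_zero hp (image_eq_zero_of_notMem_tsupport h), inner_zero_left]
      · rw [inner_flip, image_eq_zero_of_notMem_tsupport h]; simp [dot, mink]
    rw [this, norm_zero]
    positivity

lemma dot_BS (y : H3) : dot (BS v y) (v y) = ∫ x, parIntegrand v (x, y) ∂vol := by
  rw [BS, ← inner_flip, real_inner_comm, ← integral_inner (integrable_BSIntegrand hv hc y)]
  refine integral_congr_ae ?_
  filter_upwards [ae_ne y] with x hx
  rw [parIntegrand_eq v hx, real_inner_comm, inner_flip]

lemma integrable_dot_BS : Integrable (fun y => dot (BS v y) (v y)) vol := by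
  simp only [dot_BS hv hc]
  exact (integrable_parIntegrand hv hc).integral_prod_right

lemma helicity_eq_par : helicity v = ∫ p, parIntegrand v p ∂(vol.prod vol) := by
  rw [helicity, integral_prod_symm _ (integrable_parIntegrand hv hc)]
  simp only [dot_BS hv hc]

end

end H3

theorem theorem8p3 :
    (∀ v : S3 → E4, S3.IsSmoothField v →
      (∃! B : S3 → E4, S3.IsMagneticField v B) ∧
      Integrable (fun y => inner ℝ (S3.BS v y) (v y)) S3.vol ∧
      (Integrable (S3.leftIntegrand₁ v) (S3.vol.prod S3.vol) ∧
        Integrable (S3.leftIntegrand₂ v) (S3.vol.prod S3.vol) ∧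
        Integrable (S3.leftIntegrand₃ v) (S3.vol.prod S3.vol) ∧
        S3.helicity v =
          (∫ p, S3.leftIntegrand₁ v p ∂(S3.vol.prod S3.vol))
          - 1 / (4 * Real.pi ^ 2) * (∫ p, S3.leftIntegrand₂ v p ∂(S3.vol.prod S3.vol))
          + 2 * (∫ p, S3.leftIntegrand₃ v p ∂(S3.vol.prod S3.vol))) ∧
      (Integrable (S3.parIntegrand v) (S3.vol.prod S3.vol) ∧
        S3.helicity v = ∫ p, S3.parIntegrand v p ∂(S3.vol.prod S3.vol))) ∧
    (∀ v : H3 → E4, H3.IsSmoothField v → HasCompactSupport v →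
      (∀ y, Integrable (H3.BSIntegrand v y) H3.vol) ∧
      Integrable (fun y => H3.dot (H3.BS v y) (v y)) H3.vol ∧
      Integrable (H3.parIntegrand v) (H3.vol.prod H3.vol) ∧
      H3.helicity v = ∫ p, H3.parIntegrand v p ∂(H3.vol.prod H3.vol)) := by
  refine ⟨fun v hv => ⟨S3.existsUnique_isMagneticField hv, S3.integrable_inner_BS hv,
    ⟨S3.integrable_leftIntegrand₁ hv, S3.integrable_leftIntegrand₂ hv,
      S3.integrable_leftIntegrand₃ hv, S3.helicity_eq_left hv⟩,
    S3.integrable_parIntegrand hv, S3.helicity_eq_par hv⟩, fun v hv hc => ?_⟩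
  exact ⟨H3.integrable_BSIntegrand hv hc, H3.integrable_dot_BS hv hc,
    H3.integrable_parIntegrand hv hc, H3.helicity_eq_par hv hc⟩
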